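/- Let $I=[0,1]$, let $\mathrm{Homeo}_+(I)$ be the group of orientation preserving homeomorphisms of $I$, and let $F$ be Thompson's group of piecewise linear homeomorphisms of $I$ that are affine, with slopes powers of $2$, off a finite set of dyadic rationals. The class of *elementary amenable* groups is the smallest class that contains the finite groups and the abelian groups and is closed under extensions, directed unions, subgroups and quotients. *Marked and fast functions.* For $f\in\mathrm{Homeo}_+(I)$, the *orbitals* of $f$ are the components of its support $\{t: f(t)\neq t\}$, its *transition points* are the end points of the orbitals, and its *extended support* is the interior of the closure of its support. The restriction of $f$ to an orbital is a *bump* of $f$; it is positive if $f(t)>t$ there, and negative otherwise. A *marked function* is an $f$ with a chosen point $s$ (a *marker*) in each of its orbitals $(u,v)$; the *feet* of the bump are $(u,s)$ and $[t,v)$, where $t=f(s)$ if the bump is positive and $t=f^{-1}(s)$ if it is negative. A finite set of marked functions with finitely many bumps each is *fast* if no bump occurs in two of its elements and the feet of any two different bumps are disjoint. *Standard generating sets.* A marked function with finitely many bumps is *standard* if its extended support is a nonempty open interval, its positive bumps lie to the right of its negative bumps, and the number of positive bumps minus the number of negative bumps is $0$ or $1$. For standard $f,g$ write $f\ll g$ if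 the extended supports are disjoint with that of $f$ to the left of that of $g$, write $f\sqsubset g$ if the closure of the extended support of $f$ lies in the extended support of $g$, and write $f<g$ if $f\ll g$ or $f\sqsubset g$. If a standard $f$ has more than two orbitals, $f^\circ$ is the restriction of $f$ (with its markers) to all orbitals but the leftmost and the rightmost; otherwise $f^\circ$ is any positive bump, with any marker, whose support is the left foot of the positive bump of $f$. A pair $(f,g)$ of standard functions is a *standard pair* if $\{f,g\}$ is fast and either $f\ll g$, or $f\sqsubset g$ and $(g^\circ,f)$ is a standard pair (a recursive definition). A *standard generating set* is a finite set of standard functions any two of which form, in one of the two orders, a standard pair; it is then totally ordered by $<$. *Signatures.* For $f<g$ let $o(f,g)$ be the number of orbitals of $g$ that contain a transition point of $f$. The *signature* of a standard generating set $a_0<\dots<a_{n-1}$ is the function $(i,j)\mapsto o(a_i,a_j)$ on the pairs $0\le i<j<n$. For functions $\mathbf a,\mathbf b$ on the pairs of $\{0,\dots,m-1\}$ and $\{0,\dots,n-1\}$, let $\mathbf a+\mathbf b$ be the function on the pairs of $\{0,\dots,m+n-1\}$ that is $\mathbf a$ on the first $m$ indices, $\mathbf b$ on the last $n$, and $0$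 on mixed pairs, and let $\exp(\mathbf a)=\mathbf a+1$ pointwise. Let $\mathbf 0$ and $\mathbf 1$ be the functions with base of size $0$ and $1$. For $\xi<\epsilon_0$ with Cantor normal form $\xi=\omega^{\beta_0}+\dots+\omega^{\beta_k}$, $\beta_0\ge\dots\ge\beta_k$, define recursively $R_0=\mathbf 0$ and $R_\xi=E_0+\dots+E_k$, where $E_i=\mathbf 1$ if $\beta_i=0$ and $E_i=\exp(R_{1+\beta_i})$ if $\beta_i>0$. **Proposition.** For every ordinal $\xi<\epsilon_0$ there is a standard generating set $A$ with signature $R_\xi$, and for every such $A$ the group $G_\xi=\langle A\rangle\le\mathrm{Homeo}_+(I)$ is elementary amenable; in particular it contains no subgroup isomorphic to $F$. More generally, the group $\langle A\rangle$ generated by any standard generating set $A$ is elementary amenable. -/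

import Mathlib

open scoped unitInterval Topology

/-! ### Elementary amenable groups -/

/-- The smallest class of groups that contains the finite and the abelian groups and is closed under
extensions, directed unions, subgroups and quotients (and, as every class of groups, under
isomorphism: a subgroup is a group with an injective homomorphism, a quotient is a group with
a surjective homomorphism onto it). -/
inductive IsElementaryAmenable : (G : Type) → [Group G] → Prop
  | of_finite (G : Type) [Group G] (h : Finite G) : IsElementaryAmenable G
  | of_abelian (G : Type) [Group G] (h : ∀ a b : G, a * b = b * a) : IsElementaryAmenable G
  | extension (G : Type) [Group G] (N : Subgroup G) [N.Normal]
      (hN : IsElementaryAmenable N) (hQ : IsElementaryAmenable (G ⧸ N)) : IsElementaryAmenable G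
  | directedUnion (G : Type) [Group G] (𝓗 : Set (Subgroup G))
      (hdir : DirectedOn (· ≤ ·) 𝓗) (hcover : ∀ g : G, ∃ H ∈ 𝓗, g ∈ H)
      (h : ∀ H ∈ 𝓗, IsElementaryAmenable H) : IsElementaryAmenable G
  | subgroup (G H : Type) [Group G] [Group H] (φ : H →* G) (hφ : Function.Injective φ)
      (h : IsElementaryAmenable G) : IsElementaryAmenable H
  | quotient (G Q : Type) [Group G] [Group Q] (φ : G →* Q) (hφ : Function.Surjective φ)
      (h : IsElementaryAmenable G) : IsElementaryAmenable Q

/-! ### Thompson's group `F`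

The group of orientation preserving homeomorphisms of `I = [0, 1]` is the group `I ≃o I` of
order automorphisms of the unit interval. -/

/-- Dyadic rational numbers. -/
def IsDyadic (x : ℝ) : Prop := ∃ (m : ℤ) (n : ℕ), x = m / 2 ^ n

/-- `f` is affine near `x` with slope an integral power of `2`. -/
def IsAffineNear (f : I ≃o I) (x : I) : Prop :=
  ∃ (k : ℤ) (c : ℝ), ∀ᶠ y : I in 𝓝 x, (f y : ℝ) = 2 ^ k * (y : ℝ) + c

/-- Thompson's group `F`: the piecewise linear homeomorphisms of `[0, 1]` that are affine off a
finite set of dyadic rationals, with all slopes powers of `2`.  The first clause of the carrier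
follows from the second; it is kept because it makes the group laws immediate. -/
def thompsonF : Subgroup (I ≃o I) where
  carrier := {f | (∀ x : I, IsDyadic (f x) ↔ IsDyadic x) ∧
    ∃ s : Set I, s.Finite ∧ (∀ p ∈ s, IsDyadic p) ∧ ∀ x ∉ s, IsAffineNear f x}
  one_mem' := by
    refine ⟨fun x => Iff.rfl, ∅, Set.finite_empty, by simp, fun x _ => ⟨0, 0, ?_⟩⟩
    exact Filter.Eventually.of_forall fun y => by simp
  mul_mem' := by
    rintro f g ⟨hf, s, hs, hsd, hsa⟩ ⟨hg, t, ht, htd, hta⟩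
    refine ⟨fun x => (hf (g x)).trans (hg x), t ∪ g ⁻¹' s,
      ht.union (hs.preimage g.injective.injOn), ?_, ?_⟩
    · rintro p (hp | hp)
      · exact htd p hp
      · exact (hg p).1 (hsd _ hp)
    · intro x hx
      obtain ⟨k, c, hk⟩ := hta x fun h => hx (Or.inl h)
      obtain ⟨l, d, hl⟩ := hsa (g x) fun h => hx (Or.inr h)
      refine ⟨l + k, 2 ^ l * c + d, ?_⟩
      filter_upwards [hk, g.continuous.continuousAt.eventually hl] with y h1 h2
      change ((f (g y) : I) : ℝ) = _
      rw [h2, h1, zpow_add₀ (by norm_num)]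
      ring
  inv_mem' := by
    rintro f ⟨hf, s, hs, hsd, hsa⟩
    have hinv : ∀ x : I, f ((f⁻¹ : I ≃o I) x) = x := fun x => f.apply_symm_apply x
    refine ⟨fun x => ?_, f '' s, hs.image f, ?_, ?_⟩
    · rw [← hf, hinv]
    · rintro _ ⟨p, hp, rfl⟩
      exact (hf p).2 (hsd p hp)
    · intro x hx
      obtain ⟨k, c, hk⟩ := hsa ((f⁻¹ : I ≃o I) x) fun h => hx ⟨_, h, hinv x⟩
      refine ⟨-k, -(2 ^ (-k) * c), ?_⟩
      filter_upwards [(f⁻¹ : I ≃o I).continuous.continuousAt.eventually hk] with y h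
      rw [hinv] at h
      rw [h, mul_add, ← mul_assoc, ← zpow_add₀ (by norm_num)]
      simp

/-! ### Marked functions -/

/-- The orbitals of `f`, that is, the components of its support, an orbital `(u, v)` being
represented by the pair of its end points. -/
def orbitals (f : I ≃o I) : Set (I × I) :=
  {J | J.1 < J.2 ∧ f J.1 = J.1 ∧ f J.2 = J.2 ∧ ∀ t ∈ Set.Ioo J.1 J.2, f t ≠ t}

/-- The extended support of `f`: the interior (in `ℝ`) of the closure of its support. -/
def extSupport (f : I ≃o I) : Set ℝ :=
  interior (closure ((fun t : I => (t : ℝ)) '' {t | f t ≠ t}))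

/-- The end points of the orbitals of `f`. -/
def transitionPoints (f : I ≃o I) : Set I :=
  {t | ∃ J ∈ orbitals f, t = J.1 ∨ t = J.2}

/-- The orbitals on which `f` is a positive bump. -/
def posOrbitals (f : I ≃o I) : Set (I × I) :=
  {J ∈ orbitals f | ∀ t ∈ Set.Ioo J.1 J.2, t < f t}

/-- The orbitals on which `f` is a negative bump. -/
def negOrbitals (f : I ≃o I) : Set (I × I) :=
  {J ∈ orbitals f | ∀ t ∈ Set.Ioo J.1 J.2, f t < t}

/-- A homeomorphism of the unit interval with a marker in each of its orbitals. -/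
structure MarkedFunction where
  fn : I ≃o I
  mark : orbitals fn → I
  mark_mem : ∀ J : orbitals fn, mark J ∈ Set.Ioo J.1.1 J.1.2

/-- The left foot `(u, s)` of the bump of `f` with orbital `(u, v)` and marker `s`. -/
def MarkedFunction.leftFoot (f : MarkedFunction) (J : orbitals f.fn) : Set I :=
  Set.Ioo J.1.1 (f.mark J)

open Classical in
/-- The right foot `[t, v)` of the bump of `f` with orbital `(u, v)` and marker `s`, where `t` is the
image of `s` under the bump if it is positive, and under its inverse if it is negative. -/
noncomputable def MarkedFunction.rightFoot (f : MarkedFunction) (J : orbitals f.fn) : Set I :=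
  Set.Ico (if J.1 ∈ posOrbitals f.fn then f.fn (f.mark J) else f.fn.symm (f.mark J)) J.1.2

/-- The union of the two feet of a bump of `f`. -/
noncomputable def MarkedFunction.feet (f : MarkedFunction) (J : orbitals f.fn) : Set I :=
  f.leftFoot J ∪ f.rightFoot J

/-- A finite set of marked functions, each with finitely many bumps, is fast if the feet of
different bumps are disjoint.  Bumps of `S` are counted with the element of `S` in which they occur,
so that a bump that occurs in two elements is excluded. -/
def IsFast (S : Set MarkedFunction) : Prop :=
  S.Finite ∧ (∀ f ∈ S, (orbitals f.fn).Finite) ∧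
    ∀ f ∈ S, ∀ g ∈ S, ∀ (J : orbitals f.fn) (K : orbitals g.fn),
      (f ≠ g ∨ J.1 ≠ K.1) → Disjoint (f.feet J) (g.feet K)

/-! ### Standard functions, standard pairs, standard generating sets -/

/-- Standard functions.  The extended support is a nonempty open interval. -/
def IsStandardFunction (f : MarkedFunction) : Prop :=
  (orbitals f.fn).Finite ∧
  (∃ u v : ℝ, u < v ∧ extSupport f.fn = Set.Ioo u v) ∧
  (∀ J ∈ posOrbitals f.fn, ∀ K ∈ negOrbitals f.fn, K.2 ≤ J.1) ∧
  (negOrbitals f.fn).ncard ≤ (posOrbitals f.fn).ncard ∧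
  (posOrbitals f.fn).ncard ≤ (negOrbitals f.fn).ncard + 1

/-- `f ≪ g`: the extended supports are disjoint and that of `f` is to the left of that of `g`. -/
def LeftOf (f g : MarkedFunction) : Prop :=
  ∀ x ∈ extSupport f.fn, ∀ y ∈ extSupport g.fn, x < y

/-- `f ⊏ g`: the closure of the extended support of `f` lies in the extended support of `g`. -/
def NestedIn (f g : MarkedFunction) : Prop :=
  closure (extSupport f.fn) ⊆ extSupport g.fn

/-- The order `f < g` on standard functions. -/
def Precedes (f g : MarkedFunction) : Prop := LeftOf f g ∨ NestedIn f g

/-- `f'` is a possible value of the reduction `f°` of the standard function `f`.  If `f` has more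
than two orbitals, `f°` is the restriction of `f` to its orbitals other than the leftmost and the
rightmost one, with the markers of `f`; if `f` has one or two orbitals, `f°` is any positive bump,
with any marker, whose support is the left foot of the positive orbital of `f`. -/
def IsReduction (f f' : MarkedFunction) : Prop :=
  (2 < (orbitals f.fn).ncard ∧
    orbitals f'.fn =
      {J ∈ orbitals f.fn |
        (∃ K ∈ orbitals f.fn, K.1 < J.1) ∧ ∃ K ∈ orbitals f.fn, J.1 < K.1} ∧
    ∀ (J : I × I) (h : J ∈ orbitals f.fn) (h' : J ∈ orbitals f'.fn),
      f'.mark ⟨J, h'⟩ = f.mark ⟨J, h⟩ ∧ ∀ t ∈ Set.Ioo J.1 J.2, f'.fn t = f.fn t) ∨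
  ((orbitals f.fn).ncard ≤ 2 ∧
    ∃ J : orbitals f.fn, J.1 ∈ posOrbitals f.fn ∧
      orbitals f'.fn = {(J.1.1, f.mark J)} ∧ posOrbitals f'.fn = {(J.1.1, f.mark J)})

/-- Standard pairs of standard functions. -/
inductive IsStandardPair : MarkedFunction → MarkedFunction → Prop
  | left (f g : MarkedFunction) (hf : IsStandardFunction f) (hg : IsStandardFunction g)
      (hfast : IsFast {f, g}) (h : LeftOf f g) : IsStandardPair f g
  | nested (f g g' : MarkedFunction) (hf : IsStandardFunction f) (hg : IsStandardFunction g)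
      (hfast : IsFast {f, g}) (h : NestedIn f g) (hg' : IsReduction g g')
      (hpair : IsStandardPair g' f) : IsStandardPair f g

/-- Standard generating sets: finite sets of standard functions that are pairwise standard. -/
def IsStandardGeneratingSet (A : Set MarkedFunction) : Prop :=
  A.Finite ∧ (∀ f ∈ A, IsStandardFunction f) ∧
    ∀ f ∈ A, ∀ g ∈ A, f ≠ g → IsStandardPair f g ∨ IsStandardPair g f

/-- The group of homeomorphisms generated by a set of marked functions. -/
def generatedGroup (A : Set MarkedFunction) : Subgroup (I ≃o I) :=
  Subgroup.closure (MarkedFunction.fn '' A)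

/-! ### Signatures -/

/-- The oscillation `o(f, g)`, for `f < g`: the number of orbitals of `g` that contain a transition
point of `f`. -/
noncomputable def osc (f g : MarkedFunction) : ℕ :=
  {K ∈ orbitals g.fn | ∃ t ∈ transitionPoints f.fn, t ∈ Set.Ioo K.1 K.2}.ncard

/-- A function on the pairs `i < j` from the base `{0, …, size - 1}`.  The values at other pairs
carry no information. -/
structure Sig where
  size : ℕ
  val : ℕ → ℕ → ℕ

/-- The signature with empty base. -/
def Sig.zero : Sig := ⟨0, fun _ _ => 0⟩

/-- The signature whose base is a singleton. -/
def Sig.one : Sig := ⟨1, fun _ _ => 0⟩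

/-- The sum: the base of `a` followed by the base of `b`, with value `0` at mixed pairs. -/
def Sig.add (a b : Sig) : Sig where
  size := a.size + b.size
  val i j :=
    if i < a.size ∧ j < a.size then a.val i j
    else if a.size ≤ i ∧ a.size ≤ j then b.val (i - a.size) (j - a.size)
    else 0

/-- The exponential: the same base, with all values increased by `1`. -/
def Sig.exp (a : Sig) : Sig := ⟨a.size, fun i j => a.val i j + 1⟩

/-- The signature of `A` is (equivalent to) `a`: the oscillations of the pairs of elements of `A`,
enumerated in increasing order, are the values of `a`. -/
def HasSignature (A : Set MarkedFunction) (a : Sig) : Prop :=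
  ∃ e : Fin a.size → MarkedFunction, Set.range e = A ∧
    ∀ i j : Fin a.size, i < j →
      Precedes (e i) (e j) ∧ osc (e i) (e j) = a.val i j

open Ordinal in
/-- The reduced signature of an ordinal `ξ < ε₀`: the Cantor normal form
`ξ = ω ^ β₀ + ω ^ β₁ + ⋯`, `β₀ ≥ β₁ ≥ ⋯`, evaluated in signatures, the term `ω ^ β` being read as
`1` if `β = 0` and as the exponential of the signature of `1 + β` otherwise (so that `exp` plays the
role of `ζ ↦ ω ^ (-1 + ζ)`).  Here `log ω ξ = β₀` and `ξ - ω ^ β₀ = ω ^ β₁ + ⋯`.  For `0 < ξ < ε₀` the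
condition `1 + β₀ < ξ` fails only for `ξ = 1`, where the term is `1`; for `ξ > 1` with `β₀ = 0` the
term is `exp 1`, which is equivalent to `1`. -/
noncomputable def reducedSignature (ξ : Ordinal.{0}) : Sig :=
  if h0 : ξ = 0 then Sig.zero
  else
    Sig.add
      (if _h : 1 + log ω ξ < ξ then (reducedSignature (1 + log ω ξ)).exp else Sig.one)
      (reducedSignature (ξ - ω ^ log ω ξ))
termination_by ξ
decreasing_by
  · exact _h
  · exact sub_omega0_opow_log_lt h0

/-! Three facts are combined: `⟨A⟩` is elementary amenable for every standard generating set `A`;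
`F` is not elementary amenable, hence embeds in no such group; every `R_ξ` is the signature of some
`A`.

Amenability of `⟨A⟩`. A standard function expands away from its centre: negative bumps on the left,
positive ones on the right. A standard pair `f < g` amounts to a level `t` (`HasLevel`): intervals
between outer transition points of `g` and `f` are nested alternately `t + 1` times. Levels satisfy
two ultrametric inequalities. Let `g` be the largest generator. If some generator has level `0` with
`g`, the generators split into two commuting families. Otherwise `⟨A⟩` is contained in an extension,
with cyclic quotient, of the directed union of the groups generated by finitely many conjugates of
the smaller generators by powers of `g` (`closure_insert`). As feet are disjoint, `g` throws every
transition point of a smaller generator into or across the feet of `g`; so the conjugates again form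
a family with disjoint feet, and the level of `x` in one copy with `y` in a later copy is `min (ℓ x
g) (ℓ y g - 1)` (`hasLevel_conj_pow`, `disjoint_conj_pow`).

This recursion ends because an ordinal rank drops. The rank of `x` from level `t` on is the natural
sum of `ω` to its rank from level `t + 1` on and the largest sum of such powers over a chain of
elements at level exactly `t` with `x`. In a chain of copies, the elements at level exactly `t` with
`g` all lie in one copy and are accounted for by a chain below `g`; the others have, inductively,
smaller exponents than `g`. So each copy has smaller rank than `g`, and any finite number of copies
has total rank below the single term `ω ^ rank g` (`IsCopySystem.levelRank_lt`,
`IsCopySystem.totalRank_lt`).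

`F` is not elementary amenable. If noncommuting `a`, `b` satisfy the two relations of `F`, then the
normal closure of `⁅a, b⁆` contains another such pair (`IsThompsonPair.derived`). Hence having such
a pair in some section passes from an extension to its kernel or its quotient. It is inherited from
subgroups and quotients, passes to a member of a directed union, and fails in finite and in abelian
groups. Two overlapping bumps give such a pair in `F`.

Existence. Functions are drawn as diagrams with integral transition points. Juxtaposition realizes
the sum of signatures; reflecting and adding an outer orbital to each function raises all levels by
one, which realizes `exp` (`Level.extend`). A diagram is realized with feet so short that fastness
is automatic, and then levels are oscillations (`HasLevel.osc_eq`). -/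

/-! ### Iterated well-orders -/

/-- The `d`-th iterate of `T ↦ (T →₀ ℕ)`, ordered colexicographically: a copy of the ordinal
`ω ^ ω ^ ⋯ ^ ω`, with addition the natural sum. -/
def OrdTower : ℕ → Type
  | 0 => Unit
  | d + 1 => Colex (OrdTower d →₀ ℕ)

namespace OrdTower

noncomputable instance instLinearOrder : (d : ℕ) → LinearOrder (OrdTower d)
  | 0 => inferInstanceAs (LinearOrder Unit)
  | d + 1 =>
    have := instLinearOrder d
    inferInstanceAs (LinearOrder (Colex (OrdTower d →₀ ℕ)))

instance instWellFoundedLT : (d : ℕ) → WellFoundedLT (OrdTower d)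
  | 0 => inferInstanceAs (WellFoundedLT Unit)
  | d + 1 =>
    have := instWellFoundedLT d
    inferInstanceAs (WellFoundedLT (Colex (OrdTower d →₀ ℕ)))

noncomputable instance (d : ℕ) : AddCommMonoid (OrdTower (d + 1)) :=
  inferInstanceAs (AddCommMonoid (Colex (OrdTower d →₀ ℕ)))

instance (d : ℕ) : IsOrderedCancelAddMonoid (OrdTower (d + 1)) :=
  inferInstanceAs (IsOrderedCancelAddMonoid (Colex (OrdTower d →₀ ℕ)))

noncomputable instance (d : ℕ) : OrderBot (OrdTower (d + 1)) :=
  inferInstanceAs (OrderBot (Colex (OrdTower d →₀ ℕ)))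

/-- The power `ω ^ a`. -/
noncomputable def omegaPow {d : ℕ} (a : OrdTower d) : OrdTower (d + 1) :=
  toColex (Finsupp.single a 1)

theorem omegaPow_le_omegaPow {d : ℕ} {a b : OrdTower d} (h : a ≤ b) : omegaPow a ≤ omegaPow b :=
  Finsupp.Colex.single_le_iff.2 h

theorem zero_le {d : ℕ} (a : OrdTower (d + 1)) : 0 ≤ a :=
  bot_le (α := Colex (OrdTower d →₀ ℕ))

/-- The left side has coefficient `0` at every exponent from `a` on, and the colexicographic order
is decided at the largest exponent where the coefficients differ. This is the additive
indecomposability of `ω ^ a`. -/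
theorem _root_.Finsupp.Colex.sum_single_lt {T κ : Type*} [LinearOrder T] (s : Finset κ) (φ : κ → T)
    (a : T) (h : ∀ i ∈ s, φ i < a) :
    ∑ i ∈ s, (toColex (Finsupp.single (φ i) 1) : Colex (T →₀ ℕ)) <
      toColex (Finsupp.single a 1) := by
  classical
  have hsum : ofColex (∑ i ∈ s, (toColex (Finsupp.single (φ i) 1) : Colex (T →₀ ℕ))) =
      ∑ i ∈ s, Finsupp.single (φ i) 1 := by
    clear h
    induction s using Finset.induction_on with
    | empty => rfl
    | insert a s ha ih =>
      rw [Finset.sum_insert ha, Finset.sum_insert ha, ← ih]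
      rfl
  have key : ∀ j, a ≤ j → (∑ i ∈ s, Finsupp.single (φ i) (1 : ℕ)) j = 0 := by
    intro j hj
    rw [Finsupp.finsetSum_apply]
    exact Finset.sum_eq_zero fun i hi =>
      Finsupp.single_eq_of_ne ((h i hi).trans_le hj).ne'
  refine Finsupp.Colex.lt_iff.2 ⟨a, fun j hj => ?_, ?_⟩
  · rw [hsum, key j hj.le]
    exact (Finsupp.single_eq_of_ne hj.ne').symm
  · rw [hsum, key a le_rfl, ofColex_toColex, Finsupp.single_eq_same]
    exact one_pos

theorem sum_omegaPow_lt {d : ℕ} {κ : Type*} (s : Finset κ) (φ : κ → OrdTower d) (a : OrdTower d)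
    (h : ∀ i ∈ s, φ i < a) : ∑ i ∈ s, omegaPow (φ i) < omegaPow a :=
  Finsupp.Colex.sum_single_lt s φ a h

theorem omegaPow_pos {d : ℕ} (a : OrdTower d) : 0 < omegaPow a := by
  simpa using sum_omegaPow_lt (∅ : Finset Unit) (fun _ => a) a (by simp)

end OrdTower

/-! ### The rank of a system of levels -/

section LevelRank

open OrdTower

variable {ι : Type*} [LinearOrder ι]

/-- All levels between elements of `L` are at least `t`. -/
def IsLevelChain (ℓ : ι → ι → ℕ) (t : ℕ) (L : Finset ι) : Prop :=
  ∀ x ∈ L, ∀ y ∈ L, x < y → t ≤ ℓ x y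

variable {κ : Type*} [LinearOrder κ]

/-- `ℓ'` is the system of levels of finitely many copies of the elements below `g`: `z` is the
element `pr z` in the copy with number `idx z`. -/
structure IsCopySystem (ℓ : ι → ι → ℕ) (g : ι) (ℓ' : κ → κ → ℕ) (idx : κ → ℕ) (pr : κ → ι) :
    Prop where
  pr_lt : ∀ z, pr z < g
  lt_iff : ∀ z w, z < w ↔ idx z < idx w ∨ idx z = idx w ∧ pr z < pr w
  inj : ∀ z w, idx z = idx w → pr z = pr w → z = w
  same : ∀ z w, z < w → idx z = idx w → ℓ' z w = ℓ (pr z) (pr w)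
  mixed : ∀ z w, idx z < idx w → ℓ' z w = min (ℓ (pr z) g) (ℓ (pr w) g - 1)

theorem IsCopySystem.chain_image [DecidableEq ι] {ℓ : ι → ι → ℕ} {g : ι} {ℓ' : κ → κ → ℕ}
    {idx : κ → ℕ} {pr : κ → ι} (h : IsCopySystem ℓ g ℓ' idx pr) {t : ℕ}
    {L : Finset κ} (hL : IsLevelChain ℓ' t L) (hi : ∀ z ∈ L, ∀ w ∈ L, idx z = idx w) :
    IsLevelChain ℓ t (L.image pr) := by
  intro a ha b hb hab
  obtain ⟨a, ha', rfl⟩ := Finset.mem_image.1 ha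
  obtain ⟨b, hb', rfl⟩ := Finset.mem_image.1 hb
  have hlt : a < b := (h.lt_iff _ _).2 (Or.inr ⟨hi a ha' b hb', hab⟩)
  rw [← h.same a b hlt (hi a ha' b hb')]
  exact hL a ha' b hb' hlt

variable [Fintype ι]

open Classical in
/-- The chains of level at least `t` all of whose elements have level `t` with `x`. -/
noncomputable def chainsAt (ℓ : ι → ι → ℕ) (t : ℕ) (x : ι) : Finset (Finset ι) :=
  Finset.univ.filter fun L => IsLevelChain ℓ t L ∧ ∀ y ∈ L, y < x ∧ ℓ y x = t

/-- The rank of `x` with respect to the levels `t, …, t + d - 1`. -/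
noncomputable def levelRank (ℓ : ι → ι → ℕ) : (d t : ℕ) → ι → OrdTower d
  | 0, _, _ => ()
  | d + 1, t, x =>
    (chainsAt ℓ t x).sup (fun L => ∑ y ∈ L, omegaPow (levelRank ℓ d (t + 1) y)) +
      omegaPow (levelRank ℓ d (t + 1) x)

/-- The total rank of a system of levels. -/
noncomputable def totalRank (ℓ : ι → ι → ℕ) (d : ℕ) : OrdTower (d + 1) :=
  ∑ x, omegaPow (levelRank ℓ d 1 x)

theorem mem_chainsAt {ℓ : ι → ι → ℕ} {t : ℕ} {x : ι} {L : Finset ι} :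
    L ∈ chainsAt ℓ t x ↔ IsLevelChain ℓ t L ∧ ∀ y ∈ L, y < x ∧ ℓ y x = t := by
  simp [chainsAt]

/-- The supremum over the finite set of chains is attained, as the order is linear and the empty
chain is available. -/
theorem exists_chain_levelRank (ℓ : ι → ι → ℕ) (d t : ℕ) (x : ι) :
    ∃ L ∈ chainsAt ℓ t x, levelRank ℓ (d + 1) t x =
      ∑ y ∈ L, omegaPow (levelRank ℓ d (t + 1) y) + omegaPow (levelRank ℓ d (t + 1) x) := by
  have hne : (chainsAt ℓ t x).Nonempty := ⟨∅, mem_chainsAt.2 ⟨by simp [IsLevelChain], by simp⟩⟩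
  obtain ⟨L, hL, h⟩ := Finset.exists_mem_eq_sup _ hne
    (fun L => ∑ y ∈ L, omegaPow (levelRank ℓ d (t + 1) y))
  exact ⟨L, hL, by rw [levelRank, h]⟩

theorem sum_add_le_levelRank (ℓ : ι → ι → ℕ) (d t : ℕ) (x : ι) {L : Finset ι}
    (hL : L ∈ chainsAt ℓ t x) :
    ∑ y ∈ L, omegaPow (levelRank ℓ d (t + 1) y) + omegaPow (levelRank ℓ d (t + 1) x) ≤
      levelRank ℓ (d + 1) t x := by
  rw [levelRank]
  exact add_le_add_left
    (Finset.le_sup (f := fun L => ∑ y ∈ L, omegaPow (levelRank ℓ d (t + 1) y)) hL) _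

variable [Fintype κ]

/-- An optimal chain of the subsystem stays a chain in the larger one. -/
theorem levelRank_comp_le (ℓ : ι → ι → ℕ) (φ : κ ↪o ι) (d t : ℕ) (x : κ) :
    levelRank (fun x y => ℓ (φ x) (φ y)) d t x ≤ levelRank ℓ d t (φ x) := by
  induction d generalizing t x with
  | zero => exact le_rfl
  | succ d ih =>
    obtain ⟨L, hL, h⟩ := exists_chain_levelRank (fun x y => ℓ (φ x) (φ y)) d t x
    rw [mem_chainsAt] at hL
    refine h.trans_le (le_trans ?_
      (sum_add_le_levelRank ℓ d t (φ x) (L := L.map φ.toEmbedding) ?_))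
    · rw [Finset.sum_map]
      exact add_le_add (Finset.sum_le_sum fun y _ => omegaPow_le_omegaPow (ih _ _))
        (omegaPow_le_omegaPow (ih _ _))
    · rw [mem_chainsAt]
      constructor
      · intro a ha b hb hab
        obtain ⟨a, ha', rfl⟩ := Finset.mem_map.1 ha
        obtain ⟨b, hb', rfl⟩ := Finset.mem_map.1 hb
        exact hL.1 a ha' b hb' (φ.lt_iff_lt.1 hab)
      · intro a ha
        obtain ⟨a, ha', rfl⟩ := Finset.mem_map.1 ha
        exact ⟨φ.lt_iff_lt.2 (hL.2 a ha').1, (hL.2 a ha').2⟩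

theorem totalRank_comp_lt (ℓ : ι → ι → ℕ) (φ : κ ↪o ι) (d : ℕ) (g : ι) (hg : ∀ x, φ x ≠ g) :
    totalRank (fun x y => ℓ (φ x) (φ y)) d < totalRank ℓ d := by
  classical
  have h1 : totalRank (fun x y => ℓ (φ x) (φ y)) d ≤
      ∑ x ∈ Finset.univ.map φ.toEmbedding, omegaPow (levelRank ℓ d 1 x) := by
    rw [Finset.sum_map]
    exact Finset.sum_le_sum fun y _ => omegaPow_le_omegaPow (levelRank_comp_le ℓ φ d 1 y)
  refine h1.trans_lt ?_
  rw [totalRank]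
  refine Finset.sum_lt_sum_of_subset (Finset.subset_univ _) (Finset.mem_univ g) ?_
    (omegaPow_pos _) fun _ _ _ => zero_le _
  simp only [Finset.mem_map, Finset.mem_univ, true_and, not_exists]
  exact hg

/-! ### Copying the elements below `g` lowers the rank -/

section Copies

variable {ℓ : ι → ι → ℕ} {g : ι} {ℓ' : κ → κ → ℕ} {idx : κ → ℕ} {pr : κ → ι}

/-- An element whose level with `g` is below `s` has level less than `s` with every element of an
earlier copy, so only its own copy contributes to its rank from `s` on. -/
theorem IsCopySystem.levelRank_le (h : IsCopySystem ℓ g ℓ' idx pr)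
    (ultra' : ∀ x y z, x < y → y < z → min (ℓ x y) (ℓ x z) ≤ ℓ y z)
    (d s : ℕ) (z : κ) (hz : ℓ (pr z) g < s) :
    levelRank ℓ' d s z ≤ levelRank ℓ d s (pr z) := by
  classical
  induction d generalizing s z with
  | zero => exact le_rfl
  | succ d ih =>
    obtain ⟨L, hL, hE⟩ := exists_chain_levelRank ℓ' d s z
    rw [mem_chainsAt] at hL
    -- A mixed level is at most `ℓ (pr z) g - 1 < s`.
    have hidx : ∀ w ∈ L, idx w = idx z := by
      intro w hw
      obtain ⟨h1, h2⟩ := hL.2 w hw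
      rcases (h.lt_iff _ _).1 h1 with h3 | h3
      · have := h.mixed w z h3
        omega
      · exact h3.1
    have hlt : ∀ w ∈ L, pr w < pr z := fun w hw => by
      rcases (h.lt_iff _ _).1 (hL.2 w hw).1 with h3 | h3
      · exact absurd (hidx w hw) h3.ne
      · exact h3.2
    have hlev : ∀ w ∈ L, ℓ (pr w) (pr z) = s := fun w hw => by
      rw [← h.same w z (hL.2 w hw).1 (hidx w hw), (hL.2 w hw).2]
    -- By `ultra'`, a level of `pr w` with `g` of at least `s` would force one of `pr z` with `g`.
    have hw' : ∀ w ∈ L, ℓ (pr w) g < s + 1 := fun w hw => by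
      have := ultra' (pr w) (pr z) g (hlt w hw) (h.pr_lt z)
      rw [hlev w hw] at this
      omega
    refine hE.trans_le (le_trans ?_
      (sum_add_le_levelRank ℓ d s (pr z) (L := L.image pr) ?_))
    · rw [Finset.sum_image]
      · exact add_le_add (Finset.sum_le_sum fun y hy => omegaPow_le_omegaPow (ih _ _ (hw' y hy)))
          (omegaPow_le_omegaPow (ih _ _ (by omega)))
      · intro a ha b hb hab
        exact h.inj a b ((hidx a ha).trans (hidx b hb).symm) hab
    · rw [mem_chainsAt]
      refine ⟨h.chain_image hL.1 fun a ha b hb => (hidx a ha).trans (hidx b hb).symm, ?_⟩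
      intro a ha
      obtain ⟨a, ha', rfl⟩ := Finset.mem_image.1 ha
      exact ⟨hlt a ha', hlev a ha'⟩

/-- Add `z` to its optimal chain and split the result by the level with `g`. The elements at level
exactly `t` project to a chain that competes in the rank of `g`; the others have, by induction on
the number of levels left, smaller exponents than `g`, so their sum is below the last term of the
rank of `g`. -/
theorem IsCopySystem.levelRank_lt (h : IsCopySystem ℓ g ℓ' idx pr)
    (ultra : ∀ x y z, x < y → y < z → min (ℓ x y) (ℓ y z) ≤ ℓ x z)
    (ultra' : ∀ x y z, x < y → y < z → min (ℓ x y) (ℓ x z) ≤ ℓ y z)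
    (d t : ℕ) (ht : 1 ≤ t) (hd : ∀ x < g, ℓ x g < t + d) (z : κ) (hz : t ≤ ℓ (pr z) g) :
    levelRank ℓ' d t z < levelRank ℓ d t g := by
  classical
  induction d generalizing t z with
  | zero => exact absurd (hd _ (h.pr_lt z)) (by omega)
  | succ d ih =>
    obtain ⟨L, hL, hE⟩ := exists_chain_levelRank ℓ' d t z
    rw [mem_chainsAt] at hL
    have hzL : z ∉ L := fun hz => lt_irrefl _ (hL.2 z hz).1
    rw [hE.trans ((add_comm _ _).trans
      (Finset.sum_insert (f := fun w => omegaPow (levelRank ℓ' d (t + 1) w)) hzL).symm)]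
    set X := insert z L with hX
    have hchain : IsLevelChain ℓ' t X := by
      intro a ha b hb hab
      rcases Finset.mem_insert.1 ha with ha' | ha' <;> rcases Finset.mem_insert.1 hb with hb' | hb'
      · exact absurd hab (by rw [ha', hb']; exact lt_irrefl _)
      · exact absurd (hab.trans (hL.2 b hb').1) (by rw [ha']; exact lt_irrefl _)
      · rw [hb']
        exact (hL.2 a ha').2.ge
      · exact hL.1 a ha' b hb' hab
    have hlev : ∀ w ∈ X, t ≤ ℓ (pr w) g := by
      intro w hw
      rcases Finset.mem_insert.1 hw with rfl | hw
      · exact hz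
      obtain ⟨h1, h2⟩ := hL.2 w hw
      rcases (h.lt_iff _ _).1 h1 with h3 | h3
      · have := h.mixed w z h3
        omega
      · have h4 := ultra _ _ _ h3.2 (h.pr_lt z)
        rw [← h.same w z h1 h3.1] at h4
        omega
    -- An element `w'` of an earlier copy would have level at most `t - 1` with `w`, which the chain
    -- condition forbids; here `1 ≤ t` matters, because the subtraction is truncated.
    have hlight : ∀ w ∈ X, ℓ (pr w) g = t → ∀ w' ∈ X, idx w ≤ idx w' := by
      intro w hw hwt w' hw'
      by_contra! hlt
      have h1 := h.mixed w' w hlt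
      have h2 := hchain w' hw' w hw ((h.lt_iff _ _).2 (Or.inl hlt))
      omega
    rw [← Finset.sum_filter_add_sum_filter_not X (fun w => ℓ (pr w) g = t)]
    have hsame : ∀ a ∈ X.filter (fun w => ℓ (pr w) g = t), ∀ b ∈ X.filter (fun w => ℓ (pr w) g = t),
        idx a = idx b := by
      intro a ha b hb
      rw [Finset.mem_filter] at ha hb
      exact le_antisymm (hlight a ha.1 ha.2 b hb.1) (hlight b hb.1 hb.2 a ha.1)
    refine lt_of_lt_of_le ?_ (sum_add_le_levelRank ℓ d t g
      (L := (X.filter fun w => ℓ (pr w) g = t).image pr) ?_)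
    -- Elements at level `t` with `g` are compared with their projections, all others with the
    -- single power of `g`.
    · refine add_lt_add_of_le_of_lt ?_ (sum_omegaPow_lt _ _ _ ?_)
      · rw [Finset.sum_image fun a ha b hb hab => h.inj a b (hsame a ha b hb) hab]
        refine Finset.sum_le_sum fun w hw => omegaPow_le_omegaPow (h.levelRank_le ultra' _ _ _ ?_)
        rw [Finset.mem_filter] at hw
        omega
      · intro w hw
        rw [Finset.mem_filter] at hw
        refine ih (t + 1) (by omega) (fun x hx => by have := hd x hx; omega) w ?_
        have := hlev w hw.1
        omega
    · rw [mem_chainsAt]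
      refine ⟨h.chain_image (fun a ha b hb => hchain a (Finset.mem_filter.1 ha).1 b
        (Finset.mem_filter.1 hb).1) hsame, ?_⟩
      intro a ha
      obtain ⟨a, ha', rfl⟩ := Finset.mem_image.1 ha
      exact ⟨h.pr_lt a, (Finset.mem_filter.1 ha').2⟩

/-- Every exponent on the left is below the rank of `g`, so the sum is below the one term of `g` on
the right, whatever the number of copies. -/
theorem IsCopySystem.totalRank_lt (h : IsCopySystem ℓ g ℓ' idx pr)
    (ultra : ∀ x y z, x < y → y < z → min (ℓ x y) (ℓ y z) ≤ ℓ x z)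
    (ultra' : ∀ x y z, x < y → y < z → min (ℓ x y) (ℓ x z) ≤ ℓ y z)
    (d : ℕ) (hd : ∀ x < g, ℓ x g < 1 + d) (hg : ∀ x < g, 1 ≤ ℓ x g) :
    totalRank ℓ' d < totalRank ℓ d := by
  refine lt_of_lt_of_le (sum_omegaPow_lt _ _ (levelRank ℓ d 1 g) fun z _ =>
    h.levelRank_lt ultra ultra' d 1 le_rfl hd z (hg _ (h.pr_lt z))) ?_
  exact Finset.single_le_sum (f := fun x => omegaPow (levelRank ℓ d 1 x))
    (fun _ _ => zero_le _) (Finset.mem_univ g)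

end Copies

end LevelRank

/-! ### Permanence properties of elementary amenability -/

namespace IsElementaryAmenable

variable {G : Type} [Group G]

theorem mono {H K : Subgroup G} (h : H ≤ K) (hK : IsElementaryAmenable K) :
    IsElementaryAmenable H :=
  .subgroup K H (Subgroup.inclusion h) (Subgroup.inclusion_injective h) hK

/-- `N` is normal in `N ⊔ H`, and the quotient is an image of `H`. -/
theorem sup {N H : Subgroup G} (hNH : H ≤ Subgroup.normalizer (N : Set G))
    (hN : IsElementaryAmenable N)
    (hH : IsElementaryAmenable H) : IsElementaryAmenable (N ⊔ H : Subgroup G) := by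
  have hnorm : (N.subgroupOf (N ⊔ H)).Normal :=
    (Subgroup.normal_subgroupOf_iff_le_normalizer le_sup_left).2
      (sup_le Subgroup.le_normalizer hNH)
  refine .extension _ (N.subgroupOf (N ⊔ H)) ?_ ?_
  · exact .subgroup N _ (Subgroup.subgroupOfEquivOfLe (le_sup_left (a := N) (b := H))).toMonoidHom
      (Subgroup.subgroupOfEquivOfLe (le_sup_left (a := N) (b := H))).injective hN
  · let φ : H →* (N ⊔ H : Subgroup G) ⧸ N.subgroupOf (N ⊔ H) :=
      (QuotientGroup.mk' _).comp (Subgroup.inclusion le_sup_right)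
    refine .quotient H _ φ ?_ hH
    have htop : N.subgroupOf (N ⊔ H) ⊔ H.subgroupOf (N ⊔ H) ≤
        φ.range.comap (QuotientGroup.mk' _) := by
      refine sup_le ?_ ?_
      · intro x hx
        rw [Subgroup.mem_comap]
        have h1 : QuotientGroup.mk' (N.subgroupOf (N ⊔ H)) x = 1 :=
          (QuotientGroup.eq_one_iff x).2 hx
        rw [h1]
        exact one_mem _
      · intro x hx
        exact ⟨⟨x, hx⟩, rfl⟩
    rw [← Subgroup.subgroupOf_sup le_sup_left le_sup_right, Subgroup.subgroupOf_self] at htop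
    intro y
    obtain ⟨x, rfl⟩ := QuotientGroup.mk'_surjective _ y
    exact htop (Subgroup.mem_top x)

theorem iSup_of_monotone {K : ℕ → Subgroup G} (hK : Monotone K)
    (h : ∀ m, IsElementaryAmenable (K m)) : IsElementaryAmenable (⨆ m, K m : Subgroup G) := by
  refine .directedUnion _ (Set.range fun m => (K m).subgroupOf (⨆ m, K m)) ?_ ?_ ?_
  · rintro _ ⟨m, rfl⟩ _ ⟨n, rfl⟩
    refine ⟨_, ⟨max m n, rfl⟩, ?_, ?_⟩
    · exact Subgroup.comap_mono (hK (le_max_left _ _))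
    · exact Subgroup.comap_mono (hK (le_max_right _ _))
  · rintro ⟨x, hx⟩
    obtain ⟨m, hm⟩ := (Subgroup.mem_iSup_of_directed hK.directed_le).1 hx
    exact ⟨_, ⟨m, rfl⟩, hm⟩
  · rintro _ ⟨m, rfl⟩
    exact .subgroup (K m) _ (Subgroup.subgroupOfEquivOfLe (le_iSup K m)).toMonoidHom
      (Subgroup.subgroupOfEquivOfLe (le_iSup K m)).injective (h m)

theorem map {H : Type} [Group H] {K : Subgroup G} (φ : G →* H) (h : IsElementaryAmenable K) :
    IsElementaryAmenable (K.map φ) :=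
  .quotient K _ (φ.subgroupMap K) (φ.subgroupMap_surjective K) h

theorem of_commute {S T : Set G} (hST : ∀ s ∈ S, ∀ t ∈ T, s * t = t * s)
    (hS : IsElementaryAmenable (Subgroup.closure S))
    (hT : IsElementaryAmenable (Subgroup.closure T)) :
    IsElementaryAmenable (Subgroup.closure (S ∪ T)) := by
  rw [Subgroup.closure_union]
  refine sup ?_ hS hT
  have h1 : Subgroup.closure T ≤ Subgroup.centralizer (Subgroup.closure S : Set G) := by
    rw [Subgroup.centralizer_closure, Subgroup.closure_le]
    intro t ht
    exact Subgroup.mem_centralizer_iff.2 fun s hs => hST s hs t ht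
  exact h1.trans (Subgroup.centralizer_le_normalizer _)

/-- The set of conjugates of the elements of `S` by `g ^ i`, `i < k`. -/
def _root_.conjSet (g : G) (S : Set G) (k : ℕ) : Set G :=
  {x | ∃ i < k, ∃ s ∈ S, x = g ^ i * s * (g ^ i)⁻¹}

/-- The conjugates of `S` by all powers of `g` generate a group `N` normalized by `g`, and `N ⊔ ⟨g⟩`
is an extension of `N` with cyclic quotient. `N` is the increasing union of the groups generated by
the conjugates with exponents in `[-m, m]`; each is conjugate to one with exponents in `[0, 2 * m]`,
to which the hypothesis applies. -/
theorem closure_insert (g : G) (S : Set G)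
    (h : ∀ k, IsElementaryAmenable (Subgroup.closure (conjSet g S k))) :
    IsElementaryAmenable (Subgroup.closure (insert g S)) := by
  let K : ℕ → Subgroup G := fun m =>
    (Subgroup.closure (conjSet g S (2 * m + 1))).map (MulAut.conj (g⁻¹ ^ m)).toMonoidHom
  have hKle : ∀ (m : ℕ) (H : Subgroup G), (∀ i < 2 * m + 1, ∀ s ∈ S,
      g ^ ((i : ℤ) - m) * s * (g ^ ((i : ℤ) - m))⁻¹ ∈ H) → K m ≤ H := by
    intro m H hH
    rw [Subgroup.map_le_iff_le_comap, Subgroup.closure_le]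
    rintro _ ⟨i, hi, s, hs, rfl⟩
    have := hH i hi s hs
    rw [zpow_sub, zpow_natCast, zpow_natCast] at this
    simp only [SetLike.mem_coe, Subgroup.mem_comap, MulEquiv.coe_toMonoidHom, MulAut.conj_apply]
    convert this using 1
    rw [((Commute.refl g).pow_pow i m).inv_right.eq]
    group
  have hmem : ∀ (m : ℕ) (j : ℤ) (s : G), s ∈ S → -(m : ℤ) ≤ j → j ≤ m →
      g ^ j * s * (g ^ j)⁻¹ ∈ K m := by
    intro m j s hs h1 h2
    refine ⟨_, Subgroup.subset_closure ⟨(j + m).toNat, by omega, s, hs, rfl⟩, ?_⟩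
    simp only [MulEquiv.coe_toMonoidHom, MulAut.conj_apply]
    rw [← zpow_natCast g, Int.toNat_of_nonneg (by omega)]
    group
  have hmono : Monotone K := by
    refine monotone_nat_of_le_succ fun m => hKle m _ fun i hi s hs => ?_
    exact hmem _ _ s hs (by push_cast; omega) (by push_cast; omega)
  have hN := iSup_of_monotone hmono fun m => (h (2 * m + 1)).map _
  have hdir := hmono.directed_le
  -- Such a conjugation carries `K m` into `K (m + 1)`; the exponents `1` and `-1` suffice for
  -- normalization.
  have hconj : ∀ j : ℤ, -1 ≤ j → j ≤ 1 → ∀ x ∈ (⨆ m, K m), g ^ j * x * (g ^ j)⁻¹ ∈ (⨆ m, K m) := by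
    intro j h1 h2 x hx
    obtain ⟨m, hm⟩ := (Subgroup.mem_iSup_of_directed hdir).1 hx
    have : K m ≤ (⨆ m, K m).comap (MulAut.conj (g ^ j)).toMonoidHom := by
      refine hKle m _ fun i hi s hs => ?_
      refine Subgroup.mem_iSup_of_mem (m + 1) ?_
      have := hmem (m + 1) (j + (i - m)) s hs (by push_cast; omega) (by push_cast; omega)
      simp only [MulEquiv.coe_toMonoidHom, MulAut.conj_apply]
      convert this using 1
      rw [zpow_add]
      group
    exact this hm
  have hcyc : IsElementaryAmenable (Subgroup.zpowers g) :=
    .of_abelian _ fun a b => (Subgroup.zpowers_isMulCommutative g).is_comm.comm a b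
  refine mono ?_ (sup ?_ hN hcyc)
  · rw [Subgroup.closure_le]
    rintro x (rfl | hx)
    · exact Subgroup.mem_sup_right (Subgroup.mem_zpowers _)
    · refine Subgroup.mem_sup_left (Subgroup.mem_iSup_of_mem 0 ?_)
      simpa using hmem 0 0 x hx (by simp) (by simp)
  · rw [Subgroup.zpowers_le, Subgroup.mem_normalizer_iff]
    intro x
    refine ⟨fun hx => by simpa using hconj 1 (by simp) (by simp) x hx, fun hx => ?_⟩
    have := hconj (-1) (by simp) (by simp) _ hx
    simpa [mul_assoc] using this

end IsElementaryAmenable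

/-! ### Expanding maps

A standard function moves points away from its centre, the point between its negative and its
positive bumps.  We record its transition points, counted from the outside, and its (open) feet. -/

/-- A homeomorphism with its transition points `l 0 < l 1 < ⋯` counted from the left and
`r 0 > r 1 > ⋯` counted from the right, up to the centre, and a set of feet. -/
structure ExpandingMap where
  fn : I ≃o I
  l : ℕ → I
  r : ℕ → I
  F : Set I

/-- The laws of an expanding map. -/
structure ExpandingMap.IsExpanding (e : ExpandingMap) : Prop where
  mono : Monotone e.l
  anti : Antitone e.r
  le : ∀ i j, e.l i ≤ e.r j
  meet : ∃ n, e.l n = e.r n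
  lt : e.l 0 < e.r 0
  support : ∀ x, x ≤ e.l 0 ∨ e.r 0 ≤ x → e.fn x = x
  fix_l : ∀ i, e.fn (e.l i) = e.l i
  fix_r : ∀ i, e.fn (e.r i) = e.r i
  move_l : ∀ i x, e.l i ≤ x → x ≤ e.l (i + 1) → e.fn x ≤ x
  move_r : ∀ i x, e.r (i + 1) ≤ x → x ≤ e.r i → x ≤ e.fn x
  F_open : IsOpen e.F
  F_sub : e.F ⊆ Set.Ioo (e.l 0) (e.r 0)
  foot_l : ∀ i, ∃ x, e.l i < x ∧ Set.Ioo (e.l i) x ⊆ e.F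
  foot_r : ∀ i, e.r i = e.l 0 ∨ ∃ x, x < e.r i ∧ Set.Ioo x (e.r i) ⊆ e.F
  bump_l : ∀ i, e.l i < e.l (i + 1) → ∃ α β, e.l i < α ∧ α < β ∧ β < e.l (i + 1) ∧
    e.fn β = α ∧ Set.Ioo (e.l i) α ⊆ e.F ∧ Set.Ioo β (e.l (i + 1)) ⊆ e.F
  bump_r : ∀ i, e.r (i + 1) < e.r i → ∃ γ δ, e.r (i + 1) < γ ∧ γ < δ ∧ δ < e.r i ∧
    e.fn γ = δ ∧ Set.Ioo (e.r (i + 1)) γ ⊆ e.F ∧ Set.Ioo δ (e.r i) ⊆ e.F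

/-- `f` precedes `g` with oscillation `t`: the `t + 1` intervals
`(g.l 0, g.r 0) ⊐ (f.l 0, f.r 0) ⊐ (g.l 1, g.r 1) ⊐ (f.l 1, f.r 1) ⊐ ⋯` are nested, and the next one
lies to the left of the last of these. -/
structure HasLevel (t : ℕ) (f g : ExpandingMap) : Prop where
  l_lt : ∀ i, 2 * i + 1 ≤ t → g.l i < f.l i
  r_lt : ∀ i, 2 * i + 1 ≤ t → f.r i < g.r i
  l_lt' : ∀ i, 2 * i + 2 ≤ t → f.l i < g.l (i + 1)
  r_lt' : ∀ i, 2 * i + 2 ≤ t → g.r (i + 1) < f.r i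
  even : ∀ i, t = 2 * i → f.r i ≤ g.l i
  odd : ∀ i, t = 2 * i + 1 → g.r (i + 1) ≤ f.l i

namespace ExpandingMap

/-- The conjugate of `e` by `w`. -/
def conj (w : I ≃o I) (e : ExpandingMap) : ExpandingMap where
  fn := w * e.fn * w⁻¹
  l i := w (e.l i)
  r i := w (e.r i)
  F := w '' e.F

theorem conj_fn_apply (w : I ≃o I) (e : ExpandingMap) (x : I) :
    (e.conj w).fn (w x) = w (e.fn x) := by
  change w (e.fn (w.symm (w x))) = _
  rw [OrderIso.symm_apply_apply]

theorem IsExpanding.conj {e : ExpandingMap} (h : e.IsExpanding) (w : I ≃o I) :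
    (e.conj w).IsExpanding where
  mono _ _ hij := w.monotone (h.mono hij)
  anti _ _ hij := w.monotone (h.anti hij)
  le i j := w.monotone (h.le i j)
  meet := h.meet.imp fun _ hn => congrArg w hn
  lt := w.strictMono h.lt
  support x := by
    obtain ⟨x, rfl⟩ := w.surjective x
    intro hx
    rw [conj_fn_apply, h.support]
    exact hx.imp w.le_iff_le.1 w.le_iff_le.1
  fix_l i := (conj_fn_apply w e _).trans (congrArg w (h.fix_l i))
  fix_r i := (conj_fn_apply w e _).trans (congrArg w (h.fix_r i))
  move_l i x := by
    obtain ⟨x, rfl⟩ := w.surjective x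
    intro h1 h2
    rw [conj_fn_apply]
    exact w.monotone (h.move_l i x (w.le_iff_le.1 h1) (w.le_iff_le.1 h2))
  move_r i x := by
    obtain ⟨x, rfl⟩ := w.surjective x
    intro h1 h2
    rw [conj_fn_apply]
    exact w.monotone (h.move_r i x (w.le_iff_le.1 h1) (w.le_iff_le.1 h2))
  F_open := w.toHomeomorph.isOpenMap _ h.F_open
  F_sub := by
    rintro _ ⟨x, hx, rfl⟩
    exact ⟨w.strictMono (h.F_sub hx).1, w.strictMono (h.F_sub hx).2⟩
  foot_l i := by
    obtain ⟨x, hx, hs⟩ := h.foot_l i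
    refine ⟨w x, w.strictMono hx, ?_⟩
    change Set.Ioo (w (e.l i)) (w x) ⊆ w '' e.F
    rw [← OrderIso.image_Ioo]
    exact Set.image_mono hs
  foot_r i := by
    rcases h.foot_r i with h0 | ⟨x, hx, hs⟩
    · exact Or.inl (congrArg w h0)
    · refine Or.inr ⟨w x, w.strictMono hx, ?_⟩
      change Set.Ioo (w x) (w (e.r i)) ⊆ w '' e.F
      rw [← OrderIso.image_Ioo]
      exact Set.image_mono hs
  bump_l i hi := by
    obtain ⟨α, β, h1, h2, h3, h4, h5, h6⟩ := h.bump_l i (w.lt_iff_lt.1 hi)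
    refine ⟨w α, w β, w.strictMono h1, w.strictMono h2, w.strictMono h3, ?_, ?_, ?_⟩
    · rw [conj_fn_apply, h4]
    · change Set.Ioo (w (e.l i)) (w α) ⊆ w '' e.F
      rw [← OrderIso.image_Ioo]
      exact Set.image_mono h5
    · change Set.Ioo (w β) (w (e.l (i + 1))) ⊆ w '' e.F
      rw [← OrderIso.image_Ioo]
      exact Set.image_mono h6
  bump_r i hi := by
    obtain ⟨α, β, h1, h2, h3, h4, h5, h6⟩ := h.bump_r i (w.lt_iff_lt.1 hi)
    refine ⟨w α, w β, w.strictMono h1, w.strictMono h2, w.strictMono h3, ?_, ?_, ?_⟩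
    · rw [conj_fn_apply, h4]
    · change Set.Ioo (w (e.r (i + 1))) (w α) ⊆ w '' e.F
      rw [← OrderIso.image_Ioo]
      exact Set.image_mono h5
    · change Set.Ioo (w β) (w (e.r i)) ⊆ w '' e.F
      rw [← OrderIso.image_Ioo]
      exact Set.image_mono h6

theorem conj_mul (v w : I ≃o I) (e : ExpandingMap) : e.conj (v * w) = (e.conj w).conj v := by
  simp only [conj, mul_inv_rev, mul_assoc, Set.image_image]
  rfl

end ExpandingMap

open ExpandingMap

theorem HasLevel.conj {t : ℕ} {f g : ExpandingMap} (h : HasLevel t f g) (w : I ≃o I) :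
    HasLevel t (f.conj w) (g.conj w) where
  l_lt i hi := w.strictMono (h.l_lt i hi)
  r_lt i hi := w.strictMono (h.r_lt i hi)
  l_lt' i hi := w.strictMono (h.l_lt' i hi)
  r_lt' i hi := w.strictMono (h.r_lt' i hi)
  even i hi := w.monotone (h.even i hi)
  odd i hi := w.monotone (h.odd i hi)

/-! ### Ultrametric inequalities -/

/-- If the nesting of `x` in `z` stopped earlier than the other two, the position of `x` relative to
`z` at that stage would contradict the one obtained by passing through `y`. -/
theorem HasLevel.ultra {x y z : ExpandingMap} (hx : x.IsExpanding) (hy : y.IsExpanding)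
    (hz : z.IsExpanding) {p q s : ℕ} (hxy : HasLevel p x y) (hyz : HasLevel q y z)
    (hxz : HasLevel s x z) : min p q ≤ s := by
  by_contra! hs
  obtain ⟨hp, hq⟩ := lt_min_iff.1 hs
  obtain ⟨i, hi | hi⟩ := Nat.even_or_odd' s
  · have h1 := hxz.even i hi
    have h2 := hxy.l_lt i (by omega)
    have h3 := hyz.l_lt i (by omega)
    exact absurd (h3.trans (h2.trans_le ((hx.le i i).trans h1))) (lt_irrefl _)
  · have h1 := hxz.odd i hi
    have h2 := hxy.l_lt' i (by omega)
    rcases Nat.lt_or_ge q (2 * i + 3) with h3 | h3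
    · have h4 := hyz.even (i + 1) (by omega)
      have h5 := hy.le (i + 1) (i + 1)
      have h6 := hz.le (i + 1) (i + 1)
      exact absurd (h2.trans_le (h5.trans (h4.trans (h6.trans h1)))) (lt_irrefl _)
    · have h4 := hyz.r_lt (i + 1) (by omega)
      have h5 := hy.le (i + 1) (i + 1)
      exact absurd (h2.trans_le (h5.trans (h4.le.trans h1))) (lt_irrefl _)

theorem HasLevel.ultra' {x y z : ExpandingMap} (hx : x.IsExpanding)
    (hz : z.IsExpanding) {p q s : ℕ} (hxy : HasLevel p x y) (hyz : HasLevel q y z)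
    (hxz : HasLevel s x z) : min p s ≤ q := by
  by_contra! hs
  obtain ⟨hp, hq⟩ := lt_min_iff.1 hs
  obtain ⟨i, hi | hi⟩ := Nat.even_or_odd' q
  · have h1 := hyz.even i hi
    have h2 := hxy.r_lt i (by omega)
    have h3 := hxz.l_lt i (by omega)
    exact absurd (h3.trans_le ((hx.le i i).trans (h2.le.trans h1))) (lt_irrefl _)
  · have h1 := hyz.odd i hi
    have h2 := hxy.l_lt i (by omega)
    have h3 := hxz.l_lt' i (by omega)
    exact absurd (h3.trans_le ((hz.le (i + 1) (i + 1)).trans (h1.trans h2.le))) (lt_irrefl _)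

/-! ### Conjugation by the largest element -/

namespace ExpandingMap.IsExpanding

variable {e f f' g : ExpandingMap}

/-- Every `l i`, the centre included, is the left end of a foot of `e`, so a foot of another map
around it would meet that foot. -/
theorem l_notMem_foot (h : e.IsExpanding) {S : Set I} (hS : Disjoint e.F S) {u w : I}
    (hw : Set.Ioo u w ⊆ S) {i : ℕ} (h1 : u ≤ e.l i) (h2 : e.l i < w) : False := by
  obtain ⟨x, hx, hs⟩ := h.foot_l i
  obtain ⟨y, hy, hy'⟩ := exists_between (lt_min hx h2)
  exact Set.disjoint_left.1 hS (hs ⟨hy, hy'.trans_le (min_le_left _ _)⟩)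
    (hw ⟨h1.trans_lt hy, hy'.trans_le (min_le_right _ _)⟩)

/-- The mirror image of `l_notMem_foot`. The condition `h0` excludes a map without negative bumps at
its centre, where no foot ends. -/
theorem r_notMem_foot (h : e.IsExpanding) {S : Set I} (hS : Disjoint e.F S) {u w : I}
    (hw : Set.Ioo u w ⊆ S) {i : ℕ} (h0 : e.l 0 < e.r i) (h1 : u < e.r i) (h2 : e.r i ≤ w) :
    False := by
  obtain h3 | ⟨x, hx, hs⟩ := h.foot_r i
  · exact h0.ne' h3
  obtain ⟨y, hy, hy'⟩ := exists_between (max_lt hx h1)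
  exact Set.disjoint_left.1 hS (hs ⟨(le_max_left _ _).trans_lt hy, hy'⟩)
    (hw ⟨(le_max_right _ _).trans_lt hy, hy'.trans_le h2⟩)

theorem pow_l (h : g.IsExpanding) (m i : ℕ) : (g.fn ^ m) (g.l i) = g.l i := by
  induction m with
  | zero => rfl
  | succ m ih =>
    rw [pow_succ]
    exact (congrArg _ (h.fix_l i)).trans ih

theorem pow_r (h : g.IsExpanding) (m i : ℕ) : (g.fn ^ m) (g.r i) = g.r i := by
  induction m with
  | zero => rfl
  | succ m ih =>
    rw [pow_succ]
    exact (congrArg _ (h.fix_r i)).trans ih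

theorem pow_le (h : g.IsExpanding) (m i : ℕ) {x : I} (h1 : g.l i ≤ x) (h2 : x ≤ g.l (i + 1)) :
    (g.fn ^ m) x ≤ x := by
  induction m generalizing x with
  | zero => exact le_rfl
  | succ m ih =>
    rw [pow_succ]
    have h3 := h.move_l i x h1 h2
    refine (ih ?_ (h3.trans h2)).trans h3
    rw [← h.fix_l i]
    exact g.fn.monotone h1

theorem le_pow (h : g.IsExpanding) (m i : ℕ) {x : I} (h1 : g.r (i + 1) ≤ x) (h2 : x ≤ g.r i) :
    x ≤ (g.fn ^ m) x := by
  induction m generalizing x with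
  | zero => exact le_rfl
  | succ m ih =>
    rw [pow_succ]
    have h3 := h.move_r i x h1 h2
    refine h3.trans (ih (h1.trans h3) ?_)
    rw [← h.fix_r i]
    exact g.fn.monotone h2

theorem pow_succ_le (h : g.IsExpanding) (m i : ℕ) {x : I} (h1 : g.l i ≤ x)
    (h2 : x ≤ g.l (i + 1)) : (g.fn ^ (m + 1)) x ≤ g.fn x := by
  rw [pow_succ]
  have h3 := h.move_l i x h1 h2
  refine h.pow_le m i ?_ (h3.trans h2)
  rw [← h.fix_l i]
  exact g.fn.monotone h1

theorem le_pow_succ (h : g.IsExpanding) (m i : ℕ) {x : I} (h1 : g.r (i + 1) ≤ x)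
    (h2 : x ≤ g.r i) : g.fn x ≤ (g.fn ^ (m + 1)) x := by
  rw [pow_succ]
  have h3 := h.move_r i x h1 h2
  refine h.le_pow m i (h1.trans h3) ?_
  rw [← h.fix_r i]
  exact g.fn.monotone h2

theorem l_zero_lt_r (hf : f.IsExpanding) (hg : g.IsExpanding) {t i : ℕ} (h : HasLevel t f g)
    (hi : 2 * i + 1 ≤ t) : f.l 0 < f.r i := by
  rcases i.eq_zero_or_pos with rfl | hpos
  · exact hf.lt
  · have h1 := h.l_lt' 0 (by omega)
    have h2 := hg.mono (show 0 + 1 ≤ i from hpos)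
    exact h1.trans_le (h2.trans ((h.l_lt i hi).le.trans (hf.le i i)))

/-- Ping-pong: one application of `g` already moves a point left of the inner foot of a negative
bump into the outer foot, and further powers keep moving it outwards. -/
theorem pow_lt_of_l (hg : g.IsExpanding) (m j : ℕ) {x y : I} (h1 : g.l j ≤ x)
    (h2 : x ≤ g.l (j + 1)) (hlt : g.l j < g.l (j + 1))
    (hx : ∀ β, Set.Ioo β (g.l (j + 1)) ⊆ g.F → x < β)
    (hy : ∀ α, Set.Ioo (g.l j) α ⊆ g.F → α ≤ y) : (g.fn ^ (m + 1)) x < y := by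
  obtain ⟨α, β, -, -, -, h6, h7, h8⟩ := hg.bump_l j hlt
  refine (hg.pow_succ_le m j h1 h2).trans_lt (lt_of_lt_of_le ?_ (hy α h7))
  rw [← h6]
  exact g.fn.strictMono (hx β h8)

theorem pow_le_of_l (hg : g.IsExpanding) (m j : ℕ) {x y : I} (h1 : g.l j ≤ x)
    (h2 : x ≤ g.l (j + 1)) (hlt : g.l j < g.l (j + 1))
    (hx : ∀ β, Set.Ioo β (g.l (j + 1)) ⊆ g.F → x ≤ β)
    (hy : ∀ α, Set.Ioo (g.l j) α ⊆ g.F → α ≤ y) : (g.fn ^ (m + 1)) x ≤ y := by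
  obtain ⟨α, β, -, -, -, h6, h7, h8⟩ := hg.bump_l j hlt
  refine (hg.pow_succ_le m j h1 h2).trans (le_trans ?_ (hy α h7))
  rw [← h6]
  exact g.fn.monotone (hx β h8)

theorem lt_pow_of_r (hg : g.IsExpanding) (m j : ℕ) {x y : I} (h1 : g.r (j + 1) ≤ x)
    (h2 : x ≤ g.r j) (hlt : g.r (j + 1) < g.r j)
    (hx : ∀ γ, Set.Ioo (g.r (j + 1)) γ ⊆ g.F → γ < x)
    (hy : ∀ δ, Set.Ioo δ (g.r j) ⊆ g.F → y ≤ δ) : y < (g.fn ^ (m + 1)) x := by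
  obtain ⟨γ, δ, -, -, -, h6, h7, h8⟩ := hg.bump_r j hlt
  refine lt_of_lt_of_le ((hy δ h8).trans_lt ?_) (hg.le_pow_succ m j h1 h2)
  rw [← h6]
  exact g.fn.strictMono (hx γ h7)

theorem le_pow_of_r (hg : g.IsExpanding) (m j : ℕ) {x y : I} (h1 : g.r (j + 1) ≤ x)
    (h2 : x ≤ g.r j) (hlt : g.r (j + 1) < g.r j)
    (hx : ∀ γ, Set.Ioo (g.r (j + 1)) γ ⊆ g.F → γ ≤ x)
    (hy : ∀ δ, Set.Ioo δ (g.r j) ⊆ g.F → y ≤ δ) : y ≤ (g.fn ^ (m + 1)) x := by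
  obtain ⟨γ, δ, -, -, -, h6, h7, h8⟩ := hg.bump_r j hlt
  refine ((hy δ h8).trans ?_).trans (hg.le_pow_succ m j h1 h2)
  rw [← h6]
  exact g.fn.monotone (hx γ h7)

/-- Conjugating by a power of `g` separates the elements below `g`. -/
theorem hasLevel_conj_pow (hf : f.IsExpanding) (hf' : f'.IsExpanding) (hg : g.IsExpanding)
    (hd : Disjoint f.F g.F) (hd' : Disjoint f'.F g.F) {a b : ℕ} (hb : 1 ≤ b)
    (h : HasLevel a f g) (h' : HasLevel b f' g) (m : ℕ) :
    HasLevel (min a (b - 1)) f (f'.conj (g.fn ^ (m + 1))) := by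
  -- The four facts `lge`, `llt`, `rle`, `rgt` say on which side of a foot of `g` a transition point
  -- of a smaller map lies; they supply the hypotheses of the ping-pong lemmas.
  have lge : ∀ {e : ExpandingMap} (_ : e.IsExpanding) (_ : Disjoint e.F g.F) {u : I} {i : ℕ}
      (_ : u ≤ e.l i) (α : I), Set.Ioo u α ⊆ g.F → α ≤ e.l i := fun {_} he hde {_ _} h1 α hα => by
    by_contra! hlt
    exact he.l_notMem_foot hde hα h1 hlt
  have llt : ∀ {e : ExpandingMap} (_ : e.IsExpanding) (_ : Disjoint e.F g.F) {w : I} {i : ℕ}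
      (_ : e.l i < w) (β : I), Set.Ioo β w ⊆ g.F → e.l i < β := fun {_} he hde {_ _} h1 β hβ => by
    by_contra! hlt
    exact he.l_notMem_foot hde hβ hlt h1
  have rle : ∀ {e : ExpandingMap} (_ : e.IsExpanding) (_ : Disjoint e.F g.F) {w : I} {i : ℕ}
      (_ : e.l 0 < e.r i) (_ : e.r i ≤ w) (δ : I), Set.Ioo δ w ⊆ g.F → e.r i ≤ δ :=
    fun {_} he hde {_ _} h0 h1 δ hδ => by
      by_contra! hlt
      exact he.r_notMem_foot hde hδ h0 hlt h1
  have rgt : ∀ {e : ExpandingMap} (_ : e.IsExpanding) (_ : Disjoint e.F g.F) {u : I} {i : ℕ}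
      (_ : e.l 0 < e.r i) (_ : u < e.r i) (γ : I), Set.Ioo u γ ⊆ g.F → γ < e.r i :=
    fun {_} he hde {_ _} h0 h1 γ hγ => by
      by_contra! hlt
      exact he.r_notMem_foot hde hγ h0 h1 hlt
  constructor
  · intro i hi
    have h1 := h'.l_lt i (by omega)
    have h2 := h'.l_lt' i (by omega)
    exact hg.pow_lt_of_l m i h1.le h2.le (h1.trans h2) (llt hf' hd' h2)
      (lge hf hd (h.l_lt i (by omega)).le)
  · intro i hi
    have h1 := h'.r_lt i (by omega)
    have h2 := h'.r_lt' i (by omega)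
    exact hg.lt_pow_of_r m i h2.le h1.le (h2.trans h1)
      (rgt hf' hd' (hf'.l_zero_lt_r hg h' (by omega)) h2)
      (rle hf hd (hf.l_zero_lt_r hg h (by omega)) (h.r_lt i (by omega)).le)
  · intro i hi
    refine (h.l_lt' i (by omega)).trans ?_
    rw [← hg.pow_l (m + 1) (i + 1)]
    exact (g.fn ^ (m + 1)).strictMono (h'.l_lt (i + 1) (by omega))
  · intro i hi
    refine lt_trans ?_ (h.r_lt' i (by omega))
    rw [← hg.pow_r (m + 1) (i + 1)]
    exact (g.fn ^ (m + 1)).strictMono (h'.r_lt (i + 1) (by omega))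
  · intro i hi
    -- If the minimum is `b - 1`, then `f'.l i` lies in a positive bump of `g` and is thrown to the
    -- right past `f.r i`; if it is `a`, the fixed point `g.l i` separates the two maps.
    rcases Nat.lt_or_ge (2 * i) a with h1 | h1
    · have h2 := h'.odd i (by omega)
      have h3 := h'.r_lt i (by omega)
      have h4 := (hf'.le i i).trans_lt h3
      exact hg.le_pow_of_r m i h2 h4.le (h2.trans_lt h4) (lge hf' hd' h2)
        (rle hf hd (hf.l_zero_lt_r hg h (by omega)) (h.r_lt i (by omega)).le)
    · refine (h.even i (by omega)).trans ?_
      rw [← hg.pow_l (m + 1) i]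
      exact (g.fn ^ (m + 1)).monotone (h'.l_lt i (by omega)).le
  · intro i hi
    -- As in the even case: either `f'.r (i + 1)` is thrown to the left past `f.l i`, or the fixed
    -- point `g.r (i + 1)` separates.
    rcases Nat.lt_or_ge (2 * i + 1) a with h1 | h1
    · have h2 := h'.even (i + 1) (by omega)
      have h3 := h'.l_lt i (by omega)
      have h4 := h3.trans_le (hf'.le i (i + 1))
      refine hg.pow_le_of_l m i h4.le h2 (h3.trans (h'.l_lt' i (by omega))) ?_
        (lge hf hd (h.l_lt i (by omega)).le)
      -- If `f'.r (i + 1) = f'.l 0`, no foot of `f'` need end there, and the foot that starts at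
      -- `f'.l 0` is used.
      rcases (hf'.le 0 (i + 1)).eq_or_lt with h5 | h5
      · rw [← h5]
        intro β hβ
        exact (llt hf' hd' ((h'.l_lt' 0 (by omega)).trans_le (hg.mono (by omega))) β hβ).le
      · exact rle hf' hd' h5 h2
    · refine le_trans ?_ (h.odd i (by omega))
      rw [← hg.pow_r (m + 1) (i + 1)]
      refine (g.fn ^ (m + 1)).monotone ?_
      rcases Nat.lt_or_ge (2 * i + 2) b with h2 | h2
      · exact (h'.r_lt (i + 1) (by omega)).le
      · exact (h'.even (i + 1) (by omega)).trans (hg.le _ _)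

theorem exists_bump (h : e.IsExpanding) {x : I} (hx : x ∈ Set.Ioo (e.l 0) (e.r 0)) :
    (∃ i, e.l i < x ∧ x ≤ e.l (i + 1)) ∨ ∃ i, e.r (i + 1) ≤ x ∧ x < e.r i := by
  obtain ⟨n, hn⟩ := h.meet
  classical
  rcases le_total x (e.l n) with h1 | h1
  · have hex : ∃ i, x ≤ e.l i := ⟨n, h1⟩
    refine Or.inl ⟨Nat.find hex - 1, ?_, ?_⟩
    · have hpos : Nat.find hex ≠ 0 := fun h0 => by
        have := Nat.find_spec hex
        rw [h0] at this
        exact absurd hx.1 this.not_gt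
      exact not_le.1 (Nat.find_min hex (by omega))
    · exact (Nat.find_spec hex).trans (h.mono (by omega))
  · rw [hn] at h1
    have hex : ∃ i, e.r i ≤ x := ⟨n, h1⟩
    refine Or.inr ⟨Nat.find hex - 1, ?_, ?_⟩
    · exact (h.anti (by omega)).trans (Nat.find_spec hex)
    · have hpos : Nat.find hex ≠ 0 := fun h0 => by
        have := Nat.find_spec hex
        rw [h0] at this
        exact absurd hx.2 this.not_gt
      exact not_le.1 (Nat.find_min hex (by omega))

/-- Points of the feet of `f'` avoid the feet of `g`, so positive powers of `g` throw them into the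
outer feet of `g`, which are disjoint from the feet of `f`. -/
theorem disjoint_conj_pow (hf' : f'.IsExpanding) (hg : g.IsExpanding)
    (hd : Disjoint f.F g.F) (hd' : Disjoint f'.F g.F) {b : ℕ} (hb : 1 ≤ b)
    (h' : HasLevel b f' g) (m : ℕ) :
    Disjoint f.F (f'.conj (g.fn ^ (m + 1))).F := by
  rw [Set.disjoint_right]
  rintro _ ⟨x, hx, rfl⟩
  refine Set.disjoint_right.1 hd ?_
  have hx0 := hf'.F_sub hx
  -- As `f'.F` is open, it also avoids the closures of the feet of `g`; this settles points at the
  -- ends of feet and at fixed points of `g`.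
  have hcl : ∀ {u w : I}, u < w → Set.Ioo u w ⊆ g.F → x ∉ Set.Icc u w := by
    intro u w huw hs hxu
    rw [← closure_Ioo huw.ne] at hxu
    exact Set.disjoint_left.1 (hd'.closure_right hf'.F_open) hx (closure_mono hs hxu)
  rcases hg.exists_bump ⟨(h'.l_lt 0 hb).trans hx0.1, hx0.2.trans (h'.r_lt 0 hb)⟩ with
    ⟨i, h1, h2⟩ | ⟨i, h1, h2⟩
  · obtain ⟨α, β, h3, h4, h5, h6, h7, h8⟩ := hg.bump_l i (h1.trans_le h2)
    refine h7 ⟨?_, (hg.pow_succ_le m i h1.le h2).trans_lt ?_⟩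
    · calc g.l i = (g.fn ^ (m + 1)) (g.l i) := (hg.pow_l _ _).symm
        _ < _ := (g.fn ^ (m + 1)).strictMono h1
    · rw [← h6]
      refine g.fn.strictMono ?_
      by_contra! h9
      exact hcl h5 h8 ⟨h9, h2⟩
  · obtain ⟨γ, δ, h3, h4, h5, h6, h7, h8⟩ := hg.bump_r i (h1.trans_lt h2)
    refine h8 ⟨lt_of_lt_of_le ?_ (hg.le_pow_succ m i h1 h2.le), ?_⟩
    · rw [← h6]
      refine g.fn.strictMono ?_
      by_contra! h9
      exact hcl h3 h7 ⟨h1, h9⟩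
    · calc _ < (g.fn ^ (m + 1)) (g.r i) := (g.fn ^ (m + 1)).strictMono h2
        _ = g.r i := hg.pow_r _ _

end ExpandingMap.IsExpanding

/-! ### Groups generated by families of expanding maps -/

/-- A family of expanding maps with disjoint feet, any two of which have a level. -/
structure IsLevelFamily {ι : Type} [LinearOrder ι] (e : ι → ExpandingMap) (ℓ : ι → ι → ℕ) :
    Prop where
  expanding : ∀ x, (e x).IsExpanding
  disjoint : ∀ x y, x ≠ y → Disjoint (e x).F (e y).F
  level : ∀ x y, x < y → HasLevel (ℓ x y) (e x) (e y)

theorem ExpandingMap.IsExpanding.commute {f h : ExpandingMap} (hf : f.IsExpanding)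
    (hh : h.IsExpanding) (hle : f.r 0 ≤ h.l 0) : f.fn * h.fn = h.fn * f.fn := by
  refine RelIso.ext fun x => ?_
  change f.fn (h.fn x) = h.fn (f.fn x)
  rcases le_total x (f.r 0) with hx | hx
  · have h1 : f.fn x ≤ f.r 0 := by
      rw [← hf.fix_r 0]
      exact f.fn.monotone hx
    rw [hh.support x (Or.inl (hx.trans hle)), hh.support _ (Or.inl (h1.trans hle))]
  · have h1 : f.r 0 ≤ h.fn x := by
      rw [← hh.support (f.r 0) (Or.inl hle)]
      exact h.fn.monotone hx
    rw [hf.support x (Or.inr hx), hf.support _ (Or.inr h1)]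

namespace IsLevelFamily

theorem comp {ι κ : Type} [LinearOrder ι] [LinearOrder κ] {e : ι → ExpandingMap}
    {ℓ : ι → ι → ℕ} (h : IsLevelFamily e ℓ) (φ : κ ↪o ι) :
    IsLevelFamily (fun x => e (φ x)) (fun x y => ℓ (φ x) (φ y)) where
  expanding _ := h.expanding _
  disjoint _ _ hxy := h.disjoint _ _ fun h => hxy (φ.injective h)
  level _ _ hxy := h.level _ _ (φ.lt_iff_lt.2 hxy)

/-! ### Conjugates of a family by powers of its largest element -/

section Copies

variable {ι : Type} [LinearOrder ι]

/-- The conjugates of the elements below `g` by the powers `g ^ i`, `i < k`. -/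
def copies (e : ι → ExpandingMap) (g : ι) (k : ℕ) (z : Fin k ×ₗ {x // x < g}) : ExpandingMap :=
  (e (ofLex z).2).conj ((e g).fn ^ ((ofLex z).1 : ℕ))

/-- The levels of the conjugates of the elements below `g`. -/
def copyLevel (ℓ : ι → ι → ℕ) (g : ι) (k : ℕ) (z w : Fin k ×ₗ {x // x < g}) : ℕ :=
  if (ofLex z).1 = (ofLex w).1 then ℓ (ofLex z).2 (ofLex w).2
  else min (ℓ (ofLex z).2 g) (ℓ (ofLex w).2 g - 1)

theorem isCopySystem (ℓ : ι → ι → ℕ) (g : ι) (k : ℕ) :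
    IsCopySystem ℓ g (copyLevel ℓ g k) (fun z => ((ofLex z).1 : ℕ)) (fun z => (ofLex z).2) where
  pr_lt z := (ofLex z).2.2
  lt_iff z w := by
    rw [Prod.Lex.lt_iff]
    simp only [Fin.lt_def, Fin.ext_iff, Subtype.coe_lt_coe]
  inj z w h1 h2 := by
    apply ofLex.injective
    exact Prod.ext (Fin.ext h1) (Subtype.ext h2)
  same z w _ h := by
    rw [copyLevel, if_pos (Fin.ext h)]
  mixed z w h := by
    rw [copyLevel, if_neg fun h' => absurd (congrArg Fin.val h') h.ne]

theorem copies_aux {e : ι → ExpandingMap} {ℓ : ι → ι → ℕ} (h : IsLevelFamily e ℓ) {g : ι}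
    (hg : ∀ x < g, 1 ≤ ℓ x g) {i j : ℕ} (hij : i < j) {x y : ι} (hx : x < g) (hy : y < g) :
    Disjoint ((e x).conj ((e g).fn ^ i)).F ((e y).conj ((e g).fn ^ j)).F ∧
      HasLevel (min (ℓ x g) (ℓ y g - 1)) ((e x).conj ((e g).fn ^ i))
        ((e y).conj ((e g).fn ^ j)) := by
  obtain ⟨m, rfl⟩ := Nat.exists_eq_add_of_lt hij
  -- Undoing the common conjugation by `g ^ i` leaves the first copy unmoved and the second one
  -- moved by a positive power.
  have h1 : (e y).conj ((e g).fn ^ (i + m + 1)) =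
      ((e y).conj ((e g).fn ^ (m + 1))).conj ((e g).fn ^ i) := by
    rw [← ExpandingMap.conj_mul, ← pow_add, add_assoc]
  rw [h1]
  constructor
  · refine Set.disjoint_image_of_injective ((e g).fn ^ i).injective ?_
    exact (h.expanding y).disjoint_conj_pow (h.expanding g) (h.disjoint _ _ hx.ne)
      (h.disjoint _ _ hy.ne) (hg y hy) (h.level y g hy) m
  · refine HasLevel.conj ?_ _
    exact (h.expanding x).hasLevel_conj_pow (h.expanding y) (h.expanding g) (h.disjoint _ _ hx.ne)
      (h.disjoint _ _ hy.ne) (hg y hy) (h.level x g hx) (h.level y g hy) m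

theorem isLevelFamily_copies {e : ι → ExpandingMap} {ℓ : ι → ι → ℕ} (h : IsLevelFamily e ℓ)
    {g : ι} (hg : ∀ x < g, 1 ≤ ℓ x g) (k : ℕ) :
    IsLevelFamily (copies e g k) (copyLevel ℓ g k) where
  expanding z := (h.expanding _).conj _
  disjoint z w hzw := by
    rcases lt_trichotomy ((ofLex z).1 : ℕ) (ofLex w).1 with h1 | h1 | h1
    · exact (copies_aux h hg h1 (ofLex z).2.2 (ofLex w).2.2).1
    · rw [copies, copies, ← h1]
      refine Set.disjoint_image_of_injective ((e g).fn ^ _).injective (h.disjoint _ _ fun h2 => ?_)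
      exact hzw ((isCopySystem ℓ g k).inj z w h1 h2)
    · exact (copies_aux h hg h1 (ofLex w).2.2 (ofLex z).2.2).1.symm
  level z w hzw := by
    have hs := isCopySystem ℓ g k
    rcases (hs.lt_iff z w).1 hzw with h1 | h1
    · rw [hs.mixed z w h1]
      exact (copies_aux h hg h1 (ofLex z).2.2 (ofLex w).2.2).2
    · rw [hs.same z w hzw h1.1, copies, copies, ← h1.1]
      exact (h.level _ _ h1.2).conj _

/-- Copying creates no higher levels, so the same number of levels, and hence the same well-order of
ranks, serves throughout the recursion. -/
theorem copyLevel_lt {ℓ : ι → ι → ℕ} {g : ι} {k d : ℕ} (hd : ∀ x y, x < y → ℓ x y < d)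
    (z w : Fin k ×ₗ {x // x < g}) (hzw : z < w) : copyLevel ℓ g k z w < d := by
  have hs := isCopySystem ℓ g k
  rcases (hs.lt_iff z w).1 hzw with h1 | h1
  · rw [hs.mixed z w h1]
    exact (min_le_left _ _).trans_lt (hd _ _ (hs.pr_lt z))
  · rw [hs.same z w hzw h1.1]
    exact hd _ _ h1.2

end Copies

/-- Induction on the total rank. With `g` the largest element, either the family splits into two
commuting proper subfamilies, or `closure_insert` reduces it to families of copies; the rank drops
in both cases. -/
theorem isElementaryAmenable_of_totalRank (d : ℕ) (o : OrdTower (d + 1)) {ι : Type}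
    [LinearOrder ι] [Fintype ι] {e : ι → ExpandingMap} {ℓ : ι → ι → ℕ} (h : IsLevelFamily e ℓ)
    (hd : ∀ x y, x < y → ℓ x y < 1 + d) (ho : totalRank ℓ d = o) :
    IsElementaryAmenable (Subgroup.closure (Set.range fun x => (e x).fn)) := by
  induction o using WellFoundedLT.induction generalizing ι with
  | ind o ih =>
  subst ho
  rcases isEmpty_or_nonempty ι with hι | hι
  · rw [Set.range_eq_empty, Subgroup.closure_empty]
    exact .of_finite _ inferInstance
  obtain ⟨g, hmax⟩ := Finite.exists_max (id : ι → ι)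
  by_cases hsplit : ∃ x, x < g ∧ ℓ x g = 0
  · obtain ⟨a, ha⟩ := hsplit
    have hsub : ∀ (p : ι → Prop) (b : ι), ¬ p b → IsElementaryAmenable
        (Subgroup.closure (Set.range fun x : {x // p x} => (e x).fn)) := by
      intro p b hb
      classical
      let φ : {x // p x} ↪o ι := OrderEmbedding.subtype p
      exact ih _ (totalRank_comp_lt ℓ φ d b fun x hx => hb (hx ▸ x.2)) (h.comp φ)
        (fun x y hxy => hd _ _ hxy) rfl
    have key := IsElementaryAmenable.of_commute
      (S := Set.range fun x : {x // x < g ∧ ℓ x g = 0} => (e x).fn)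
      (T := Set.range fun x : {x // ¬ (x < g ∧ ℓ x g = 0)} => (e x).fn) ?_
      (hsub _ g fun h' => lt_irrefl _ h'.1) (hsub _ a fun h' => h' ha)
    · refine key.mono (Subgroup.closure_mono ?_)
      rintro _ ⟨x, rfl⟩
      by_cases hx : x < g ∧ ℓ x g = 0
      · exact Or.inl ⟨⟨x, hx⟩, rfl⟩
      · exact Or.inr ⟨⟨x, hx⟩, rfl⟩
    · rintro _ ⟨⟨x, hx, hx0⟩, rfl⟩ _ ⟨⟨y, hy⟩, rfl⟩
      -- Elements at level `0` lie to the left of `g`, while every other element starts no further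
      -- left than `g`: the supports are disjoint.
      refine (h.expanding x).commute (h.expanding y) (((h.level x g hx).even 0 hx0).trans ?_)
      rcases (hmax y).lt_or_eq with h1 | h1
      · have h2 : ℓ y g ≠ 0 := fun h2 => hy ⟨h1, h2⟩
        exact ((h.level y g h1).l_lt 0 (by omega)).le
      · exact (congrArg (fun y => (e y).l 0) h1).ge
  · push Not at hsplit
    have hg : ∀ x < g, 1 ≤ ℓ x g := fun x hx => Nat.one_le_iff_ne_zero.2 (hsplit x hx)
    have hrange : (Set.range fun x => (e x).fn) ⊆
        insert (e g).fn (Set.range fun x : {x // x < g} => (e x).fn) := by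
      rintro _ ⟨x, rfl⟩
      rcases (hmax x).lt_or_eq with h1 | h1
      · exact Or.inr ⟨⟨x, h1⟩, rfl⟩
      · exact Or.inl (congrArg (fun y => (e y).fn) h1)
    refine (IsElementaryAmenable.closure_insert (e g).fn _ fun k => ?_).mono
      (Subgroup.closure_mono hrange)
    have hconj : conjSet (e g).fn (Set.range fun x : {x // x < g} => (e x).fn) k ⊆
        Set.range fun z => (copies e g k z).fn := by
      rintro _ ⟨i, hi, _, ⟨x, rfl⟩, rfl⟩
      exact ⟨toLex (⟨i, hi⟩, x), rfl⟩
    have hlt : totalRank (copyLevel ℓ g k) d < totalRank ℓ d :=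
      (isCopySystem ℓ g k).totalRank_lt
        (fun x y z hxy hyz => (h.level x y hxy).ultra (h.expanding x) (h.expanding y)
          (h.expanding z) (h.level y z hyz) (h.level x z (hxy.trans hyz)))
        (fun x y z hxy hyz => (h.level x y hxy).ultra' (h.expanding x)
          (h.expanding z) (h.level y z hyz) (h.level x z (hxy.trans hyz)))
        d (fun x hx => hd x g hx) hg
    exact (ih _ hlt (isLevelFamily_copies h hg k) (copyLevel_lt hd) rfl).mono
      (Subgroup.closure_mono hconj)

theorem isElementaryAmenable {ι : Type} [LinearOrder ι] [Finite ι] {e : ι → ExpandingMap}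
    {ℓ : ι → ι → ℕ} (h : IsLevelFamily e ℓ) :
    IsElementaryAmenable (Subgroup.closure (Set.range fun x => (e x).fn)) := by
  have := Fintype.ofFinite ι
  -- The sum of all levels serves as a common bound.
  refine isElementaryAmenable_of_totalRank (∑ x, ∑ y, ℓ x y) _ h (fun x y _ => ?_) rfl
  have h1 : ℓ x y ≤ ∑ y, ℓ x y :=
    Finset.single_le_sum (f := fun y => ℓ x y) (fun _ _ => Nat.zero_le _) (Finset.mem_univ y)
  have h2 : ∑ y, ℓ x y ≤ ∑ x, ∑ y, ℓ x y :=
    Finset.single_le_sum (f := fun x => ∑ y, ℓ x y) (fun _ _ => Nat.zero_le _) (Finset.mem_univ x)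
  omega

end IsLevelFamily

/-! ### Orbitals -/

section Orbitals

variable {f : I ≃o I} {J K : I × I}

theorem orbitals_snd_le_fst (hJ : J ∈ orbitals f) (hK : K ∈ orbitals f) (h : J.1 < K.1) :
    J.2 ≤ K.1 := by
  by_contra! h'
  exact hJ.2.2.2 K.1 ⟨h, h'⟩ hK.2.1

theorem orbitals_ext (hJ : J ∈ orbitals f) (hK : K ∈ orbitals f) (h : J.1 = K.1) : J = K := by
  refine Prod.ext h ?_
  by_contra hne
  rcases lt_or_gt_of_ne hne with h' | h'
  · exact hK.2.2.2 J.2 ⟨h ▸ hJ.1, h'⟩ hJ.2.2.1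
  · exact hJ.2.2.2 K.2 ⟨h ▸ hK.1, h'⟩ hK.2.2.1

theorem exists_orbital {t : I} (ht : f t ≠ t) : ∃ J ∈ orbitals f, t ∈ Set.Ioo J.1 J.2 := by
  have hcl : IsClosed {x : I | f x = x} := isClosed_eq f.continuous continuous_id
  have h0 : f 0 = 0 := f.map_bot
  have h1 : f 1 = 1 := f.map_top
  obtain ⟨u, ⟨hu, hut⟩, humax⟩ := (hcl.inter (isClosed_Iic (a := t))).isCompact.exists_isGreatest
    ⟨0, h0, unitInterval.nonneg'⟩
  obtain ⟨v, ⟨hv, hvt⟩, hvmin⟩ := (hcl.inter (isClosed_Ici (a := t))).isCompact.exists_isLeast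
    ⟨1, h1, unitInterval.le_one'⟩
  have hut' : u < t := lt_of_le_of_ne hut fun h => ht (h ▸ hu)
  have hvt' : t < v := lt_of_le_of_ne hvt fun h => ht (h ▸ hv)
  refine ⟨(u, v), ⟨hut'.trans hvt', hu, hv, fun x hx hfx => ?_⟩, hut', hvt'⟩
  rcases le_total x t with h | h
  · exact absurd (humax ⟨hfx, h⟩) hx.1.not_ge
  · exact absurd (hvmin ⟨hfx, h⟩) hx.2.not_ge

theorem pos_or_neg (hJ : J ∈ orbitals f) : J ∈ posOrbitals f ∨ J ∈ negOrbitals f := by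
  by_contra! h
  obtain ⟨a, ha, ha'⟩ : ∃ t ∈ Set.Ioo J.1 J.2, f t ≤ t := by
    by_contra! h'
    exact h.1 ⟨hJ, h'⟩
  obtain ⟨b, hb, hb'⟩ : ∃ t ∈ Set.Ioo J.1 J.2, t ≤ f t := by
    by_contra! h'
    exact h.2 ⟨hJ, h'⟩
  obtain ⟨x, hx, hx'⟩ := isPreconnected_Ioo.intermediate_value₂ ha hb f.continuous.continuousOn
    continuous_id.continuousOn ha' hb'
  exact hJ.2.2.2 x hx hx'

theorem not_pos_and_neg (hJ : J ∈ posOrbitals f) (hJ' : J ∈ negOrbitals f) : False := by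
  obtain ⟨t, ht⟩ := exists_between hJ.1.1
  exact lt_asymm (hJ.2 t ht) (hJ'.2 t ht)

end Orbitals

/-- The orbitals of `f` are the intervals between consecutive points of `p 0 < ⋯ < p k`, the first
`N` of them negative and the others positive. -/
structure IsRep (f : I ≃o I) (k N : ℕ) (p : ℕ → I) : Prop where
  k_pos : 0 < k
  N_le : N ≤ k
  strict : ∀ i < k, p i < p (i + 1)
  orb : ∀ J, J ∈ orbitals f ↔ ∃ i < k, J = (p i, p (i + 1))
  neg : ∀ i < N, ∀ t ∈ Set.Ioo (p i) (p (i + 1)), f t < t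
  pos : ∀ i, N ≤ i → i < k → ∀ t ∈ Set.Ioo (p i) (p (i + 1)), t < f t

namespace IsRep

variable {f : I ≃o I} {k N : ℕ} {p : ℕ → I}

theorem lt_of_lt (h : IsRep f k N p) {i j : ℕ} (hij : i < j) (hj : j ≤ k) : p i < p j := by
  induction j with
  | zero => omega
  | succ j ih =>
    rcases Nat.lt_succ_iff_lt_or_eq.1 hij with h1 | rfl
    · exact (ih h1 (by omega)).trans (h.strict j (by omega))
    · exact h.strict i (by omega)

theorem le_of_le (h : IsRep f k N p) {i j : ℕ} (hij : i ≤ j) (hj : j ≤ k) : p i ≤ p j := by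
  rcases hij.lt_or_eq with h1 | rfl
  · exact (h.lt_of_lt h1 hj).le
  · exact le_rfl

theorem mem (h : IsRep f k N p) {i : ℕ} (hi : i < k) : (p i, p (i + 1)) ∈ orbitals f :=
  (h.orb _).2 ⟨i, hi, rfl⟩

theorem injOn (h : IsRep f k N p) : Set.InjOn (fun i => (p i, p (i + 1))) (Set.Iio k) := by
  intro i hi j hj hij
  have h1 : p i = p j := congrArg Prod.fst hij
  rcases lt_trichotomy i j with h2 | h2 | h2
  · exact absurd h1 (h.lt_of_lt h2 hj.le).ne
  · exact h2
  · exact absurd h1 (h.lt_of_lt h2 hi.le).ne'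

theorem orbitals_eq (h : IsRep f k N p) :
    orbitals f = (fun i => (p i, p (i + 1))) '' Set.Iio k := by
  ext J
  rw [h.orb]
  exact ⟨fun ⟨i, hi, hJ⟩ => ⟨i, hi, hJ.symm⟩, fun ⟨i, hi, hJ⟩ => ⟨i, hi, hJ.symm⟩⟩

theorem neg_mem (h : IsRep f k N p) {i : ℕ} (hi : i < N) : (p i, p (i + 1)) ∈ negOrbitals f :=
  ⟨h.mem (hi.trans_le h.N_le), h.neg i hi⟩

theorem pos_mem (h : IsRep f k N p) {i : ℕ} (hi : N ≤ i) (hk : i < k) :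
    (p i, p (i + 1)) ∈ posOrbitals f :=
  ⟨h.mem hk, h.pos i hi hk⟩

theorem negOrbitals_eq (h : IsRep f k N p) :
    negOrbitals f = (fun i => (p i, p (i + 1))) '' Set.Iio N := by
  ext J
  constructor
  · intro hJ
    obtain ⟨i, hi, rfl⟩ := (h.orb J).1 hJ.1
    refine ⟨i, ?_, rfl⟩
    by_contra hN
    exact not_pos_and_neg (h.pos_mem (not_lt.1 hN) hi) hJ
  · rintro ⟨i, hi, rfl⟩
    exact h.neg_mem hi

theorem posOrbitals_eq (h : IsRep f k N p) :
    posOrbitals f = (fun i => (p i, p (i + 1))) '' Set.Ico N k := by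
  ext J
  constructor
  · intro hJ
    obtain ⟨i, hi, rfl⟩ := (h.orb J).1 hJ.1
    refine ⟨i, ⟨?_, hi⟩, rfl⟩
    by_contra! hN
    exact not_pos_and_neg hJ (h.neg_mem hN)
  · rintro ⟨i, hi, rfl⟩
    exact h.pos_mem hi.1 hi.2

theorem finite_orbitals (h : IsRep f k N p) : (orbitals f).Finite := by
  rw [h.orbitals_eq]
  exact (Set.finite_Iio k).image _

theorem ncard_orbitals (h : IsRep f k N p) : (orbitals f).ncard = k := by
  rw [h.orbitals_eq, h.injOn.ncard_image, ← Nat.card_coe_set_eq]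
  simp

theorem ncard_negOrbitals (h : IsRep f k N p) : (negOrbitals f).ncard = N := by
  rw [h.negOrbitals_eq, (h.injOn.mono (Set.Iio_subset_Iio h.N_le)).ncard_image,
    ← Nat.card_coe_set_eq]
  simp

theorem ncard_posOrbitals (h : IsRep f k N p) : (posOrbitals f).ncard = k - N := by
  rw [h.posOrbitals_eq, (h.injOn.mono fun _ hi => hi.2).ncard_image, ← Nat.card_coe_set_eq]
  simp

theorem exists_index {x : I} (h1 : p 0 ≤ x) (h2 : x < p k) :
    ∃ i < k, p i ≤ x ∧ x < p (i + 1) := by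
  classical
  have hex : ∃ i, x < p i := ⟨k, h2⟩
  have hk : Nat.find hex ≤ k := Nat.find_min' hex h2
  have h0 : Nat.find hex ≠ 0 := fun h0 => by
    have := Nat.find_spec hex
    rw [h0] at this
    exact absurd h1 this.not_ge
  refine ⟨Nat.find hex - 1, by omega, not_lt.1 (Nat.find_min hex (by omega)), ?_⟩
  rw [Nat.sub_add_cancel (by omega)]
  exact Nat.find_spec hex

theorem eq_of_le_or_ge (h : IsRep f k N p) {x : I} (hx : x ≤ p 0 ∨ p k ≤ x) : f x = x := by
  by_contra hne
  obtain ⟨J, hJ, hxJ⟩ := exists_orbital hne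
  obtain ⟨i, hi, rfl⟩ := (h.orb J).1 hJ
  rcases hx with hx | hx
  · exact absurd (hx.trans (h.le_of_le (Nat.zero_le i) hi.le)) hxJ.1.not_ge
  · exact absurd ((h.le_of_le (Nat.succ_le_of_lt hi) le_rfl).trans hx) hxJ.2.not_ge

theorem apply_p (h : IsRep f k N p) {i : ℕ} (hi : i ≤ k) : f (p i) = p i := by
  rcases hi.lt_or_eq with h1 | rfl
  · exact (h.mem h1).2.1
  · exact h.eq_of_le_or_ge (Or.inr le_rfl)

theorem closure_support (h : IsRep f k N p) :
    closure ((fun t : I => (t : ℝ)) '' {t | f t ≠ t}) = Set.Icc (p 0 : ℝ) (p k) := by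
  apply Set.Subset.antisymm
  · refine closure_minimal ?_ isClosed_Icc
    rintro _ ⟨t, ht, rfl⟩
    constructor
    · by_contra! h'
      exact ht (h.eq_of_le_or_ge (Or.inl (Subtype.coe_le_coe.1 h'.le)))
    · by_contra! h'
      exact ht (h.eq_of_le_or_ge (Or.inr (Subtype.coe_le_coe.1 h'.le)))
  · have key : ∀ i < k, Set.Icc (p i : ℝ) (p (i + 1)) ⊆
        closure ((fun t : I => (t : ℝ)) '' {t | f t ≠ t}) := by
      intro i hi
      have hlt : (p i : ℝ) < p (i + 1) := h.strict i hi
      rw [← closure_Ioo hlt.ne]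
      refine closure_mono fun x hx => ?_
      have hx01 : x ∈ I := ⟨(p i).2.1.trans hx.1.le, hx.2.le.trans (p (i + 1)).2.2⟩
      exact ⟨⟨x, hx01⟩, (h.mem hi).2.2.2 _ ⟨hx.1, hx.2⟩, rfl⟩
    rintro x ⟨h1, h2⟩
    rcases h2.lt_or_eq with h2 | rfl
    · have hx01 : x ∈ I := ⟨(p 0).2.1.trans h1, h2.le.trans (p k).2.2⟩
      obtain ⟨i, hi, h3, h4⟩ := exists_index (x := ⟨x, hx01⟩) h1 h2
      exact key i hi ⟨h3, le_of_lt h4⟩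
    · have hk := h.k_pos
      have h3 := key (k - 1) (by omega)
      rw [Nat.sub_add_cancel hk] at h3
      exact h3 ⟨h.le_of_le (by omega) le_rfl, le_rfl⟩

theorem extSupport_eq (h : IsRep f k N p) : extSupport f = Set.Ioo (p 0 : ℝ) (p k) := by
  rw [extSupport, h.closure_support, interior_Icc]

theorem zero_lt (h : IsRep f k N p) : p 0 < p k := h.lt_of_lt h.k_pos le_rfl

theorem isStandardFunction {f : MarkedFunction} (h : IsRep f.fn k N p)
    (hN : k = 2 * N ∨ k = 2 * N + 1) : IsStandardFunction f := by
  refine ⟨h.finite_orbitals, ⟨_, _, h.zero_lt, h.extSupport_eq⟩, ?_, ?_, ?_⟩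
  · rw [h.negOrbitals_eq, h.posOrbitals_eq]
    rintro _ ⟨i, hi, rfl⟩ _ ⟨j, hj, rfl⟩
    exact h.le_of_le (Nat.succ_le_of_lt (lt_of_lt_of_le hj hi.1)) hi.2.le
  · rw [h.ncard_negOrbitals, h.ncard_posOrbitals]
    omega
  · rw [h.ncard_negOrbitals, h.ncard_posOrbitals]
    omega

end IsRep

theorem leftOf_iff {f g : MarkedFunction} {k N k' N' : ℕ} {p q : ℕ → I} (hf : IsRep f.fn k N p)
    (hg : IsRep g.fn k' N' q) : LeftOf f g ↔ p k ≤ q 0 := by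
  have h1 : (p 0 : ℝ) < p k := hf.zero_lt
  have h2 : (q 0 : ℝ) < q k' := hg.zero_lt
  rw [LeftOf, hf.extSupport_eq, hg.extSupport_eq]
  constructor
  · intro h
    by_contra! h'
    have h' : (q 0 : ℝ) < p k := h'
    obtain ⟨x, hx, hx'⟩ := exists_between (max_lt h1 h')
    obtain ⟨y, hy, hy'⟩ := exists_between (lt_min ((le_max_right _ _).trans_lt hx) h2)
    exact lt_asymm (hy'.trans_le (min_le_left _ _))
      (h x ⟨(le_max_left _ _).trans_lt hx, hx'⟩ y ⟨hy, hy'.trans_le (min_le_right _ _)⟩)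
  · intro h x hx y hy
    have h : (p k : ℝ) ≤ q 0 := h
    exact hx.2.trans (h.trans_lt hy.1)

theorem nestedIn_iff {f g : MarkedFunction} {k N k' N' : ℕ} {p q : ℕ → I} (hf : IsRep f.fn k N p)
    (hg : IsRep g.fn k' N' q) : NestedIn f g ↔ q 0 < p 0 ∧ p k < q k' := by
  have h1 : (p 0 : ℝ) < p k := hf.zero_lt
  rw [NestedIn, hf.extSupport_eq, hg.extSupport_eq, closure_Ioo h1.ne]
  rw [Set.Icc_subset_Ioo_iff h1.le]
  rfl

/-! ### Representing standard functions -/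

/-- List the finitely many orbitals from left to right. Consecutive ones abut because the extended
support is an interval, and the signs change at most once. -/
theorem exists_isRep_of_isStandardFunction {f : MarkedFunction} (hf : IsStandardFunction f) :
    ∃ k N p, IsRep f.fn k N p ∧ (k = 2 * N ∨ k = 2 * N + 1) := by
  classical
  obtain ⟨hfin, ⟨u, v, huv, hext⟩, hpn, hc1, hc2⟩ := hf
  set s : Finset I := hfin.toFinset.image Prod.fst with hs
  have hmem : ∀ x, x ∈ s ↔ ∃ y, (x, y) ∈ orbitals f.fn := by
    intro x
    simp [hs]
  obtain ⟨k, hk⟩ : ∃ k, s.card = k := ⟨_, rfl⟩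
  have hkpos : 0 < k := by
    rw [← hk, Finset.card_pos]
    by_contra! hemp
    have hsupp : {t | f.fn t ≠ t} = ∅ := by
      rw [Set.eq_empty_iff_forall_notMem]
      intro t ht
      obtain ⟨J, hJ, -⟩ := exists_orbital ht
      have := (hmem J.1).2 ⟨J.2, hJ⟩
      rw [hemp] at this
      simp at this
    have h1 : extSupport f.fn = ∅ := by
      rw [extSupport, hsupp]
      simp
    rw [hext, Set.Ioo_eq_empty_iff] at h1
    exact h1 huv
  let q := s.orderEmbOfFin hk
  have hq : ∀ i, ∃ y, (q i, y) ∈ orbitals f.fn := fun i =>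
    (hmem _).1 (s.orderEmbOfFin_mem hk i)
  choose w hw using hq
  have hq' : ∀ J ∈ orbitals f.fn, ∃ i, J = (q i, w i) := by
    intro J hJ
    have h1 : J.1 ∈ Set.range q := by
      rw [Finset.range_orderEmbOfFin]
      exact (hmem _).2 ⟨J.2, hJ⟩
    obtain ⟨i, hi⟩ := h1
    exact ⟨i, orbitals_ext hJ (hw i) hi.symm⟩
  have hin : ∀ i, ∀ x ∈ Set.Ioo (q i : ℝ) (w i), x ∈ extSupport f.fn := by
    intro i
    refine interior_maximal ?_ isOpen_Ioo
    refine Set.Subset.trans ?_ subset_closure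
    intro x hx
    have hx01 : x ∈ I := ⟨(q i).2.1.trans hx.1.le, hx.2.le.trans (w i).2.2⟩
    exact ⟨⟨x, hx01⟩, (hw i).2.2.2 _ ⟨hx.1, hx.2⟩, rfl⟩
  -- A gap between neighbours would consist of fixed points, yet lie in the extended support and so
  -- in the closure of the support.
  have hadj : ∀ (i : ℕ) (h1 : i < k) (h2 : i + 1 < k), w ⟨i, h1⟩ = q ⟨i + 1, h2⟩ := by
    intro i h1 h2
    have hlt : q ⟨i, h1⟩ < q ⟨i + 1, h2⟩ := q.strictMono (by simp [Fin.lt_def])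
    refine (orbitals_snd_le_fst (hw _) (hw _) hlt).antisymm ?_
    by_contra! hgap
    change (w ⟨i, h1⟩ : I) < q ⟨i + 1, h2⟩ at hgap
    have hfix : ∀ t ∈ Set.Ioo (w ⟨i, h1⟩) (q ⟨i + 1, h2⟩), f.fn t = t := by
      intro t ht
      by_contra hne
      obtain ⟨J, hJ, htJ⟩ := exists_orbital hne
      obtain ⟨j, rfl⟩ := hq' J hJ
      have h3 : j < ⟨i + 1, h2⟩ := q.lt_iff_lt.1 (htJ.1.trans ht.2)
      have h4 : j ≤ ⟨i, h1⟩ := Fin.le_def.2 (Nat.lt_succ_iff.1 (Fin.lt_def.1 h3))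
      have h5 : w j ≤ w ⟨i, h1⟩ := by
        rcases h4.lt_or_eq with h4 | rfl
        · exact (orbitals_snd_le_fst (hw j) (hw _) (q.strictMono h4)).trans (hw _).1.le
        · exact le_rfl
      exact absurd (htJ.2.trans_le h5) ht.1.not_gt
    have hgap' : ((w ⟨i, h1⟩ : I) : ℝ) < q ⟨i + 1, h2⟩ := hgap
    obtain ⟨a, ha⟩ := exists_between (show (q ⟨i, h1⟩ : ℝ) < w ⟨i, h1⟩ from (hw _).1)
    obtain ⟨b, hb⟩ := exists_between (show (q ⟨i + 1, h2⟩ : ℝ) < w ⟨i + 1, h2⟩ from (hw _).1)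
    obtain ⟨y, hy⟩ := exists_between hgap'
    have ha' := hin _ a ha
    have hb' := hin _ b hb
    have hy' : y ∈ extSupport f.fn := by
      rw [hext] at ha' hb' ⊢
      exact ⟨ha'.1.trans (ha.2.trans hy.1), (hy.2.trans hb.1).trans hb'.2⟩
    obtain ⟨z, hz, t, ht, rfl⟩ := mem_closure_iff.1 (interior_subset hy') _ isOpen_Ioo hy
    exact ht (hfix t hz)
  -- The default value is the right end of the last orbital, as `p k` requires.
  set p : ℕ → I := fun i => if h : i < k then q ⟨i, h⟩ else w ⟨k - 1, by omega⟩ with hp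
  have hp1 : ∀ (i : ℕ) (hi : i < k), p i = q ⟨i, hi⟩ := fun i hi => dif_pos hi
  have hp2 : ∀ (i : ℕ) (hi : i < k), p (i + 1) = w ⟨i, hi⟩ := by
    intro i hi
    by_cases h2 : i + 1 < k
    · rw [hp1 _ h2, hadj i hi h2]
    · have h3 : i = k - 1 := by omega
      subst h3
      exact dif_neg h2
  have hpair : ∀ (i : ℕ) (hi : i < k), (p i, p (i + 1)) = (q ⟨i, hi⟩, w ⟨i, hi⟩) := fun i hi => by
    rw [hp1 i hi, hp2 i hi]
  have horb : ∀ J, J ∈ orbitals f.fn ↔ ∃ i < k, J = (p i, p (i + 1)) := by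
    intro J
    constructor
    · intro hJ
      obtain ⟨i, rfl⟩ := hq' J hJ
      exact ⟨i, i.2, (hpair i i.2).symm⟩
    · rintro ⟨i, hi, rfl⟩
      rw [hpair i hi]
      exact hw _
  have hstrict : ∀ i < k, p i < p (i + 1) := fun i hi => ((horb _).2 ⟨i, hi, rfl⟩).1
  -- `N` is the first index of a nonnegative orbital; no negative orbital can follow it.
  have hex : ∃ i, k ≤ i ∨ (p i, p (i + 1)) ∉ negOrbitals f.fn := ⟨k, Or.inl le_rfl⟩
  have hNk : Nat.find hex ≤ k := Nat.find_min' hex (Or.inl le_rfl)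
  set N := Nat.find hex with hN
  have hneg : ∀ i < N, (p i, p (i + 1)) ∈ negOrbitals f.fn := by
    intro i hi
    by_contra h
    exact Nat.find_min hex hi (Or.inr h)
  have hmono : ∀ i j, i ≤ j → j ≤ k → p i ≤ p j := by
    intro i j hij
    induction j, hij using Nat.le_induction with
    | base => exact fun _ => le_rfl
    | succ j _ ih => exact fun hj => (ih (by omega)).trans (hstrict j hj).le
  have hpos : ∀ i, N ≤ i → i < k → (p i, p (i + 1)) ∈ posOrbitals f.fn := by
    intro i hi hik
    have hNpos : (p N, p (N + 1)) ∈ posOrbitals f.fn := by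
      have h1 := Nat.find_spec hex
      rw [← hN] at h1
      have h2 := h1.resolve_left (by omega)
      exact (pos_or_neg ((horb _).2 ⟨N, by omega, rfl⟩)).resolve_right h2
    refine (pos_or_neg ((horb _).2 ⟨i, hik, rfl⟩)).resolve_right fun h => ?_
    have h3 := hpn _ hNpos _ h
    exact absurd (h3.trans (hmono N i hi hik.le)) (hstrict i hik).not_ge
  have hrep : IsRep f.fn k N p :=
    ⟨hkpos, hNk, hstrict, horb, fun i hi => (hneg i hi).2, fun i hi hik => (hpos i hi hik).2⟩
  rw [hrep.ncard_negOrbitals, hrep.ncard_posOrbitals] at hc1 hc2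
  exact ⟨k, N, p, hrep, by omega⟩

/-! ### The expanding map of a standard function -/

namespace MarkedFunction

open Classical in
/-- The left end point of the right foot. -/
noncomputable def rightStart (f : MarkedFunction) (J : orbitals f.fn) : I :=
  if J.1 ∈ posOrbitals f.fn then f.fn (f.mark J) else f.fn.symm (f.mark J)

variable {f g : MarkedFunction} {J : orbitals f.fn}

theorem rightStart_of_pos (h : J.1 ∈ posOrbitals f.fn) : f.rightStart J = f.fn (f.mark J) :=
  if_pos h

theorem rightStart_of_neg (h : J.1 ∈ negOrbitals f.fn) : f.rightStart J = f.fn.symm (f.mark J) :=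
  if_neg fun h' => not_pos_and_neg h' h

theorem mark_lt_rightStart (f : MarkedFunction) (J : orbitals f.fn) : f.mark J < f.rightStart J := by
  rcases pos_or_neg J.2 with h | h
  · rw [rightStart_of_pos h]
    exact h.2 _ (f.mark_mem J)
  · rw [rightStart_of_neg h, OrderIso.lt_symm_apply]
    exact h.2 _ (f.mark_mem J)

theorem rightStart_lt (f : MarkedFunction) (J : orbitals f.fn) : f.rightStart J < J.1.2 := by
  rcases pos_or_neg J.2 with h | h
  · rw [rightStart_of_pos h, ← J.2.2.2.1]
    exact f.fn.strictMono (f.mark_mem J).2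
  · rw [rightStart_of_neg h, OrderIso.symm_apply_lt, J.2.2.2.1]
    exact (f.mark_mem J).2

/-- The union of the open feet. -/
def openFeet (f : MarkedFunction) : Set I :=
  ⋃ J : orbitals f.fn, Set.Ioo J.1.1 (f.mark J) ∪ Set.Ioo (f.rightStart J) J.1.2

theorem isOpen_openFeet (f : MarkedFunction) : IsOpen f.openFeet :=
  isOpen_iUnion fun _ => isOpen_Ioo.union isOpen_Ioo

theorem openFeet_subset (f : MarkedFunction) : f.openFeet ⊆ ⋃ J, f.feet J :=
  Set.iUnion_mono fun _ => Set.union_subset_union_right _ Set.Ioo_subset_Ico_self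

theorem leftFoot_subset (f : MarkedFunction) (J : orbitals f.fn) :
    Set.Ioo J.1.1 (f.mark J) ⊆ f.openFeet :=
  Set.subset_iUnion_of_subset J Set.subset_union_left

theorem rightFoot_subset (f : MarkedFunction) (J : orbitals f.fn) :
    Set.Ioo (f.rightStart J) J.1.2 ⊆ f.openFeet :=
  Set.subset_iUnion_of_subset J Set.subset_union_right

theorem disjoint_openFeet (hfg : f ≠ g) (h : IsFast {f, g}) :
    Disjoint f.openFeet g.openFeet := by
  refine Set.disjoint_of_subset f.openFeet_subset g.openFeet_subset ?_
  rw [Set.disjoint_iUnion_left]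
  intro J
  rw [Set.disjoint_iUnion_right]
  intro K
  exact h.2.2 f (by simp) g (by simp) J K (Or.inl hfg)

/-- The expanding map of a marked function. -/
def toExpanding (f : MarkedFunction) (k N : ℕ) (p : ℕ → I) : ExpandingMap where
  fn := f.fn
  l i := p (min i N)
  r i := p (max (k - i) N)
  F := f.openFeet

theorem isExpanding {k N : ℕ} {p : ℕ → I} (h : IsRep f.fn k N p)
    (hN : k = 2 * N ∨ k = 2 * N + 1) : (f.toExpanding k N p).IsExpanding where
  mono i j hij := h.le_of_le (by omega) (by have := h.N_le; omega)
  anti i j hij := h.le_of_le (by omega) (by have := h.N_le; omega)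
  le i j := h.le_of_le (by omega) (by have := h.N_le; omega)
  meet := ⟨k, congrArg p (by have := h.N_le; omega)⟩
  lt := h.lt_of_lt (by have := h.k_pos; omega) (by have := h.N_le; omega)
  support x hx := by
    refine h.eq_of_le_or_ge ?_
    have := h.N_le
    simpa [toExpanding, this] using hx
  fix_l i := h.apply_p (by have := h.N_le; omega)
  fix_r i := h.apply_p (by have := h.N_le; omega)
  move_l i x h1 h2 := by
    change p (min i N) ≤ x at h1
    change x ≤ p (min (i + 1) N) at h2
    change f.fn x ≤ x
    have hN := h.N_le
    rcases h1.eq_or_lt with h1 | h1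
    · rw [← h1, h.apply_p (by omega)]
    rcases h2.eq_or_lt with h2 | h2
    · rw [h2, h.apply_p (by omega)]
    rcases Nat.lt_or_ge i N with h3 | h3
    · rw [min_eq_left h3.le] at h1
      rw [min_eq_left h3] at h2
      exact (h.neg i h3 x ⟨h1, h2⟩).le
    · rw [min_eq_right h3] at h1
      rw [min_eq_right (by omega)] at h2
      exact absurd h2 h1.not_gt
  move_r i x h1 h2 := by
    change p (max (k - (i + 1)) N) ≤ x at h1
    change x ≤ p (max (k - i) N) at h2
    change x ≤ f.fn x
    have hN := h.N_le
    rcases h1.eq_or_lt with h1 | h1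
    · rw [← h1, h.apply_p (by omega)]
    rcases h2.eq_or_lt with h2 | h2
    · rw [h2, h.apply_p (by omega)]
    rcases Nat.lt_or_ge N (k - i) with h3 | h3
    · rw [max_eq_left (by omega)] at h1
      rw [max_eq_left h3.le, show k - i = k - (i + 1) + 1 by omega] at h2
      exact (h.pos (k - (i + 1)) (by omega) (by omega) x ⟨h1, h2⟩).le
    · rw [max_eq_right (by omega)] at h1
      rw [max_eq_right h3] at h2
      exact absurd h2 h1.not_gt
  F_open := f.isOpen_openFeet
  F_sub x hx := by
    obtain ⟨J, hJ⟩ := Set.mem_iUnion.1 hx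
    have hxJ : x ∈ Set.Ioo J.1.1 J.1.2 := by
      rcases hJ with hJ | hJ
      · exact ⟨hJ.1, hJ.2.trans (f.mark_mem J).2⟩
      · exact ⟨((f.mark_mem J).1.trans (f.mark_lt_rightStart J)).trans hJ.1, hJ.2⟩
    obtain ⟨i, hi, hJi⟩ := (h.orb J.1).1 J.2
    rw [hJi] at hxJ
    have hN := h.N_le
    exact ⟨(h.le_of_le (by omega) (by omega)).trans_lt hxJ.1,
      hxJ.2.trans_le (h.le_of_le (by omega) (by omega))⟩
  foot_l i := by
    have hN' := h.N_le
    have hk := h.k_pos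
    -- For `i ≥ N` this is the orbital to the right of the centre; it exists because a standard
    -- function has a positive orbital, so `N < k`.
    let J : orbitals f.fn := ⟨_, h.mem (i := min i N) (by omega)⟩
    exact ⟨f.mark J, (f.mark_mem J).1, f.leftFoot_subset J⟩
  foot_r i := by
    have hN' := h.N_le
    have hk := h.k_pos
    change p _ = p _ ∨ ∃ x, x < p _ ∧ Set.Ioo x (p _) ⊆ _
    -- The index `0` occurs only if `N = 0`; the point is then the left end of the whole support.
    rcases Nat.eq_zero_or_pos (max (k - i) N) with h0 | h0
    · exact Or.inl (congrArg p (by omega))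
    · right
      obtain ⟨m, hm⟩ := Nat.exists_eq_succ_of_ne_zero h0.ne'
      rw [hm]
      let J : orbitals f.fn := ⟨_, h.mem (i := m) (by omega)⟩
      exact ⟨f.rightStart J, f.rightStart_lt J, f.rightFoot_subset J⟩
  bump_l i hi := by
    change p _ < p _ at hi
    change ∃ α β, p (min i N) < α ∧ α < β ∧ β < p (min (i + 1) N) ∧ f.fn β = α ∧
      Set.Ioo (p (min i N)) α ⊆ f.openFeet ∧ Set.Ioo β (p (min (i + 1) N)) ⊆ f.openFeet
    have h3 : i < N := by
      by_contra! h3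
      rw [min_eq_right h3, min_eq_right (by omega)] at hi
      exact lt_irrefl _ hi
    rw [min_eq_left h3.le, min_eq_left (by omega)]
    have hneg := h.neg_mem h3
    let J : orbitals f.fn := ⟨_, hneg.1⟩
    refine ⟨f.mark J, f.rightStart J, (f.mark_mem J).1, f.mark_lt_rightStart J,
      f.rightStart_lt J, ?_, f.leftFoot_subset J, f.rightFoot_subset J⟩
    rw [rightStart_of_neg hneg, OrderIso.apply_symm_apply]
  bump_r i hi := by
    change p _ < p _ at hi
    change ∃ γ δ, p (max (k - (i + 1)) N) < γ ∧ γ < δ ∧ δ < p (max (k - i) N) ∧ f.fn γ = δ ∧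
      Set.Ioo (p (max (k - (i + 1)) N)) γ ⊆ f.openFeet ∧
      Set.Ioo δ (p (max (k - i) N)) ⊆ f.openFeet
    have h3 : N < k - i := by
      by_contra! h3
      rw [max_eq_right h3, max_eq_right (by omega)] at hi
      exact lt_irrefl _ hi
    rw [max_eq_left (by omega), max_eq_left h3.le, show k - i = k - (i + 1) + 1 by omega]
    have hpos := h.pos_mem (i := k - (i + 1)) (by omega) (by omega)
    let J : orbitals f.fn := ⟨_, hpos.1⟩
    refine ⟨f.mark J, f.rightStart J, (f.mark_mem J).1, f.mark_lt_rightStart J,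
      f.rightStart_lt J, ?_, f.leftFoot_subset J, f.rightFoot_subset J⟩
    exact (rightStart_of_pos hpos).symm

end MarkedFunction

theorem HasLevel.r_zero_lt {t : ℕ} {f g : ExpandingMap} (h : HasLevel t f g)
    (hg : g.IsExpanding) : f.r 0 < g.r 0 := by
  rcases t.eq_zero_or_pos with rfl | ht
  · exact (h.even 0 rfl).trans_lt hg.lt
  · exact h.r_lt 0 (by omega)

/-! ### Reductions -/

theorem IsRep.reduction {f f' : I ≃o I} {k N : ℕ} {p : ℕ → I} (h : IsRep f k N p) (hN1 : 1 ≤ N)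
    (hN2 : N + 2 ≤ k)
    (horb : orbitals f' = {J ∈ orbitals f |
        (∃ K ∈ orbitals f, K.1 < J.1) ∧ ∃ K ∈ orbitals f, J.1 < K.1})
    (hfn : ∀ J ∈ orbitals f', ∀ t ∈ Set.Ioo J.1 J.2, f' t = f t) :
    IsRep f' (k - 2) (N - 1) (fun i => p (i + 1)) := by
  have hmem : ∀ J, J ∈ orbitals f' ↔ ∃ i < k - 2, J = (p (i + 1), p (i + 1 + 1)) := by
    intro J
    rw [horb]
    constructor
    · rintro ⟨hJ, ⟨K, hK, hKJ⟩, L, hL, hJL⟩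
      obtain ⟨i, hi, rfl⟩ := (h.orb _).1 hJ
      obtain ⟨j, hj, rfl⟩ := (h.orb _).1 hK
      obtain ⟨m, hm, rfl⟩ := (h.orb _).1 hL
      have h1 : j < i := by
        by_contra! h1
        exact absurd hKJ (h.le_of_le h1 hj.le).not_gt
      have h2 : i < m := by
        by_contra! h1
        exact absurd hJL (h.le_of_le h1 hi.le).not_gt
      exact ⟨i - 1, by omega, by rw [Nat.sub_add_cancel (by omega)]⟩
    · rintro ⟨i, hi, rfl⟩
      refine ⟨h.mem (by omega), ⟨_, h.mem (i := 0) (by omega), h.lt_of_lt (by omega) (by omega)⟩,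
        _, h.mem (i := k - 1) (by omega), h.lt_of_lt (by omega) (by omega)⟩
  have hfn' : ∀ i < k - 2, ∀ t ∈ Set.Ioo (p (i + 1)) (p (i + 1 + 1)), f' t = f t :=
    fun i hi => hfn _ ((hmem _).2 ⟨i, hi, rfl⟩)
  refine ⟨by omega, by omega, fun i hi => h.strict (i + 1) (by omega), hmem, ?_, ?_⟩
  · intro i hi t ht
    rw [hfn' i (by omega) t ht]
    exact h.neg (i + 1) (by omega) t ht
  · intro i hi hk t ht
    rw [hfn' i hk t ht]
    exact h.pos (i + 1) (by omega) (by omega) t ht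

theorem isRep_of_single {f : I ≃o I} {a b : I} (ho : orbitals f = {(a, b)})
    (hp : posOrbitals f = {(a, b)}) : IsRep f 1 0 (fun i => if i = 0 then a else b) := by
  have h1 : (a, b) ∈ posOrbitals f := by rw [hp]; rfl
  refine ⟨one_pos, Nat.zero_le _, ?_, ?_, fun i hi => absurd hi (by omega), ?_⟩
  · intro i hi
    obtain rfl : i = 0 := by omega
    exact h1.1.1
  · intro J
    rw [ho]
    constructor
    · rintro rfl
      exact ⟨0, one_pos, rfl⟩
    · rintro ⟨i, hi, rfl⟩
      obtain rfl : i = 0 := by omega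
      rfl
  · intro i _ hi t ht
    obtain rfl : i = 0 := by omega
    exact h1.2 t ht

/-- Raising the level: `g'` is obtained from `g` by removing its outer intervals. -/
theorem HasLevel.of_shift {t : ℕ} {f g g' : ExpandingMap} (hl : ∀ i, g'.l i = g.l (i + 1))
    (hr : ∀ i, g'.r i = g.r (i + 1)) (h : HasLevel t g' f) (h1 : g.l 0 < f.l 0)
    (h2 : f.r 0 < g.r 0) : HasLevel (t + 1) f g where
  l_lt i hi := by
    cases i with
    | zero => exact h1
    | succ i => exact hl i ▸ h.l_lt' i (by omega)
  r_lt i hi := by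
    cases i with
    | zero => exact h2
    | succ i => exact hr i ▸ h.r_lt' i (by omega)
  l_lt' i hi := hl i ▸ h.l_lt i (by omega)
  r_lt' i hi := hr i ▸ h.r_lt i (by omega)
  even i hi := by
    cases i with
    | zero => omega
    | succ i => exact hl i ▸ h.odd i (by omega)
  odd i hi := hr i ▸ h.even i (by omega)

theorem IsStandardPair.isFast {f g : MarkedFunction} (h : IsStandardPair f g) : IsFast {f, g} := by
  cases h with
  | left _ _ _ _ hfast => exact hfast
  | nested _ _ _ _ _ hfast => exact hfast

/-- Replacing `g` by its reduction removes the outermost of the nested intervals, so each step of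
the recursive definition raises the level by one. A reduction of a `g` with at most two orbitals is
a bump on a foot, which other functions cannot enter. -/
theorem IsStandardPair.exists_hasLevel {f g : MarkedFunction} (h : IsStandardPair f g)
    {k N k' N' : ℕ} {p q : ℕ → I} (hf : IsRep f.fn k N p) (hg : IsRep g.fn k' N' q)
    (hN : k = 2 * N ∨ k = 2 * N + 1) (hN' : k' = 2 * N' ∨ k' = 2 * N' + 1) :
    ∃ t, HasLevel t (f.toExpanding k N p) (g.toExpanding k' N' q) := by
  induction h generalizing k N p k' N' q with
  | left f g _ _ _ h =>
    rw [leftOf_iff hf hg] at h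
    refine ⟨0, by omega, by omega, by omega, by omega, ?_, by omega⟩
    intro i hi
    obtain rfl : i = 0 := by omega
    have := hf.N_le
    simpa [MarkedFunction.toExpanding, this] using h
  | nested f g g' _ _ hfast hnest hg' _ ih =>
    have h := (nestedIn_iff hf hg).1 hnest
    have hNk := hf.N_le
    have hNk' := hg.N_le
    have hk' := hg.k_pos
    have h1 : (g.toExpanding k' N' q).l 0 < (f.toExpanding k N p).l 0 := by
      simpa [MarkedFunction.toExpanding] using h.1
    have h2 : (f.toExpanding k N p).r 0 < (g.toExpanding k' N' q).r 0 := by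
      simpa [MarkedFunction.toExpanding, hNk, hNk'] using h.2
    have hfe := MarkedFunction.isExpanding hf hN
    rcases hg' with ⟨hcard, horb, hfn⟩ | ⟨hcard, J, hJ, ho, hp⟩
    · rw [hg.ncard_orbitals] at hcard
      have hrep := hg.reduction (f' := g'.fn) (by omega) (by omega) horb fun J hJ =>
        (hfn J ((horb ▸ hJ : _ ∈ {J ∈ _ | _}).1) hJ).2
      obtain ⟨t, ht⟩ := ih hrep hf (by omega) hN
      refine ⟨t + 1, HasLevel.of_shift (fun i => ?_) (fun i => ?_) ht h1 h2⟩
      · exact congrArg q (by omega)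
      · exact congrArg q (by omega)
    · rw [hg.ncard_orbitals] at hcard
      have hrep := isRep_of_single ho hp
      obtain ⟨t, ht⟩ := ih hrep hf (by omega) hN
      have hJ1 : J.1 = (q N', q (N' + 1)) := by
        rw [hg.posOrbitals_eq] at hJ
        obtain ⟨j, hj, hj'⟩ := hJ
        rw [← hj', show j = N' by have := hj.1; have : j < k' := hj.2; omega]
      set s := g.mark J with hs
      have hne : f ≠ g := by
        rintro rfl
        exact lt_irrefl _ ((nestedIn_iff hf hf).1 hnest).1
      have hcs : J.1.1 = q N' := congrArg Prod.fst hJ1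
      have hlt : q N' < s := hcs ▸ (g.mark_mem J).1
      have hfoot : Set.Ioo (q N') s ⊆ g.openFeet := hcs ▸ g.leftFoot_subset J
      have hgl : ∀ i, (g.toExpanding k' N' q).l (i + 1) = q N' :=
        fun i => congrArg q (by omega)
      have hgr : ∀ i, (g.toExpanding k' N' q).r (i + 1) = q N' :=
        fun i => congrArg q (by omega)
      have hl' : ∀ i, (g'.toExpanding 1 0 (fun i => if i = 0 then J.1.1 else s)).l i = q N' :=
        fun i => by simp [MarkedFunction.toExpanding, hcs]
      have hr0' : (g'.toExpanding 1 0 (fun i => if i = 0 then J.1.1 else s)).r 0 = s := by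
        simp [MarkedFunction.toExpanding]
      -- A level of at least `2` of `g'` with `f` would put the point `f.l 1` inside the foot `(q
      -- N', s)` of `g`, against fastness.
      rcases Nat.lt_or_ge t 2 with ht2 | ht2
      · refine ⟨t + 1, ?_, ?_, ?_, ?_, ?_, ?_⟩
        · intro i hi
          obtain rfl : i = 0 := by omega
          exact h1
        · intro i hi
          obtain rfl : i = 0 := by omega
          exact h2
        · intro i hi
          obtain rfl : i = 0 := by omega
          rw [hgl, ← hl' 0]
          exact ht.l_lt 0 (by omega)
        · intro i hi
          obtain rfl : i = 0 := by omega
          rw [hgr]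
          refine hlt.trans ?_
          rw [← hr0']
          exact ht.r_lt 0 (by omega)
        · intro i hi
          obtain rfl : i = 1 := by omega
          rw [hgl 0, ← hl' 0]
          exact ht.odd 0 (by omega)
        · intro i hi
          obtain rfl : i = 0 := by omega
          rw [hgr]
          refine hlt.le.trans ?_
          rw [← hr0']
          exact ht.even 0 (by omega)
      · exfalso
        have h3 := ht.l_lt' 0 (by omega)
        have h4 := ht.r_lt' 0 (by omega)
        rw [hl'] at h3
        rw [hr0'] at h4
        exact hfe.l_notMem_foot (MarkedFunction.disjoint_openFeet hne hfast) hfoot h3.le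
          ((hfe.le 1 1).trans_lt h4)

/-! ### Groups generated by standard generating sets -/

theorem IsStandardGeneratingSet.isElementaryAmenable {A : Set MarkedFunction}
    (hA : IsStandardGeneratingSet A) : IsElementaryAmenable (generatedGroup A) := by
  classical
  obtain ⟨hfin, hstd, hpair⟩ := hA
  choose k N p hrep hN using fun f : A => exists_isRep_of_isStandardFunction (hstd f f.2)
  let e : A → ExpandingMap := fun f => f.1.toExpanding (k f) (N f) (p f)
  have hexp : ∀ f, (e f).IsExpanding := fun f => MarkedFunction.isExpanding (hrep f) (hN f)
  have hlevel : ∀ f g : A, IsStandardPair f.1 g.1 → ∃ t, HasLevel t (e f) (e g) := fun f g h =>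
    h.exists_hasLevel (hrep f) (hrep g) (hN f) (hN g)
  have hlt : ∀ f g : A, IsStandardPair f.1 g.1 → (e f).r 0 < (e g).r 0 := fun f g h => by
    obtain ⟨t, ht⟩ := hlevel f g h
    exact ht.r_zero_lt (hexp g)
  -- The right end of the support increases strictly along standard pairs, so it orders the
  -- generators.
  have hinj : Function.Injective fun f => (e f).r 0 := by
    intro f g hfg
    by_contra hne
    rcases hpair f f.2 g g.2 fun h => hne (Subtype.ext h) with h | h
    · exact (hlt f g h).ne hfg
    · exact (hlt g f h).ne' hfg
  let _ : LinearOrder A := LinearOrder.lift' _ hinj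
  have := hfin.to_subtype
  have hpair' : ∀ f g : A, f < g → IsStandardPair f.1 g.1 := fun f g hfg => by
    have hne : f ≠ g := hfg.ne
    have hfg' : (e f).r 0 < (e g).r 0 := hfg
    refine (hpair f f.2 g g.2 fun h => hne (Subtype.ext h)).resolve_right fun h => ?_
    exact lt_asymm hfg' (hlt g f h)
  let ℓ : A → A → ℕ := fun f g => if h : f < g then (hlevel f g (hpair' f g h)).choose else 0
  have hfam : IsLevelFamily e ℓ := by
    refine ⟨hexp, fun f g hne => ?_, fun f g hfg => ?_⟩
    · have hne' : f.1 ≠ g.1 := fun h => hne (Subtype.ext h)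
      rcases hpair f f.2 g g.2 hne' with h | h
      · exact MarkedFunction.disjoint_openFeet hne' h.isFast
      · exact (MarkedFunction.disjoint_openFeet hne'.symm h.isFast).symm
    · simp only [ℓ, dif_pos hfg]
      exact (hlevel f g (hpair' f g hfg)).choose_spec
  refine hfam.isElementaryAmenable.mono (Subgroup.closure_mono ?_)
  rintro _ ⟨f, hf, rfl⟩
  exact ⟨⟨f, hf⟩, rfl⟩

/-! ### Thompson's group is not elementary amenable

Thompson's group is generated by two elements `a`, `b` subject to the relations that `a * b⁻¹`
commutes with `a⁻¹ * b * a` and with `a⁻² * b * a²`. -/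

section ThompsonPairs

open scoped commutatorElement

variable {G : Type*} [Group G]

/-- The first relator of Thompson's group. -/
def thompsonRel₁ (a b : G) : G := ⁅a * b⁻¹, a⁻¹ * b * a⁆

/-- The second relator of Thompson's group. -/
def thompsonRel₂ (a b : G) : G := ⁅a * b⁻¹, a⁻¹ * (a⁻¹ * b * a) * a⁆

/-- Two elements that satisfy the relations of Thompson's group and do not commute. -/
structure IsThompsonPair (a b : G) : Prop where
  rel₁ : thompsonRel₁ a b = 1
  rel₂ : thompsonRel₂ a b = 1
  ne : ⁅a, b⁆ ≠ 1

/-- The standard infinite generating sequence of Thompson's group. -/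
def thompsonSeq (a b : G) : ℕ → G
  | 0 => b
  | n + 1 => a⁻¹ * thompsonSeq a b n * a

namespace IsThompsonPair

variable {a b : G}

/-- The infinite presentation follows from the two relations. Conjugation by `a` shifts indices, so
it suffices to treat `i = 0`; there each relation follows from the previous two and shifts of the
first. -/
theorem seq_mul_seq (h : IsThompsonPair a b) (i m : ℕ) :
    thompsonSeq a b (i + m + 1) * thompsonSeq a b i =
      thompsonSeq a b i * thompsonSeq a b (i + m + 2) := by
  have shift : ∀ u v w z : ℕ, thompsonSeq a b u * thompsonSeq a b v =
      thompsonSeq a b w * thompsonSeq a b z → ∀ i, thompsonSeq a b (u + i) *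
        thompsonSeq a b (v + i) = thompsonSeq a b (w + i) * thompsonSeq a b (z + i) := by
    intro u v w z h i
    induction i with
    | zero => exact h
    | succ i ih =>
      change a⁻¹ * thompsonSeq a b (u + i) * a * (a⁻¹ * thompsonSeq a b (v + i) * a) =
        a⁻¹ * thompsonSeq a b (w + i) * a * (a⁻¹ * thompsonSeq a b (z + i) * a)
      calc _ = a⁻¹ * (thompsonSeq a b (u + i) * thompsonSeq a b (v + i)) * a := by group
        _ = _ := by rw [ih]; group
  have h1 : thompsonSeq a b 1 * b = b * thompsonSeq a b 2 := by
    have := commutatorElement_eq_one_iff_mul_comm.1 h.rel₁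
    simp only [thompsonSeq]
    calc _ = b * a⁻¹ * (a * b⁻¹ * (a⁻¹ * b * a)) * b := by group
      _ = _ := by rw [this]; group
  have h2 : thompsonSeq a b 2 * b = b * thompsonSeq a b 3 := by
    have := commutatorElement_eq_one_iff_mul_comm.1 h.rel₂
    simp only [thompsonSeq]
    calc _ = b * a⁻¹ * (a * b⁻¹ * (a⁻¹ * (a⁻¹ * b * a) * a)) * b := by group
      _ = _ := by rw [this]; group
  have h3 : ∀ m, thompsonSeq a b (m + 1) * b = b * thompsonSeq a b (m + 2) ∧
      thompsonSeq a b (m + 2) * b = b * thompsonSeq a b (m + 3) := by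
    intro m
    induction m with
    | zero => exact ⟨h1, h2⟩
    | succ m ih =>
      refine ⟨ih.2, ?_⟩
      have h4 := shift 1 0 0 2 h1 (m + 1)
      have h5 := shift 1 0 0 2 h1 (m + 2)
      rw [show 1 + (m + 1) = m + 2 by ring, show 0 + (m + 1) = m + 1 by ring,
        show 2 + (m + 1) = m + 3 by ring] at h4
      rw [show 1 + (m + 2) = m + 3 by ring, show 0 + (m + 2) = m + 2 by ring,
        show 2 + (m + 2) = m + 4 by ring] at h5
      change thompsonSeq a b (m + 3) * b = b * thompsonSeq a b (m + 4)
      apply mul_left_cancel (a := thompsonSeq a b (m + 1))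
      rw [← mul_assoc, ← h4, mul_assoc, ih.1, ← mul_assoc, ih.2, mul_assoc, h5, ← mul_assoc,
        ← ih.1, mul_assoc]
  have := shift (m + 1) 0 0 (m + 2) (h3 m).1 i
  rw [show m + 1 + i = i + m + 1 by ring, show 0 + i = i by ring,
    show m + 2 + i = i + m + 2 by ring] at this
  exact this

theorem seq_ne (h : IsThompsonPair a b) : thompsonSeq a b 0 ≠ thompsonSeq a b 1 := by
  intro h1
  refine h.ne (commutatorElement_eq_one_iff_mul_comm.2 ?_)
  change b = a⁻¹ * b * a at h1
  rw [eq_comm, mul_assoc, inv_mul_eq_iff_eq_mul] at h1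
  exact h1.symm

theorem seq_ne' (h : IsThompsonPair a b) : thompsonSeq a b 1 ≠ thompsonSeq a b 2 := by
  intro h1
  refine h.seq_ne ?_
  change a⁻¹ * b * a = a⁻¹ * (a⁻¹ * b * a) * a at h1
  exact mul_left_cancel (mul_right_cancel h1)

/-- The derived subgroup contains another pair. -/
theorem derived (h : IsThompsonPair a b) :
    IsThompsonPair (thompsonSeq a b 0 * (thompsonSeq a b 2)⁻¹)
      (thompsonSeq a b 1 * (thompsonSeq a b 2)⁻¹) := by
  have hrel := h.seq_mul_seq
  set x := thompsonSeq a b with hx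
  have h01 := hrel 0 0
  have h02 := hrel 0 1
  have h03 := hrel 0 2
  have h12 := hrel 1 0
  have h13 := hrel 1 1
  have h14 := hrel 1 2
  have h04 := hrel 0 3
  simp only [Nat.reduceAdd] at h01 h02 h03 h12 h13 h14 h04
  -- Conjugation by `x 0` and by `x 1` both shift `x j`, so `x 0 * (x 1)⁻¹` commutes with it.
  have hcomm : ∀ j, x j * x 0 = x 0 * x (j + 1) → x j * x 1 = x 1 * x (j + 1) →
      Commute (x 0 * (x 1)⁻¹) (x j) := by
    intro j h1 h2
    change x 0 * (x 1)⁻¹ * x j = x j * (x 0 * (x 1)⁻¹)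
    rw [← mul_assoc, h1, mul_assoc, mul_assoc, mul_right_inj, inv_mul_eq_iff_eq_mul, ← mul_assoc,
      ← h2, mul_inv_cancel_right]
  have hc2 := hcomm 2 h02 h12
  have hc3 := hcomm 3 h03 h13
  have hc4 := hcomm 4 h04 h14
  have e1 : x 0 * (x 2)⁻¹ * (x 1 * (x 2)⁻¹)⁻¹ = x 0 * (x 1)⁻¹ := by group
  -- The conjugates in the relators of the new pair are words in `x 2`, `x 3`, `x 4`, with which `x
  -- 0 * (x 1)⁻¹` commutes.
  have e2 : (x 0 * (x 2)⁻¹)⁻¹ * (x 1 * (x 2)⁻¹) * (x 0 * (x 2)⁻¹) =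
      x 2 * (x 2 * (x 3)⁻¹) * (x 2)⁻¹ := by
    have h1 : (x 0)⁻¹ * x 1 * x 0 = x 2 := by rw [mul_assoc, h01]; group
    have h2 : (x 0)⁻¹ * x 2 * x 0 = x 3 := by rw [mul_assoc, h02]; group
    calc _ = x 2 * ((x 0)⁻¹ * x 1 * x 0 * ((x 0)⁻¹ * x 2 * x 0)⁻¹) * (x 2)⁻¹ := by group
      _ = _ := by rw [h1, h2]
  have e3 : (x 0 * (x 2)⁻¹)⁻¹ * (x 2 * (x 2 * (x 3)⁻¹) * (x 2)⁻¹) * (x 0 * (x 2)⁻¹) =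
      x 2 * (x 3 * (x 3 * (x 4)⁻¹) * (x 3)⁻¹) * (x 2)⁻¹ := by
    have h1 : (x 0)⁻¹ * x 2 * x 0 = x 3 := by rw [mul_assoc, h02]; group
    have h2 : (x 0)⁻¹ * x 3 * x 0 = x 4 := by rw [mul_assoc, h03]; group
    calc _ = x 2 * ((x 0)⁻¹ * x 2 * x 0 * ((x 0)⁻¹ * x 2 * x 0 *
          ((x 0)⁻¹ * x 3 * x 0)⁻¹) * ((x 0)⁻¹ * x 2 * x 0)⁻¹) * (x 2)⁻¹ := by group
      _ = _ := by rw [h1, h2]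
  constructor
  · rw [thompsonRel₁, e1, e2]
    exact commutatorElement_eq_one_iff_commute.2
      ((hc2.mul_right (hc2.mul_right hc3.inv_right)).mul_right hc2.inv_right)
  · rw [thompsonRel₂, e1, e2, e3]
    exact commutatorElement_eq_one_iff_commute.2 ((hc2.mul_right ((hc3.mul_right
      (hc3.mul_right hc4.inv_right)).mul_right hc3.inv_right)).mul_right hc2.inv_right)
  · intro h1
    have h2 : Commute (x 0 * (x 2)⁻¹) (x 1 * (x 2)⁻¹) := commutatorElement_eq_one_iff_commute.1 h1
    have h3 : Commute (x 0 * (x 1)⁻¹) (x 1 * (x 2)⁻¹) := by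
      rw [← e1]
      exact h2.mul_left (Commute.refl _).inv_left
    have h4 : Commute (x 0 * (x 1)⁻¹) (x 1) := by
      simpa using h3.mul_right hc2
    have h5 : Commute (x 0) (x 1) := by
      simpa using h4.mul_left (Commute.refl (x 1))
    have h6 : x 1 * x 0 = x 0 * x 1 := h5.eq.symm
    rw [h01, mul_right_inj] at h6
    exact h.seq_ne' h6.symm

/-- Modulo `M` conjugation by `a` fixes `b`, so all members of the sequence coincide. -/
theorem derived_mem (M : Subgroup G) [M.Normal] (hab : ⁅a, b⁆ ∈ M) :
    thompsonSeq a b 0 * (thompsonSeq a b 2)⁻¹ ∈ M ∧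
      thompsonSeq a b 1 * (thompsonSeq a b 2)⁻¹ ∈ M := by
  have hcomm : (a : G ⧸ M) * b = b * a := by
    rw [← QuotientGroup.eq_one_iff] at hab
    exact commutatorElement_eq_one_iff_mul_comm.1 hab
  have hx : ∀ n, ((thompsonSeq a b n : G) : G ⧸ M) = b := by
    intro n
    induction n with
    | zero => rfl
    | succ n ih =>
      change ((a⁻¹ * thompsonSeq a b n * a : G) : G ⧸ M) = b
      rw [QuotientGroup.mk_mul, QuotientGroup.mk_mul, ih, QuotientGroup.mk_inv, mul_assoc, ← hcomm,
        inv_mul_cancel_left]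
  constructor <;>
  · rw [← QuotientGroup.eq_one_iff, QuotientGroup.mk_mul, QuotientGroup.mk_inv, hx, hx,
      mul_inv_cancel]

/-- If `a` has order dividing `m > 0`, the sequence has period `m`, and the relation between its
members with indices `m` and `0` forces the first two members to be equal. -/
theorem not_finite [Finite G] (h : IsThompsonPair a b) : False := by
  obtain ⟨m, hm, hm'⟩ := (isOfFinOrder_of_finite a).exists_pow_eq_one
  have hseq : ∀ n i, thompsonSeq a b (i + n) = (a ^ n)⁻¹ * thompsonSeq a b i * a ^ n := by
    intro n i
    induction n with
    | zero => simp
    | succ n ih =>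
      change a⁻¹ * thompsonSeq a b (i + n) * a = _
      rw [ih, pow_succ]
      group
  have h1 : ∀ i, thompsonSeq a b (i + m) = thompsonSeq a b i := fun i => by
    rw [hseq, hm']; simp
  obtain ⟨n, rfl⟩ := Nat.exists_eq_add_of_lt hm
  have h2 := h.seq_mul_seq 0 n
  have h3 := h1 0
  have h4 := h1 1
  rw [show 1 + (0 + n + 1) = 0 + n + 2 by ring] at h4
  rw [show 0 + (0 + n + 1) = 0 + n + 1 by ring] at h3
  rw [h3, h4, mul_right_inj] at h2
  exact h.seq_ne h2

end IsThompsonPair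

/-! ### Thompson pairs in sections, and their permanence -/

/-- Some section of `G` contains a pair that satisfies the relations of Thompson's group and does
not commute. -/
def HasThompsonSection (G : Type*) [Group G] : Prop :=
  ∃ (R : Subgroup G) (a b : Subgroup.normalizer (R : Set G)),
    IsThompsonPair (a : Subgroup.normalizer (R : Set G) ⧸ R.subgroupOf (Subgroup.normalizer R)) b

theorem isThompsonPair_coe_iff {R : Subgroup G} {a b : Subgroup.normalizer (R : Set G)} :
    IsThompsonPair (a : Subgroup.normalizer (R : Set G) ⧸ R.subgroupOf (Subgroup.normalizer R)) b ↔
      thompsonRel₁ (a : G) b ∈ R ∧ thompsonRel₂ (a : G) b ∈ R ∧ ⁅(a : G), (b : G)⁆ ∉ R := by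
  have e1 := QuotientGroup.eq_one_iff (N := R.subgroupOf (Subgroup.normalizer R))
    (thompsonRel₁ a b)
  have e2 := QuotientGroup.eq_one_iff (N := R.subgroupOf (Subgroup.normalizer R))
    (thompsonRel₂ a b)
  have e3 := QuotientGroup.eq_one_iff (N := R.subgroupOf (Subgroup.normalizer R)) ⁅a, b⁆
  exact ⟨fun h => ⟨e1.1 h.rel₁, e2.1 h.rel₂, fun h' => h.ne (e3.2 h')⟩,
    fun h => ⟨e1.2 h.1, e2.2 h.2.1, fun h' => h.2.2 (e3.1 h')⟩⟩

theorem hasThompsonSection_iff : HasThompsonSection G ↔ ∃ (R : Subgroup G) (a b : G),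
    a ∈ Subgroup.normalizer (R : Set G) ∧ b ∈ Subgroup.normalizer (R : Set G) ∧
      thompsonRel₁ a b ∈ R ∧ thompsonRel₂ a b ∈ R ∧ ⁅a, b⁆ ∉ R := by
  constructor
  · rintro ⟨R, a, b, h⟩
    exact ⟨R, a, b, a.2, b.2, isThompsonPair_coe_iff.1 h⟩
  · rintro ⟨R, a, b, ha, hb, h⟩
    exact ⟨R, ⟨a, ha⟩, ⟨b, hb⟩, isThompsonPair_coe_iff.2 h⟩

theorem IsThompsonPair.hasThompsonSection {a b : G} (h : IsThompsonPair a b) :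
    HasThompsonSection G := by
  refine hasThompsonSection_iff.2 ⟨⊥, a, b, ?_, ?_, ?_⟩
  · exact (Subgroup.normalizer_eq_top (⊥ : Subgroup G)).ge (Subgroup.mem_top a)
  · exact (Subgroup.normalizer_eq_top (⊥ : Subgroup G)).ge (Subgroup.mem_top b)
  · simp only [Subgroup.mem_bot]
    exact ⟨h.rel₁, h.rel₂, h.ne⟩

theorem map_thompsonRel₁ {H : Type*} [Group H] (φ : G →* H) (a b : G) :
    φ (thompsonRel₁ a b) = thompsonRel₁ (φ a) (φ b) := by
  simp [thompsonRel₁, map_commutatorElement]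

theorem map_thompsonRel₂ {H : Type*} [Group H] (φ : G →* H) (a b : G) :
    φ (thompsonRel₂ a b) = thompsonRel₂ (φ a) (φ b) := by
  simp [thompsonRel₂, map_commutatorElement]

theorem HasThompsonSection.of_injective {H : Type*} [Group H] (φ : H →* G)
    (hφ : Function.Injective φ) (h : HasThompsonSection H) : HasThompsonSection G := by
  obtain ⟨R, a, b, ha, hb, h1, h2, h3⟩ := hasThompsonSection_iff.1 h
  refine hasThompsonSection_iff.2 ⟨R.map φ, φ a, φ b, ?_, ?_, ?_, ?_, ?_⟩
  · exact Subgroup.le_normalizer_map φ ⟨a, ha, rfl⟩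
  · exact Subgroup.le_normalizer_map φ ⟨b, hb, rfl⟩
  · exact ⟨_, h1, map_thompsonRel₁ φ a b⟩
  · exact ⟨_, h2, map_thompsonRel₂ φ a b⟩
  · rwa [← map_commutatorElement, Subgroup.mem_map_iff_mem hφ]

theorem HasThompsonSection.of_surjective {Q : Type*} [Group Q] (φ : G →* Q)
    (hφ : Function.Surjective φ) (h : HasThompsonSection Q) : HasThompsonSection G := by
  obtain ⟨R, a, b, ha, hb, h1, h2, h3⟩ := hasThompsonSection_iff.1 h
  obtain ⟨a, rfl⟩ := hφ a
  obtain ⟨b, rfl⟩ := hφ b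
  refine hasThompsonSection_iff.2 ⟨R.comap φ, a, b, ?_, ?_, ?_, ?_, ?_⟩
  · exact Subgroup.le_normalizer_comap φ ha
  · exact Subgroup.le_normalizer_comap φ hb
  · rwa [Subgroup.mem_comap, map_thompsonRel₁]
  · rwa [Subgroup.mem_comap, map_thompsonRel₂]
  · rwa [Subgroup.mem_comap, map_commutatorElement]

/-- If `⁅a, b⁆` stays nontrivial modulo `R ⊔ N`, the image of the pair in `G ⧸ N` works. Otherwise
the image `M` of `N` in the section contains `⁅a, b⁆`, hence the derived pair, which therefore comes
from `N`. -/
theorem HasThompsonSection.extension (N : Subgroup G) [N.Normal] (h : HasThompsonSection G) :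
    HasThompsonSection N ∨ HasThompsonSection (G ⧸ N) := by
  obtain ⟨R, a, b, hab⟩ := h
  by_cases hc : ((⁅a, b⁆ : Subgroup.normalizer (R : Set G)) : G) ∈ R ⊔ N
  · left
    set M : Subgroup (Subgroup.normalizer (R : Set G) ⧸ R.subgroupOf (Subgroup.normalizer R)) :=
      (N.subgroupOf (Subgroup.normalizer R)).map (QuotientGroup.mk' _) with hM
    have hMn : M.Normal := Subgroup.Normal.map inferInstance _ (QuotientGroup.mk'_surjective _)
    have hcM : ⁅(a : Subgroup.normalizer (R : Set G) ⧸ R.subgroupOf (Subgroup.normalizer R)),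
        (b : _ ⧸ R.subgroupOf (Subgroup.normalizer R))⁆ ∈ M := by
      obtain ⟨r, hr, n, hn, hrn⟩ := Subgroup.mem_sup_of_normal_right.1 hc
      have hr' : r ∈ Subgroup.normalizer (R : Set G) := Subgroup.le_normalizer hr
      have hn' : n ∈ Subgroup.normalizer (R : Set G) := by
        have : n = r⁻¹ * (⁅a, b⁆ : Subgroup.normalizer (R : Set G)) := by rw [← hrn]; group
        rw [this]
        exact mul_mem (inv_mem hr') (Subtype.coe_prop _)
      refine ⟨⟨n, hn'⟩, hn, ?_⟩
      have h3 : ⁅a, b⁆ = ⟨r, hr'⟩ * ⟨n, hn'⟩ := Subtype.ext hrn.symm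
      change _ = ((⁅a, b⁆ : Subgroup.normalizer (R : Set G)) :
        Subgroup.normalizer (R : Set G) ⧸ R.subgroupOf (Subgroup.normalizer R))
      have h4 : ((⟨r, hr'⟩ : Subgroup.normalizer (R : Set G)) :
          Subgroup.normalizer (R : Set G) ⧸ R.subgroupOf (Subgroup.normalizer R)) = 1 :=
        (QuotientGroup.eq_one_iff _).2 hr
      rw [h3, QuotientGroup.mk_mul, h4, one_mul]
      rfl
    obtain ⟨⟨a', ha', ha''⟩, ⟨b', hb', hb''⟩⟩ := IsThompsonPair.derived_mem M hcM
    have hd := hab.derived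
    rw [← ha'', ← hb''] at hd
    obtain ⟨h1, h2, h3⟩ := isThompsonPair_coe_iff.1 hd
    refine hasThompsonSection_iff.2 ⟨R.subgroupOf N, ⟨a', ha'⟩, ⟨b', hb'⟩,
      Subgroup.le_normalizer_comap N.subtype a'.2, Subgroup.le_normalizer_comap N.subtype b'.2,
      h1, h2, h3⟩
  · right
    obtain ⟨h1, h2, -⟩ := isThompsonPair_coe_iff.1 hab
    refine hasThompsonSection_iff.2 ⟨R.map (QuotientGroup.mk' N), QuotientGroup.mk' N a,
      QuotientGroup.mk' N b, Subgroup.le_normalizer_map _ ⟨a, a.2, rfl⟩,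
      Subgroup.le_normalizer_map _ ⟨b, b.2, rfl⟩, ⟨_, h1, rfl⟩, ⟨_, h2, rfl⟩, fun h3 => hc ?_⟩
    have h4 : ((⁅a, b⁆ : Subgroup.normalizer (R : Set G)) : G) ∈
        (R.map (QuotientGroup.mk' N)).comap (QuotientGroup.mk' N) := h3
    rwa [QuotientGroup.comap_map_mk', sup_comm] at h4

/-- A section pair involves only two elements of `G`, and these lie in a common member. -/
theorem HasThompsonSection.directedUnion {𝓗 : Set (Subgroup G)} (hdir : DirectedOn (· ≤ ·) 𝓗)
    (hcover : ∀ g : G, ∃ H ∈ 𝓗, g ∈ H) (h : HasThompsonSection G) :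
    ∃ H ∈ 𝓗, HasThompsonSection H := by
  obtain ⟨R, a, b, ha, hb, h1, h2, h3⟩ := hasThompsonSection_iff.1 h
  obtain ⟨H, hH, haH⟩ := hcover a
  obtain ⟨K, hK, hbK⟩ := hcover b
  obtain ⟨L, hL, hHL, hKL⟩ := hdir H hH K hK
  exact ⟨L, hL, hasThompsonSection_iff.2 ⟨R.subgroupOf L, ⟨a, hHL haH⟩, ⟨b, hKL hbK⟩,
    Subgroup.le_normalizer_comap L.subtype ha, Subgroup.le_normalizer_comap L.subtype hb,
    h1, h2, h3⟩⟩

end ThompsonPairs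

theorem IsElementaryAmenable.not_hasThompsonSection {G : Type} [Group G]
    (h : IsElementaryAmenable G) : ¬ HasThompsonSection G := by
  induction h with
  | of_finite G h =>
    rintro ⟨R, a, b, hab⟩
    exact hab.not_finite
  | of_abelian G h =>
    rintro ⟨R, a, b, hab⟩
    refine hab.ne (commutatorElement_eq_one_iff_mul_comm.2 ?_)
    rw [← QuotientGroup.mk_mul, ← QuotientGroup.mk_mul]
    exact congrArg _ (Subtype.ext (h a b))
  | extension G N hN hQ ihN ihQ => exact fun hG => (hG.extension N).elim ihN ihQ
  | directedUnion G 𝓗 hdir hcover h ih =>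
    intro hG
    obtain ⟨H, hH, h⟩ := hG.directedUnion hdir hcover
    exact ih H hH h
  | subgroup G H φ hφ h ih => exact fun hH => ih (hH.of_injective φ hφ)
  | quotient G Q φ hφ h ih => exact fun hQ => ih (hQ.of_surjective φ hφ)

/-! ### Piecewise linear homeomorphisms -/

namespace OrderIso

/-- The pointwise minimum of two order automorphisms. -/
def minIso {X : Type*} [LinearOrder X] (e₁ e₂ : X ≃o X) : X ≃o X :=
  StrictMono.orderIsoOfRightInverse (fun x => min (e₁ x) (e₂ x))
    (fun _ _ h => min_lt_min (e₁.strictMono h) (e₂.strictMono h))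
    (fun y => max (e₁.symm y) (e₂.symm y)) (fun y => by
      rcases le_total (e₁.symm y) (e₂.symm y) with h | h
      · have h1 : y ≤ e₁ (e₂.symm y) := (e₁.symm_apply_le).1 h
        simp [h, h1]
      · have h1 : y ≤ e₂ (e₁.symm y) := (e₂.symm_apply_le).1 h
        simp [h, h1])

/-- The pointwise maximum of two order automorphisms. -/
def maxIso {X : Type*} [LinearOrder X] (e₁ e₂ : X ≃o X) : X ≃o X :=
  StrictMono.orderIsoOfRightInverse (fun x => max (e₁ x) (e₂ x))
    (fun _ _ h => max_lt_max (e₁.strictMono h) (e₂.strictMono h))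
    (fun y => min (e₁.symm y) (e₂.symm y)) (fun y => by
      rcases le_total (e₁.symm y) (e₂.symm y) with h | h
      · have h1 : e₂ (e₁.symm y) ≤ y := (e₂.le_symm_apply).1 h
        simp [h, h1]
      · have h1 : e₁ (e₂.symm y) ≤ y := (e₁.le_symm_apply).1 h
        simp [h, h1])

/-- The affine map `x ↦ m * x + c`. -/
noncomputable def affine (m c : ℝ) (hm : 0 < m) : ℝ ≃o ℝ :=
  StrictMono.orderIsoOfRightInverse (fun x => m * x + c)
    (fun _ _ h => by
      have := mul_lt_mul_of_pos_left h hm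
      simpa using this)
    (fun y => (y - c) / m) (fun y => by
      simp only
      field_simp
      ring)

@[simp]
theorem affine_apply (m c : ℝ) (hm : 0 < m) (x : ℝ) : affine m c hm x = m * x + c := rfl

/-- The restriction to the unit interval of an order automorphism of `ℝ` that fixes `0` and `1`. -/
def restrictUnitInterval (e : ℝ ≃o ℝ) (h0 : e 0 = 0) (h1 : e 1 = 1) : I ≃o I where
  toFun x := ⟨e x, h0.ge.trans (e.monotone x.2.1), (e.monotone x.2.2).trans h1.le⟩
  invFun x := ⟨e.symm x, e.le_symm_apply.2 (h0.le.trans x.2.1), e.symm_apply_le.2 (x.2.2.trans h1.ge)⟩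
  left_inv x := Subtype.ext (e.symm_apply_apply x)
  right_inv x := Subtype.ext (e.apply_symm_apply x)
  map_rel_iff' := e.le_iff_le

end OrderIso

/-! ### A pair of elements of Thompson's group -/

open OrderIso

theorem IsDyadic.int (m : ℤ) : IsDyadic m := ⟨m, 0, by simp⟩

theorem IsDyadic.add {x y : ℝ} (hx : IsDyadic x) (hy : IsDyadic y) : IsDyadic (x + y) := by
  obtain ⟨m, n, rfl⟩ := hx
  obtain ⟨m', n', rfl⟩ := hy
  refine ⟨m * 2 ^ n' + m' * 2 ^ n, n + n', ?_⟩
  push_cast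
  field_simp
  ring

theorem IsDyadic.neg {x : ℝ} (hx : IsDyadic x) : IsDyadic (-x) := by
  obtain ⟨m, n, rfl⟩ := hx
  exact ⟨-m, n, by push_cast; ring⟩

theorem IsDyadic.half {x : ℝ} (hx : IsDyadic x) : IsDyadic (x / 2) := by
  obtain ⟨m, n, rfl⟩ := hx
  exact ⟨m, n + 1, by rw [pow_succ]; field_simp⟩

theorem isDyadic_add_iff {x c : ℝ} (hc : IsDyadic c) : IsDyadic (x + c) ↔ IsDyadic x :=
  ⟨fun h => by simpa using h.add hc.neg, fun h => h.add hc⟩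

theorem isDyadic_half_iff {x : ℝ} : IsDyadic (x / 2) ↔ IsDyadic x :=
  ⟨fun h => by simpa using h.add h, IsDyadic.half⟩

/-- The negative bump on `(s, s + 1 / 2)` with slopes `1 / 2`, `1`, `2`. -/
noncomputable def thompsonBump (s : ℝ) : ℝ ≃o ℝ :=
  minIso (OrderIso.refl ℝ) (maxIso (maxIso (affine 2⁻¹ (s / 2) (by norm_num))
    (affine 1 (-(1 / 8)) one_pos)) (affine 2 (-(1 / 2) - s) two_pos))

theorem thompsonBump_apply (s x : ℝ) : thompsonBump s x =
    min x (max (max (2⁻¹ * x + s / 2) (1 * x + -(1 / 8))) (2 * x + (-(1 / 2) - s))) := rfl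

theorem thompsonBump_of_le {s x : ℝ} (h : x ≤ s) : thompsonBump s x = x := by
  rw [thompsonBump_apply, min_eq_left]
  exact (le_max_left _ _).trans' ((le_max_left _ _).trans' (by linarith))

theorem thompsonBump_of_ge {s x : ℝ} (h : s + 1 / 2 ≤ x) : thompsonBump s x = x := by
  rw [thompsonBump_apply, min_eq_left]
  exact (le_max_right _ _).trans' (by linarith)

theorem thompsonBump_of_mem_left {s x : ℝ} (h1 : s ≤ x) (h2 : x ≤ s + 1 / 4) :
    thompsonBump s x = 2⁻¹ * x + s / 2 := by
  rw [thompsonBump_apply, max_eq_left (a := max _ _), max_eq_left, min_eq_right]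
  · linarith
  · linarith
  · exact (le_max_left _ _).trans' (by linarith)

theorem thompsonBump_of_mem_mid {s x : ℝ} (h1 : s + 1 / 4 ≤ x) (h2 : x ≤ s + 3 / 8) :
    thompsonBump s x = 1 * x + -(1 / 8) := by
  rw [thompsonBump_apply, max_eq_left (a := max _ _), max_eq_right, min_eq_right]
  · linarith
  · linarith
  · exact (le_max_right _ _).trans' (by linarith)

theorem thompsonBump_of_mem_right {s x : ℝ} (h1 : s + 3 / 8 ≤ x) (h2 : x ≤ s + 1 / 2) :
    thompsonBump s x = 2 * x + (-(1 / 2) - s) := by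
  rw [thompsonBump_apply, max_eq_right (b := 2 * x + (-(1 / 2) - s)), min_eq_right]
  · linarith
  · exact max_le (by linarith) (by linarith)

theorem isDyadic_thompsonBump {s x : ℝ} (hs : IsDyadic s) :
    IsDyadic (thompsonBump s x) ↔ IsDyadic x := by
  have h1 : IsDyadic (-(1 / 8)) := by
    have := (IsDyadic.int 1).half.half.half.neg
    norm_num at this ⊢
    exact this
  have h2 : IsDyadic (-(1 / 2) - s) := by
    simpa [sub_eq_add_neg] using (IsDyadic.int 1).half.neg.add hs.neg
  rcases le_total x s with h | h
  · rw [thompsonBump_of_le h]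
  rcases le_total x (s + 1 / 4) with h' | h'
  · rw [thompsonBump_of_mem_left h h', isDyadic_add_iff hs.half, inv_mul_eq_div, isDyadic_half_iff]
  rcases le_total x (s + 3 / 8) with h'' | h''
  · rw [thompsonBump_of_mem_mid h' h'', isDyadic_add_iff h1, one_mul]
  rcases le_total x (s + 1 / 2) with h''' | h'''
  · rw [thompsonBump_of_mem_right h'' h''', isDyadic_add_iff h2,
      ← isDyadic_half_iff (x := 2 * x), mul_div_cancel_left₀ _ two_ne_zero]
  · rw [thompsonBump_of_ge h''']

/-- A bump on `[0, 1]`. -/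
noncomputable def thompsonBumpI (s : ℝ) (h0 : 0 ≤ s) (h1 : s ≤ 1 / 2) : I ≃o I :=
  restrictUnitInterval (thompsonBump s) (thompsonBump_of_le h0)
    (thompsonBump_of_ge (by linarith))

theorem isAffineNear_of_mem_Ioo {f : I ≃o I} {x : I} {a b : ℝ} (hx : (x : ℝ) ∈ Set.Ioo a b) (k : ℤ)
    (c : ℝ) (h : ∀ y : I, (y : ℝ) ∈ Set.Ioo a b → (f y : ℝ) = 2 ^ k * (y : ℝ) + c) :
    IsAffineNear f x :=
  ⟨k, c, Filter.eventually_of_mem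
    ((isOpen_Ioo.preimage continuous_subtype_val).mem_nhds hx) h⟩

theorem thompsonBumpI_mem (s : ℝ) (h0 : 0 ≤ s) (h1 : s ≤ 1 / 2) (hs : IsDyadic s) :
    thompsonBumpI s h0 h1 ∈ thompsonF := by
  refine ⟨fun x => isDyadic_thompsonBump hs,
    (fun x : I => (x : ℝ)) ⁻¹' {s, s + 1 / 4, s + 3 / 8, s + 1 / 2},
    Set.Finite.preimage Subtype.val_injective.injOn (Set.toFinite _), ?_, ?_⟩
  · have e1 : IsDyadic (1 / 4) := by
      have := (IsDyadic.int 1).half.half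
      norm_num at this ⊢
      exact this
    have e2 : IsDyadic (3 / 8) := by
      have := (IsDyadic.int 3).half.half.half
      norm_num at this ⊢
      exact this
    have e3 : IsDyadic (1 / 2) := by simpa using (IsDyadic.int 1).half
    rintro p (hp | hp | hp | hp)
    all_goals
      replace hp : (p : ℝ) = _ := hp
      rw [hp]
    exacts [hs, hs.add e1, hs.add e2, hs.add e3]
  · intro x hx
    simp only [Set.mem_preimage, Set.mem_insert_iff, Set.mem_singleton_iff, not_or] at hx
    obtain ⟨n1, n2, n3, n4⟩ := hx
    rcases lt_or_gt_of_ne n1 with h | h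
    · exact isAffineNear_of_mem_Ioo (a := (x : ℝ) - 1) ⟨by linarith, h⟩ 0 0 fun y hy =>
        (thompsonBump_of_le hy.2.le).trans (by simp)
    rcases lt_or_gt_of_ne n2 with h' | h'
    · exact isAffineNear_of_mem_Ioo ⟨h, h'⟩ (-1) (s / 2) fun y hy =>
        (thompsonBump_of_mem_left hy.1.le hy.2.le).trans (by simp)
    rcases lt_or_gt_of_ne n3 with h'' | h''
    · exact isAffineNear_of_mem_Ioo ⟨h', h''⟩ 0 (-(1 / 8)) fun y hy =>
        (thompsonBump_of_mem_mid hy.1.le hy.2.le).trans (by simp)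
    rcases lt_or_gt_of_ne n4 with h''' | h'''
    · exact isAffineNear_of_mem_Ioo ⟨h'', h'''⟩ 1 (-(1 / 2) - s) fun y hy =>
        (thompsonBump_of_mem_right hy.1.le hy.2.le).trans (by simp)
    · exact isAffineNear_of_mem_Ioo (b := (x : ℝ) + 1) ⟨h''', by linarith⟩ 0 0 fun y hy =>
        (thompsonBump_of_ge hy.1.le).trans (by simp)

open scoped commutatorElement in
-- With `a = f * g`, the element `a * g⁻¹ = f` lives to the left of `d`. The map `g` lives to the
-- right of `c`, and `a` maps `d` to the left of `c`, so conjugation moves the support of `g` to the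
-- right of `d`. Both relators are thus commutators of maps with disjoint supports.
theorem isThompsonPair_of_chain {X : Type*} [LinearOrder X] {f g : X ≃o X} {c d : X}
    (hf : ∀ x, d ≤ x → f x = x) (hg : ∀ x, x ≤ c → g x = x) (hcd : c ≤ d)
    (hfg : f (g d) ≤ c) (hne : f (g d) ≠ g (f d)) : IsThompsonPair (f * g) g := by
  have hcomm : ∀ h : X ≃o X, (∀ x, x ≤ d → h x = x) → f * h = h * f := by
    intro h hh
    refine RelIso.ext fun x => ?_
    change f (h x) = h (f x)
    have hfd := hf d le_rfl
    have hhd := hh d le_rfl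
    rcases le_total x d with hx | hx
    · have h1 : f x ≤ d := hfd ▸ f.monotone hx
      rw [hh x hx, hh _ h1]
    · have h1 : d ≤ h x := hhd ▸ h.monotone hx
      rw [hf x hx, hf _ h1]
  have hconj : ∀ h : X ≃o X, (∀ x, x ≤ c → h x = x) →
      ∀ x, x ≤ d → ((f * g)⁻¹ * h * (f * g)) x = x := by
    intro h hh x hx
    change (f * g).symm (h (f (g x))) = x
    rw [hh _ ((f.monotone (g.monotone hx)).trans hfg)]
    exact (f * g).symm_apply_apply x
  have e : f * g * g⁻¹ = f := by group
  have h1 := hconj g hg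
  have h2 := hconj _ fun x hx => h1 x (hx.trans hcd)
  refine ⟨?_, ?_, fun h => hne ?_⟩
  · rw [thompsonRel₁, e]
    exact commutatorElement_eq_one_iff_mul_comm.2 (hcomm _ h1)
  · rw [thompsonRel₂, e]
    exact commutatorElement_eq_one_iff_mul_comm.2 (hcomm _ h2)
  · have h3 : f * g * g = g * (f * g) := commutatorElement_eq_one_iff_mul_comm.1 h
    rw [← mul_assoc, mul_left_inj] at h3
    exact DFunLike.congr_fun h3 d

theorem not_isElementaryAmenable_thompsonF : ¬ IsElementaryAmenable thompsonF := by
  intro h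
  refine h.not_hasThompsonSection ?_
  have hs0 : IsDyadic 0 := by simpa using IsDyadic.int 0
  have hs1 : IsDyadic (1 / 4) := by
    have := (IsDyadic.int 1).half.half
    norm_num at this ⊢
    exact this
  set f := thompsonBumpI 0 le_rfl (by norm_num) with hf
  set g := thompsonBumpI (1 / 4) (by norm_num) (by norm_num) with hg
  have hfF : f ∈ thompsonF := thompsonBumpI_mem _ _ _ hs0
  have hgF : g ∈ thompsonF := thompsonBumpI_mem _ _ _ hs1
  -- The bumps `f` on `(0, 1 / 2)` and `g` on `(1 / 4, 3 / 4)` overlap so that `1 / 2` goes to `3 /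
  -- 8` under `g` and then exactly to `1 / 4` under `f`.
  let c : I := ⟨1 / 4, by norm_num, by norm_num⟩
  let d : I := ⟨1 / 2, by norm_num, by norm_num⟩
  let m : I := ⟨3 / 8, by norm_num, by norm_num⟩
  have hgd : g d = m := Subtype.ext <| by
    change thompsonBump (1 / 4) (1 / 2) = 3 / 8
    rw [thompsonBump_of_mem_left] <;> norm_num
  have hfm : f m = c := Subtype.ext <| by
    change thompsonBump 0 (3 / 8) = 1 / 4
    rw [thompsonBump_of_mem_mid] <;> norm_num
  have hfix : ∀ x, d ≤ x → f x = x := fun x hx => Subtype.ext <|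
    thompsonBump_of_ge (by
      have : (1 / 2 : ℝ) ≤ x := hx
      linarith)
  have hpair : IsThompsonPair (f * g) g := by
    refine isThompsonPair_of_chain (c := c) (d := d) hfix
      (fun x hx => Subtype.ext <| thompsonBump_of_le hx) ?_ ?_ ?_
    · exact Subtype.coe_le_coe.1 (by norm_num [c, d])
    · rw [hgd, hfm]
    · rw [hgd, hfm, hfix d le_rfl, hgd]
      exact fun h => by
        have := congrArg Subtype.val h
        norm_num [c, m] at this
  have hpair' : IsThompsonPair (⟨f, hfF⟩ * ⟨g, hgF⟩ : thompsonF) ⟨g, hgF⟩ :=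
    ⟨Subtype.ext hpair.rel₁, Subtype.ext hpair.rel₂, fun h => hpair.ne (congrArg Subtype.val h)⟩
  exact hpair'.hasThompsonSection

/-! ### Standard pairs from levels -/

theorem isFast_pair {f g : MarkedFunction} (hf : IsFast {f}) (hg : IsFast {g})
    (hfg : ∀ J K, Disjoint (f.feet J) (g.feet K)) : IsFast {f, g} := by
  refine ⟨Set.toFinite _, ?_, ?_⟩
  · rintro _ (rfl | rfl)
    exacts [hf.2.1 _ rfl, hg.2.1 _ rfl]
  · rintro _ (rfl | rfl) _ (rfl | rfl) J K h
    exacts [hf.2.2 _ rfl _ rfl J K h, hfg J K, (hfg K J).symm, hg.2.2 _ rfl _ rfl J K h]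

/-- Lowering the level: `g'` is obtained from `g` by removing its outer intervals. -/
theorem HasLevel.to_shift {t : ℕ} {f g g' : ExpandingMap} (hl : ∀ i, g'.l i = g.l (i + 1))
    (hr : ∀ i, g'.r i = g.r (i + 1)) (h : HasLevel (t + 1) f g) : HasLevel t g' f where
  l_lt i hi := hl i ▸ h.l_lt' i (by omega)
  r_lt i hi := hr i ▸ h.r_lt' i (by omega)
  l_lt' i hi := hl i ▸ h.l_lt (i + 1) (by omega)
  r_lt' i hi := hr i ▸ h.r_lt (i + 1) (by omega)
  even i hi := hr i ▸ h.odd i (by omega)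
  odd i hi := hl i ▸ h.even (i + 1) (by omega)

namespace OrderIso

/-- The order automorphism that agrees with `e` between two fixed points of `e` and is the identity
elsewhere. -/
noncomputable def between {X : Type*} [LinearOrder X] (e : X ≃o X) {a b : X} (ha : e a = a)
    (hb : e b = b) : X ≃o X :=
  have key : ∀ (e : X ≃o X), e a = a → e b = b → ∀ x, e x ∈ Set.Icc a b ↔ x ∈ Set.Icc a b :=
    fun e ha hb x => by
      constructor
      · rintro ⟨h1, h2⟩
        exact ⟨e.le_iff_le.1 (ha.symm ▸ h1), e.le_iff_le.1 (hb.symm ▸ h2)⟩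
      · rintro ⟨h1, h2⟩
        exact ⟨ha ▸ e.monotone h1, hb ▸ e.monotone h2⟩
  have hsa : e.symm a = a := by rw [OrderIso.symm_apply_eq, ha]
  have hsb : e.symm b = b := by rw [OrderIso.symm_apply_eq, hb]
  StrictMono.orderIsoOfRightInverse (fun x => open Classical in if x ∈ Set.Icc a b then e x else x)
    (fun x y h => by
      dsimp only
      split_ifs with h1 h2 h2
      · exact e.strictMono h
      · have := (key e ha hb x).2 h1
        refine lt_of_le_of_lt this.2 ?_
        by_contra! h3
        exact h2 ⟨h1.1.trans h.le, h3⟩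
      · have := (key e ha hb y).2 h2
        refine lt_of_lt_of_le ?_ this.1
        by_contra! h3
        exact h1 ⟨h3, h.le.trans h2.2⟩
      · exact h)
    (fun y => open Classical in if y ∈ Set.Icc a b then e.symm y else y) (fun y => by
      dsimp only
      by_cases h : y ∈ Set.Icc a b
      · rw [if_pos h, if_pos ((key e.symm hsa hsb y).2 h), OrderIso.apply_symm_apply]
      · rw [if_neg h, if_neg h])

variable {X : Type*} [LinearOrder X] {e : X ≃o X} {a b : X} (ha : e a = a) (hb : e b = b)

theorem between_of_mem {x : X} (hx : x ∈ Set.Icc a b) : between e ha hb x = e x :=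
  if_pos hx

theorem between_of_notMem {x : X} (hx : x ∉ Set.Icc a b) : between e ha hb x = x :=
  if_neg hx

end OrderIso

/-- A homeomorphism whose bumps are given on consecutive intervals. -/
theorem IsRep.of_bumps {f : I ≃o I} {k N : ℕ} {p : ℕ → I} (hk : 0 < k) (hN : N ≤ k)
    (hp : ∀ i < k, p i < p (i + 1)) (hfix : ∀ i ≤ k, f (p i) = p i)
    (hout : ∀ x, x < p 0 ∨ p k < x → f x = x)
    (hneg : ∀ i < N, ∀ t ∈ Set.Ioo (p i) (p (i + 1)), f t < t)
    (hpos : ∀ i, N ≤ i → i < k → ∀ t ∈ Set.Ioo (p i) (p (i + 1)), t < f t) :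
    IsRep f k N p := by
  have hne : ∀ i < k, ∀ t ∈ Set.Ioo (p i) (p (i + 1)), f t ≠ t := fun i hi t ht => by
    rcases Nat.lt_or_ge i N with h | h
    · exact (hneg i h t ht).ne
    · exact (hpos i h hi t ht).ne'
  have hmem : ∀ i < k, (p i, p (i + 1)) ∈ orbitals f := fun i hi =>
    ⟨hp i hi, hfix i hi.le, hfix (i + 1) hi, hne i hi⟩
  have hcover : ∀ x, f x ≠ x → ∃ i < k, x ∈ Set.Ioo (p i) (p (i + 1)) := by
    intro x hx
    by_contra! hcon
    have h0 : p 0 ≤ x := by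
      by_contra! h
      exact hx (hout x (Or.inl h))
    have h : ∀ i ≤ k, p i ≤ x := by
      intro i
      induction i with
      | zero => exact fun _ => h0
      | succ i ih =>
        intro hi
        have h1 : p i < x := (ih (by omega)).lt_of_ne fun h => hx (h ▸ hfix i (by omega))
        by_contra! h2
        exact hcon i (by omega) ⟨h1, h2⟩
    refine hx (hout x (Or.inr ((h k le_rfl).lt_of_ne fun h => hx (h ▸ hfix k le_rfl))))
  refine ⟨hk, hN, hp, fun J => ⟨fun hJ => ?_, ?_⟩, hneg, hpos⟩
  · obtain ⟨x, hx⟩ := exists_between hJ.1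
    obtain ⟨i, hi, hxi⟩ := hcover x (hJ.2.2.2 x hx)
    refine ⟨i, hi, orbitals_ext hJ (hmem i hi) ?_⟩
    rcases lt_trichotomy J.1 (p i) with h | h | h
    · exact absurd (orbitals_snd_le_fst hJ (hmem i hi) h) (hxi.1.trans hx.2).not_ge
    · exact h
    · exact absurd (orbitals_snd_le_fst (hmem i hi) hJ h) (hx.1.trans hxi.2).not_ge
  · rintro ⟨i, hi, rfl⟩
    exact hmem i hi

/-- The reduction of a standard function with more than two orbitals. -/
theorem exists_isReduction_of_two_lt {g : MarkedFunction} {k N : ℕ} {q : ℕ → I}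
    (hg : IsRep g.fn k N q) (hN : k = 2 * N ∨ k = 2 * N + 1) (hk : 2 < k) :
    ∃ g' : MarkedFunction, IsReduction g g' ∧
      IsRep g'.fn (k - 2) (N - 1) (fun i => q (i + 1)) ∧
      ∀ J : orbitals g'.fn, ∃ h : J.1 ∈ orbitals g.fn, g'.feet J = g.feet ⟨J.1, h⟩ := by
  have ha := hg.apply_p (i := 1) (by omega)
  have hb := hg.apply_p (i := k - 1) (by omega)
  -- Cutting `g` off at its second and its last but one transition point removes the two outermost
  -- orbitals.
  set e := OrderIso.between g.fn ha hb with he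
  have hin : ∀ i < k - 2, ∀ t ∈ Set.Icc (q (i + 1)) (q (i + 2)), e t = g.fn t := by
    intro i hi t ht
    exact OrderIso.between_of_mem ha hb
      ⟨(hg.le_of_le (by omega) (by omega)).trans ht.1, ht.2.trans (hg.le_of_le (by omega) (by omega))⟩
  have hrep : IsRep e (k - 2) (N - 1) (fun i => q (i + 1)) := by
    refine IsRep.of_bumps (by omega) (by omega) (fun i hi => hg.strict _ (by omega)) ?_ ?_ ?_ ?_
    · intro i hi
      rw [OrderIso.between_of_mem ha hb ⟨hg.le_of_le (by omega) (by omega),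
        hg.le_of_le (by omega) (by omega)⟩, hg.apply_p (by omega)]
    · intro x hx
      refine OrderIso.between_of_notMem ha hb fun h => ?_
      rw [show k - 2 + 1 = k - 1 by omega] at hx
      exact hx.elim (fun h1 => h1.not_ge h.1) (fun h1 => h1.not_ge h.2)
    · intro i hi t ht
      rw [hin i (by omega) t ⟨ht.1.le, ht.2.le⟩]
      exact hg.neg (i + 1) (by omega) t ht
    · intro i hi hk t ht
      rw [hin i hk t ⟨ht.1.le, ht.2.le⟩]
      exact hg.pos (i + 1) (by omega) (by omega) t ht
  have hsub : ∀ J ∈ orbitals e, J ∈ orbitals g.fn := by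
    intro J hJ
    obtain ⟨i, hi, rfl⟩ := (hrep.orb J).1 hJ
    exact hg.mem (by omega)
  have hfn : ∀ J ∈ orbitals e, ∀ t ∈ Set.Icc J.1 J.2, e t = g.fn t := by
    intro J hJ
    obtain ⟨i, hi, rfl⟩ := (hrep.orb J).1 hJ
    exact hin i hi
  let g' : MarkedFunction := ⟨e, fun J => g.mark ⟨J.1, hsub J.1 J.2⟩,
    fun J => g.mark_mem ⟨J.1, hsub J.1 J.2⟩⟩
  refine ⟨g', Or.inl ⟨by rwa [hg.ncard_orbitals], ?_, ?_⟩, hrep, ?_⟩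
  · ext J
    constructor
    · intro hJ
      refine ⟨hsub J hJ, ?_⟩
      obtain ⟨i, hi, rfl⟩ := (hrep.orb J).1 hJ
      exact ⟨⟨_, hg.mem (i := 0) (by omega), hg.lt_of_lt (by omega) (by omega)⟩,
        _, hg.mem (i := k - 1) (by omega), hg.lt_of_lt (by omega) (by omega)⟩
    · rintro ⟨hJ, ⟨K, hK, hKJ⟩, L, hL, hJL⟩
      obtain ⟨i, hi, rfl⟩ := (hg.orb _).1 hJ
      obtain ⟨j, hj, rfl⟩ := (hg.orb _).1 hK
      obtain ⟨m, hm, rfl⟩ := (hg.orb _).1 hL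
      have h1 : j < i := by
        by_contra! h1
        exact absurd hKJ (hg.le_of_le h1 hj.le).not_gt
      have h2 : i < m := by
        by_contra! h1
        exact absurd hJL (hg.le_of_le h1 hi.le).not_gt
      exact (hrep.orb _).2 ⟨i - 1, by omega, by rw [Nat.sub_add_cancel (by omega)]⟩
  · exact fun J h h' => ⟨rfl, fun t ht => hfn J h' t ⟨ht.1.le, ht.2.le⟩⟩
  · intro J
    refine ⟨hsub J.1 J.2, ?_⟩
    have hm := g.mark_mem ⟨J.1, hsub J.1 J.2⟩
    have h1 : J.1 ∈ posOrbitals e ↔ J.1 ∈ posOrbitals g.fn := by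
      refine ⟨fun h => ⟨hsub J.1 J.2, fun t ht => ?_⟩, fun h => ⟨J.2, fun t ht => ?_⟩⟩
      · rw [← hfn J.1 J.2 t ⟨ht.1.le, ht.2.le⟩]
        exact h.2 t ht
      · rw [hfn J.1 J.2 t ⟨ht.1.le, ht.2.le⟩]
        exact h.2 t ht
    have h2 : g'.rightStart J = g.rightStart ⟨J.1, hsub J.1 J.2⟩ := by
      rcases pos_or_neg (f := e) J.2 with h | h
      · rw [MarkedFunction.rightStart_of_pos (f := g') h,
          MarkedFunction.rightStart_of_pos (h1.1 h)]
        exact hfn J.1 J.2 _ ⟨hm.1.le, hm.2.le⟩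
      · have h' : J.1 ∈ negOrbitals g.fn :=
          (pos_or_neg (hsub J.1 J.2)).resolve_left fun h' => not_pos_and_neg (h1.2 h') h
        rw [MarkedFunction.rightStart_of_neg (f := g') h]
        change e.symm (g.mark ⟨J.1, hsub J.1 J.2⟩) = _
        rw [OrderIso.symm_apply_eq, hfn J.1 J.2 _
          ⟨(hm.1.trans (g.mark_lt_rightStart _)).le, (g.rightStart_lt _).le⟩,
          MarkedFunction.rightStart_of_neg h', OrderIso.apply_symm_apply]
    change Set.Ioo _ _ ∪ Set.Ico (g'.rightStart J) _ = Set.Ioo _ _ ∪ Set.Ico (g.rightStart _) _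
    rw [h2]

/-- The positive bump on `(u, v)` that maps `s` to `t`. -/
noncomputable def posBump {u s t v : ℝ} (h1 : u < s) (h2 : s < t) (h3 : t < v) : ℝ ≃o ℝ :=
  OrderIso.maxIso (OrderIso.refl ℝ) (OrderIso.minIso
    (OrderIso.affine ((t - u) / (s - u)) (u - (t - u) / (s - u) * u)
      (div_pos (by linarith) (by linarith)))
    (OrderIso.affine ((v - t) / (v - s)) (v - (v - t) / (v - s) * v)
      (div_pos (by linarith) (by linarith))))

/-! ### A piecewise linear bump with one prescribed value -/

section PosBump

variable {u s t v : ℝ} (h1 : u < s) (h2 : s < t) (h3 : t < v)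

theorem posBump_apply (x : ℝ) : posBump h1 h2 h3 x =
    max x (min (u + (t - u) / (s - u) * (x - u)) (v - (v - t) / (v - s) * (v - x))) := by
  change max x (min ((t - u) / (s - u) * x + (u - (t - u) / (s - u) * u))
    ((v - t) / (v - s) * x + (v - (v - t) / (v - s) * v))) = _
  congr 2 <;> ring

theorem posBump_of_le {x : ℝ} (hx : x ≤ u) : posBump h1 h2 h3 x = x := by
  rw [posBump_apply, max_eq_left]
  refine (min_le_left _ _).trans ?_
  have h : 1 ≤ (t - u) / (s - u) := (one_le_div (by linarith)).2 (by linarith)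
  nlinarith

theorem posBump_of_ge {x : ℝ} (hx : v ≤ x) : posBump h1 h2 h3 x = x := by
  rw [posBump_apply, max_eq_left]
  refine (min_le_right _ _).trans ?_
  have h : (v - t) / (v - s) ≤ 1 := (div_le_one (by linarith)).2 (by linarith)
  nlinarith

theorem lt_posBump {x : ℝ} (hx : x ∈ Set.Ioo u v) : x < posBump h1 h2 h3 x := by
  rw [posBump_apply]
  refine lt_max_of_lt_right (lt_min ?_ ?_)
  · have h : 1 < (t - u) / (s - u) := (one_lt_div (by linarith)).2 (by linarith)
    nlinarith [hx.1]
  · have h : (v - t) / (v - s) < 1 := (div_lt_one (by linarith)).2 (by linarith)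
    nlinarith [hx.2]

theorem posBump_mark : posBump h1 h2 h3 s = t := by
  have e1 : (t - u) / (s - u) * (s - u) = t - u := div_mul_cancel₀ _ (by linarith)
  have e2 : (v - t) / (v - s) * (v - s) = v - t := div_mul_cancel₀ _ (by linarith)
  rw [posBump_apply, e1, e2, add_sub_cancel, sub_sub_cancel, min_self, max_eq_right h2.le]

end PosBump

theorem exists_single_bump {a b : I} (hab : a < b) :
    ∃ f : MarkedFunction, IsRep f.fn 1 0 (fun i => if i = 0 then a else b) := by
  have hab' : (a : ℝ) < b := hab
  obtain ⟨s, hs1, hs2⟩ := exists_between hab'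
  obtain ⟨t, ht1, ht2⟩ := exists_between hs2
  let e : I ≃o I := OrderIso.restrictUnitInterval (posBump hs1 ht1 ht2)
    (posBump_of_le _ _ _ a.2.1) (posBump_of_ge _ _ _ b.2.2)
  have hrep : IsRep e 1 0 (fun i => if i = 0 then a else b) := by
    refine IsRep.of_bumps one_pos (Nat.zero_le _) ?_ ?_ ?_ (fun i hi => absurd hi (by omega)) ?_
    · intro i hi
      obtain rfl : i = 0 := by omega
      exact hab
    · intro i hi
      rcases Nat.eq_zero_or_pos i with rfl | h
      · exact Subtype.ext (posBump_of_le _ _ _ le_rfl)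
      · obtain rfl : i = 1 := by omega
        exact Subtype.ext (posBump_of_ge _ _ _ le_rfl)
    · rintro x (hx | hx)
      · exact Subtype.ext (posBump_of_le _ _ _ (Subtype.coe_le_coe.2 hx.le))
      · exact Subtype.ext (posBump_of_ge _ _ _ (Subtype.coe_le_coe.2 hx.le))
    · intro i _ hi x hx
      obtain rfl : i = 0 := by omega
      exact lt_posBump hs1 ht1 ht2 (x := x) hx
  choose m hm using fun J : orbitals e => exists_between J.2.1
  exact ⟨⟨e, m, hm⟩, hrep⟩

theorem MarkedFunction.feet_subset (f : MarkedFunction) (J : orbitals f.fn) :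
    f.feet J ⊆ Set.Ioo J.1.1 J.1.2 := by
  rintro x (hx | hx)
  · exact ⟨hx.1, hx.2.trans (f.mark_mem J).2⟩
  · exact ⟨((f.mark_mem J).1.trans (f.mark_lt_rightStart J)).trans_le hx.1, hx.2⟩

theorem HasLevel.precedes {t : ℕ} {f g : MarkedFunction} {k N k' N' : ℕ} {p q : ℕ → I}
    (hf : IsRep f.fn k N p) (hg : IsRep g.fn k' N' q)
    (h : HasLevel t (f.toExpanding k N p) (g.toExpanding k' N' q)) :
    (t = 0 → LeftOf f g) ∧ (t ≠ 0 → NestedIn f g) := by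
  have h1 := hf.N_le
  have h2 := hg.N_le
  refine ⟨fun ht => ?_, fun ht => ?_⟩
  · rw [leftOf_iff hf hg]
    simpa [MarkedFunction.toExpanding, h1] using h.even 0 (by omega)
  · rw [nestedIn_iff hf hg]
    have h3 := h.l_lt 0 (by omega)
    have h4 := h.r_lt 0 (by omega)
    simp only [MarkedFunction.toExpanding] at h3 h4
    simp only [Nat.zero_min, Nat.sub_zero, max_eq_left h1, max_eq_left h2] at h3 h4
    exact ⟨h3, h4⟩

/-- The converse of `IsStandardPair.exists_hasLevel`, by induction on the level: the pair formed by
a reduction of `g` and `f` has level one less. -/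
theorem HasLevel.isStandardPair {t : ℕ} {f g : MarkedFunction} {k N k' N' : ℕ} {p q : ℕ → I}
    (hf : IsRep f.fn k N p) (hg : IsRep g.fn k' N' q)
    (hN : k = 2 * N ∨ k = 2 * N + 1) (hN' : k' = 2 * N' ∨ k' = 2 * N' + 1)
    (hff : IsFast {f}) (hgf : IsFast {g}) (hfg : ∀ J K, Disjoint (f.feet J) (g.feet K))
    (h : HasLevel t (f.toExpanding k N p) (g.toExpanding k' N' q)) : IsStandardPair f g := by
  induction t generalizing f g k N k' N' p q with
  | zero =>
    exact .left f g (hf.isStandardFunction hN) (hg.isStandardFunction hN')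
      (isFast_pair hff hgf hfg) ((h.precedes hf hg).1 rfl)
  | succ t ih =>
    have hdisj : Disjoint f.openFeet g.openFeet := by
      refine Set.disjoint_of_subset f.openFeet_subset g.openFeet_subset ?_
      rw [Set.disjoint_iUnion_left]
      intro J
      rw [Set.disjoint_iUnion_right]
      exact hfg J
    have hfe := MarkedFunction.isExpanding hf hN
    suffices ∃ g', IsReduction g g' ∧ IsStandardPair g' f by
      obtain ⟨g', h1, h2⟩ := this
      exact .nested f g g' (hf.isStandardFunction hN) (hg.isStandardFunction hN')
        (isFast_pair hff hgf hfg) ((h.precedes hf hg).2 t.succ_ne_zero) h1 h2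
    have hk' := hg.k_pos
    rcases Nat.lt_or_ge 2 k' with h2 | h2
    · obtain ⟨g', hred, hrep, hfeet⟩ := exists_isReduction_of_two_lt hg hN' h2
      refine ⟨g', hred, ih hrep hf (by omega) hN ?_ hff ?_ (HasLevel.to_shift ?_ ?_ h)⟩
      · refine ⟨Set.finite_singleton _, ?_, ?_⟩
        · rintro _ rfl
          exact hrep.finite_orbitals
        · rintro _ rfl _ rfl J K hJK
          obtain ⟨hJ, hJ'⟩ := hfeet J
          obtain ⟨hK, hK'⟩ := hfeet K
          rw [hJ', hK']
          exact hgf.2.2 g rfl g rfl _ _ (Or.inr (hJK.resolve_left fun h => h rfl))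
      · intro J K
        obtain ⟨hJ, hJ'⟩ := hfeet J
        rw [hJ']
        exact (hfg K _).symm
      · exact fun i => congrArg q (by omega)
      · exact fun i => congrArg q (by omega)
    · let J : orbitals g.fn := ⟨_, hg.mem (i := N') (by omega)⟩
      have hlt : q N' < g.mark J := (g.mark_mem J).1
      obtain ⟨g', hrep⟩ := exists_single_bump hlt
      have hfoot : Set.Ioo (q N') (g.mark J) ⊆ g.openFeet := g.leftFoot_subset J
      have horb : orbitals g'.fn = {(q N', g.mark J)} := by
        rw [hrep.orbitals_eq]
        ext K
        simp [eq_comm]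
      have hpos : posOrbitals g'.fn = {(q N', g.mark J)} := by
        rw [hrep.posOrbitals_eq]
        ext K
        simp [eq_comm]
      have hfeet : ∀ K, g'.feet K ⊆ g.feet J := by
        intro K
        have hK : K.1 = (q N', g.mark J) := horb.subset K.2
        refine (g'.feet_subset K).trans ?_
        rw [hK]
        exact Set.subset_union_left
      have hgl : ∀ i, (g.toExpanding k' N' q).l (i + 1) = q N' :=
        fun i => congrArg q (by omega)
      have hgr : ∀ i, (g.toExpanding k' N' q).r (i + 1) = q N' :=
        fun i => congrArg q (by omega)
      have hl' : ∀ i, (g'.toExpanding 1 0 (fun i => if i = 0 then q N' else g.mark J)).l i = q N' :=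
        fun i => by simp [MarkedFunction.toExpanding]
      have hr0' : (g'.toExpanding 1 0 (fun i => if i = 0 then q N' else g.mark J)).r 0 =
          g.mark J := by
        simp [MarkedFunction.toExpanding]
      refine ⟨g', Or.inr ⟨by rwa [hg.ncard_orbitals], J, hg.pos_mem le_rfl (by omega), horb, hpos⟩,
        ih hrep hf (by omega) hN ?_ hff (fun K L => ?_) ?_⟩
      · refine ⟨Set.finite_singleton _, ?_, ?_⟩
        · rintro _ rfl
          exact hrep.finite_orbitals
        · rintro _ rfl _ rfl K L hKL
          exact absurd ((horb.subset K.2).trans (horb.subset L.2).symm)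
            (hKL.resolve_left fun h => h rfl)
      · exact Set.disjoint_of_subset_left (hfeet K) (hfg L J).symm
      -- Level `3` or more of `f` with `g` would need room between `g.l 1` and `g.r 1`, which are
      -- both the centre.
      · have ht : t < 2 := by
          by_contra! ht
          have h3 := h.l_lt 1 (by omega)
          have h4 := h.r_lt 1 (by omega)
          rw [hgl 0] at h3
          rw [hgr 0] at h4
          exact lt_irrefl _ ((h3.trans_le (hfe.le 1 1)).trans h4)
        refine ⟨?_, ?_, fun i hi => by omega, fun i hi => by omega, ?_, ?_⟩
        · intro i hi
          obtain rfl : i = 0 := by omega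
          rw [hl', ← hgl 0]
          exact h.l_lt' 0 (by omega)
        -- By fastness `f.r 0` is not in the foot `(q N', g.mark J)`, so being right of the centre
        -- it is right of the mark; the next goal uses the same argument for `f.l 0`.
        · intro i hi
          obtain rfl : i = 0 := by omega
          rw [hr0']
          by_contra! h3
          refine hfe.r_notMem_foot hdisj hfoot hfe.lt ?_ h3
          rw [← hgr 0]
          exact h.r_lt' 0 (by omega)
        · intro i hi
          obtain rfl : i = 0 := by omega
          rw [hr0']
          by_contra! h3
          refine hfe.l_notMem_foot hdisj hfoot ?_ h3
          rw [← hgr 0]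
          exact h.odd 0 (by omega)
        · intro i hi
          obtain rfl : i = 0 := by omega
          rw [hl', ← hgl 0]
          exact h.even 1 (by omega)

/-! ### Oscillation from levels -/

/-- The orbitals of `g` met by transition points of `f` are the `⌊t / 2⌋` leftmost and the `⌈t / 2⌉`
rightmost: the nesting places a point of `f` in each, and where the nesting stops the remaining
orbitals of `g` lie between neighbouring points of `f` or outside its support. -/
theorem HasLevel.osc_eq {t : ℕ} {f g : MarkedFunction} {k N k' N' : ℕ} {p q : ℕ → I}
    (hf : IsRep f.fn k N p) (hg : IsRep g.fn k' N' q)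
    (hpq : ∀ i ≤ k, ∀ j ≤ k', p i ≠ q j)
    (h : HasLevel t (f.toExpanding k N p) (g.toExpanding k' N' q)) : osc f g = t := by
  have hNk := hf.N_le
  have hNk' := hg.N_le
  have hl : ∀ i, 2 * i + 1 ≤ t → q (min i N') < p (min i N) := h.l_lt
  have hr : ∀ i, 2 * i + 1 ≤ t → p (max (k - i) N) < q (max (k' - i) N') := h.r_lt
  have hl' : ∀ i, 2 * i + 2 ≤ t → p (min i N) < q (min (i + 1) N') := h.l_lt'
  -- One index more than `HasLevel.r_lt'` gives: at the last stage of an odd level the weak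
  -- inequality is strict, because no transition points coincide.
  have hr' : ∀ i, 2 * i + 1 ≤ t → q (max (k' - (i + 1)) N') < p (max (k - i) N) := by
    intro i hi
    rcases hi.eq_or_lt with h1 | h1
    · refine lt_of_le_of_ne ?_ (hpq _ (by omega) _ (by omega)).symm
      have h2 : q (max (k' - (i + 1)) N') ≤ p (min i N) := h.odd i h1.symm
      exact h2.trans (hf.le_of_le (by omega) (by omega))
    · exact h.r_lt' i h1
  have he : ∀ i, t = 2 * i → p (max (k - i) N) ≤ q (min i N') := h.even
  have ho : ∀ i, t = 2 * i + 1 → q (max (k' - (i + 1)) N') ≤ p (min i N) := h.odd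
  obtain ⟨m, m', hm, hm1, hm2⟩ : ∃ m m', t = m + m' ∧ 2 * m ≤ t ∧ t ≤ 2 * m + 1 :=
    ⟨t / 2, t - t / 2, by omega, by omega, by omega⟩
  have hmN : m ≤ N' := by
    by_contra! h1
    have h2 := (hl N' (by omega)).trans (hl' N' (by omega))
    rw [min_self, min_eq_right (by omega)] at h2
    exact lt_irrefl _ h2
  have hmN' : m' ≤ k' - N' := by
    by_contra! h1
    have h2 := (hr' (k' - N') (by omega)).trans (hr (k' - N') (by omega))
    rw [max_eq_right (by omega), max_eq_right (by omega)] at h2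
    exact lt_irrefl _ h2
  have hset : {K ∈ orbitals g.fn | ∃ x ∈ transitionPoints f.fn, x ∈ Set.Ioo K.1 K.2} =
      (fun j => (q j, q (j + 1))) '' (Finset.range m ∪ Finset.Ico (k' - m') k' : Finset ℕ) := by
    ext K
    simp only [Finset.coe_union, Finset.coe_range, Finset.coe_Ico]
    constructor
    · rintro ⟨hK, x, hx, hxK⟩
      obtain ⟨j, hj, rfl⟩ := (hg.orb K).1 hK
      obtain ⟨u, hu, rfl⟩ : ∃ u ≤ k, x = p u := by
        obtain ⟨J, hJ, hxJ⟩ := hx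
        obtain ⟨i, hi, rfl⟩ := (hf.orb J).1 hJ
        rcases hxJ with rfl | rfl
        · exact ⟨i, hi.le, rfl⟩
        · exact ⟨i + 1, hi, rfl⟩
      refine ⟨j, ?_, rfl⟩
      by_contra hcon
      simp only [Set.mem_union, Set.mem_Iio, Set.mem_Ico, not_or, not_lt, not_and] at hcon
      obtain ⟨hj1, hj2⟩ := hcon
      have hj3 : j + 1 ≤ k' - m' := by
        by_contra! h3
        exact absurd (hj2 (by omega)) hj.not_ge
      -- For odd `t` a point `p u` in a remaining orbital would have `u < m`, so it would lie left
      -- of `q (u + 1)` and of that orbital; for even `t` the mirror argument applies.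
      rcases Nat.lt_or_ge (2 * m) t with h3 | h3
      · have h4 := ho m (by omega)
        rw [max_eq_left (by omega)] at h4
        have h5 : p u < p (min m N) :=
          hxK.2.trans_le ((hg.le_of_le (by omega) (by omega)).trans h4)
        have h6 : u < min m N := by
          by_contra! h6
          exact absurd (hf.le_of_le h6 hu) h5.not_ge
        have h7 := hl' u (by omega)
        rw [min_eq_left (by omega), min_eq_left (by omega)] at h7
        exact absurd (h7.trans_le (hg.le_of_le (by omega) hj.le)) hxK.1.not_gt
      · have h4 := he m (by omega)
        rw [min_eq_left (by omega)] at h4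
        have h5 : p (max (k - m) N) < p u :=
          (h4.trans (hg.le_of_le (by omega) hj.le)).trans_lt hxK.1
        have h6 : max (k - m) N < u := by
          by_contra! h6
          exact absurd (hf.le_of_le h6 (by omega)) h5.not_ge
        have h7 := hr' (k - u) (by omega)
        rw [max_eq_left (by omega), max_eq_left (by omega), Nat.sub_sub_self hu] at h7
        exact absurd ((hg.le_of_le (i := j + 1) (by omega) (by omega)).trans_lt h7) hxK.2.not_gt
    · have htp : ∀ u ≤ k, p u ∈ transitionPoints f.fn := by
        intro u hu
        rcases hu.lt_or_eq with h1 | rfl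
        · exact ⟨_, hf.mem h1, Or.inl rfl⟩
        · have := hf.k_pos
          exact ⟨_, hf.mem (i := u - 1) (by omega), Or.inr (by
            change p u = p _
            rw [Nat.sub_add_cancel this])⟩
      rintro ⟨j, hj | hj, rfl⟩
      · have hj : j < m := hj
        refine ⟨hg.mem (by omega), p (min j N), htp _ (by omega), ?_, ?_⟩
        · have := hl j (by omega)
          rwa [min_eq_left (by omega : j ≤ N')] at this
        · have := hl' j (by omega)
          rwa [min_eq_left (by omega : j + 1 ≤ N')] at this
      · have hj1 : k' - m' ≤ j := hj.1
        have hj2 : j < k' := hj.2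
        refine ⟨hg.mem (by omega), p (max (k - (k' - 1 - j)) N), htp _ (by omega), ?_, ?_⟩
        · have := hr' (k' - 1 - j) (by omega)
          rwa [show max (k' - (k' - 1 - j + 1)) N' = j by omega] at this
        · have := hr (k' - 1 - j) (by omega)
          rwa [show max (k' - (k' - 1 - j)) N' = j + 1 by omega] at this
  rw [osc, hset, (hg.injOn.mono ?_).ncard_image, Set.ncard_coe_finset,
    Finset.card_union_of_disjoint, Finset.card_range, Nat.card_Ico]
  · omega
  · rw [Finset.disjoint_left]
    intro j h1 h2
    rw [Finset.mem_range] at h1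
    rw [Finset.mem_Ico] at h2
    omega
  · intro j hj
    simp only [Finset.coe_union, Finset.coe_range, Finset.coe_Ico] at hj
    rcases hj with hj | hj
    · have hj : j < m := hj
      exact show j < k' by omega
    · exact hj.2

/-! ### Diagrams of standard functions -/

/-- A standard function with `k` orbitals `(p i, p (i + 1))` of which the first `N` are negative, up to
the choice of a homeomorphism. -/
structure Diagram where
  k : ℕ
  N : ℕ
  p : ℕ → ℤ

namespace Diagram

/-- The laws of a diagram. -/
structure IsStandard (d : Diagram) : Prop where
  k_pos : 0 < d.k
  balanced : d.k = 2 * d.N ∨ d.k = 2 * d.N + 1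
  strict : StrictMono d.p

/-- The transition points, counted from the left. -/
def l (d : Diagram) (i : ℕ) : ℤ := d.p (min i d.N)

/-- The transition points, counted from the right. -/
def r (d : Diagram) (i : ℕ) : ℤ := d.p (max (d.k - i) d.N)

/-- `HasLevel` for diagrams. -/
structure Level (t : ℕ) (d e : Diagram) : Prop where
  l_lt : ∀ i, 2 * i + 1 ≤ t → e.l i < d.l i
  r_lt : ∀ i, 2 * i + 1 ≤ t → d.r i < e.r i
  l_lt' : ∀ i, 2 * i + 2 ≤ t → d.l i < e.l (i + 1)
  r_lt' : ∀ i, 2 * i + 2 ≤ t → e.r (i + 1) < d.r i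
  even : ∀ i, t = 2 * i → d.r i ≤ e.l i
  odd : ∀ i, t = 2 * i + 1 → e.r (i + 1) ≤ d.l i

end Diagram

/-! ### Gluing bumps and rescaling to the unit interval -/

theorem OrderIso.exists_concat {X : Type*} [LinearOrder X] (b : ℕ → X ≃o X) {p : ℕ → X}
    (hp : Monotone p) (h1 : ∀ i x, x ≤ p i → b i x = x) (h2 : ∀ i x, p (i + 1) ≤ x → b i x = x)
    (k : ℕ) : ∃ F : X ≃o X, (∀ x ≤ p 0, F x = x) ∧ (∀ x, p k ≤ x → F x = x) ∧
      ∀ i < k, ∀ x ∈ Set.Icc (p i) (p (i + 1)), F x = b i x := by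
  induction k with
  | zero => exact ⟨OrderIso.refl X, fun _ _ => rfl, fun _ _ => rfl, fun i hi => by omega⟩
  | succ k ih =>
    obtain ⟨F, hF1, hF2, hF3⟩ := ih
    refine ⟨(b k).trans F, fun x hx => ?_, fun x hx => ?_, fun i hi x hx => ?_⟩
    · change F (b k x) = x
      rw [h1 k x (hx.trans (hp k.zero_le)), hF1 x hx]
    · change F (b k x) = x
      rw [h2 k x hx, hF2 x ((hp k.le_succ).trans hx)]
    · change F (b k x) = b i x
      rcases Nat.lt_succ_iff_lt_or_eq.1 hi with h | rfl
      · rw [h1 k x (hx.2.trans (hp h)), hF3 i h x hx]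
      · refine hF2 _ ?_
        rw [← h1 i (p i) le_rfl]
        exact (b i).monotone hx.1

/-- The affine coordinate on the unit interval with values in `[-B, B]`. -/
def coord (B : ℝ) (x : I) : ℝ := 2 * B * x - B

theorem coord_lt_coord {B : ℝ} (hB : 0 < B) {x y : I} : coord B x < coord B y ↔ x < y := by
  rw [coord, coord, sub_lt_sub_iff_right, mul_lt_mul_iff_right₀ (by positivity)]
  exact Iff.rfl

theorem coord_le_coord {B : ℝ} (hB : 0 < B) {x y : I} : coord B x ≤ coord B y ↔ x ≤ y := by
  rw [← not_lt, ← not_lt, coord_lt_coord hB]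

theorem coord_injective {B : ℝ} (hB : 0 < B) : Function.Injective (coord B) := fun _ _ h =>
  le_antisymm ((coord_le_coord hB).1 h.le) ((coord_le_coord hB).1 h.ge)

theorem exists_coord_eq {B y : ℝ} (hB : 0 < B) (h1 : -B ≤ y) (h2 : y ≤ B) :
    ∃ x, coord B x = y := by
  refine ⟨⟨(y + B) / (2 * B), div_nonneg (by linarith) (by linarith),
    (div_le_one (by linarith)).2 (by linarith)⟩, ?_⟩
  rw [coord, mul_div_cancel₀ _ (by positivity)]
  ring

theorem exists_coord_conj {B : ℝ} (hB : 0 < B) (F : ℝ ≃o ℝ) (h1 : F (-B) = -B) (h2 : F B = B) :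
    ∃ f : I ≃o I, ∀ x, coord B (f x) = F (coord B x) := by
  set c := OrderIso.affine (2 * B) (-B) (by linarith) with hc
  have hc0 : c 0 = -B := by simp [hc]
  have hc1 : c 1 = B := by
    rw [hc, OrderIso.affine_apply]
    ring
  refine ⟨OrderIso.restrictUnitInterval (c.trans (F.trans c.symm)) ?_ ?_, fun x => ?_⟩
  · change c.symm (F (c 0)) = 0
    rw [hc0, h1, ← hc0, OrderIso.symm_apply_apply]
  · change c.symm (F (c 1)) = 1
    rw [hc1, h2, ← hc1, OrderIso.symm_apply_apply]
  · have hcx : ∀ y : I, coord B y = c y := fun y => by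
      rw [hc, OrderIso.affine_apply, coord]
      ring
    rw [hcx, hcx]
    exact c.apply_symm_apply _

namespace Diagram

variable {d e : Diagram}

/-- Transition points are integers, so each orbital has length at least `1` and admits a bump
carrying the point `1 / 4` from one end to the point `1 / 4` from the other; with these markers all
feet have length `1 / 4`. -/
theorem IsStandard.exists_homeo (hd : d.IsStandard) : ∃ F : ℝ ≃o ℝ,
    (∀ x, x ≤ (d.p 0 : ℝ) → F x = x) ∧ (∀ x, (d.p d.k : ℝ) ≤ x → F x = x) ∧
    (∀ i ≤ d.k, F (d.p i) = d.p i) ∧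
    (∀ i < d.N, (∀ x ∈ Set.Ioo (d.p i : ℝ) (d.p (i + 1)), F x < x) ∧
      F (d.p (i + 1) - 1 / 4) = d.p i + 1 / 4) ∧
    ∀ i, d.N ≤ i → i < d.k → (∀ x ∈ Set.Ioo (d.p i : ℝ) (d.p (i + 1)), x < F x) ∧
      F (d.p i + 1 / 4) = d.p (i + 1) - 1 / 4 := by
  have hgap : ∀ i, (d.p i : ℝ) + 1 ≤ d.p (i + 1) := fun i => by
    exact_mod_cast hd.strict (Nat.lt_succ_self i)
  have h1 : ∀ i, (d.p i : ℝ) < d.p i + 1 / 4 := fun i => by linarith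
  have h2 : ∀ i, (d.p i : ℝ) + 1 / 4 < d.p (i + 1) - 1 / 4 := fun i => by linarith [hgap i]
  have h3 : ∀ i, (d.p (i + 1) : ℝ) - 1 / 4 < d.p (i + 1) := fun i => by linarith
  let c : ℕ → ℝ ≃o ℝ := fun i => posBump (h1 i) (h2 i) (h3 i)
  have hc1 : ∀ i x, x ≤ (d.p i : ℝ) → c i x = x := fun i x hx => posBump_of_le _ _ _ hx
  have hc2 : ∀ i x, (d.p (i + 1) : ℝ) ≤ x → c i x = x := fun i x hx => posBump_of_ge _ _ _ hx
  let b : ℕ → ℝ ≃o ℝ := fun i => if i < d.N then (c i).symm else c i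
  have hmono : Monotone fun i => (d.p i : ℝ) := fun i j hij =>
    Int.cast_le.2 (hd.strict.monotone hij)
  have hb1 : ∀ i x, x ≤ (d.p i : ℝ) → b i x = x := fun i x hx => by
    dsimp only [b]
    split_ifs
    · rw [OrderIso.symm_apply_eq, hc1 i x hx]
    · exact hc1 i x hx
  have hb2 : ∀ i x, (d.p (i + 1) : ℝ) ≤ x → b i x = x := fun i x hx => by
    dsimp only [b]
    split_ifs
    · rw [OrderIso.symm_apply_eq, hc2 i x hx]
    · exact hc2 i x hx
  obtain ⟨F, hF1, hF2, hF3⟩ := OrderIso.exists_concat b hmono hb1 hb2 d.k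
  have hNk : d.N ≤ d.k := by
    have := hd.balanced
    omega
  refine ⟨F, hF1, hF2, fun i hi => ?_, fun i hi => ⟨fun x hx => ?_, ?_⟩,
    fun i hi hik => ⟨fun x hx => ?_, ?_⟩⟩
  · rcases hi.lt_or_eq with h | rfl
    · rw [hF3 i h _ ⟨le_rfl, hmono i.le_succ⟩, hb1 i _ le_rfl]
    · exact hF2 _ le_rfl
  · rw [hF3 i (by omega) x ⟨hx.1.le, hx.2.le⟩]
    dsimp only [b]
    rw [if_pos hi, OrderIso.symm_apply_lt]
    exact lt_posBump _ _ _ hx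
  · rw [hF3 i (by omega) _ ⟨by linarith [h1 i, h2 i], by linarith [h3 i]⟩]
    dsimp only [b]
    rw [if_pos hi, OrderIso.symm_apply_eq]
    exact (posBump_mark _ _ _).symm
  · rw [hF3 i (by omega) x ⟨hx.1.le, hx.2.le⟩]
    dsimp only [b]
    rw [if_neg (by omega)]
    exact lt_posBump _ _ _ hx
  · rw [hF3 i (by omega) _ ⟨by linarith [h1 i], by linarith [h2 i, h3 i]⟩]
    dsimp only [b]
    rw [if_neg (by omega)]
    exact posBump_mark _ _ _

/-- `f` realizes the diagram `d` in the coordinate of `[-B, B]`, with small feet. -/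
structure Realizes (B : ℝ) (d : Diagram) (f : MarkedFunction) (P : ℕ → I) : Prop where
  rep : IsRep f.fn d.k d.N P
  coord_eq : ∀ i ≤ d.k, coord B (P i) = d.p i
  feet : ∀ J : orbitals f.fn, ∃ i < d.k, J.1 = (P i, P (i + 1)) ∧ ∀ x ∈ f.feet J,
    ((d.p i : ℝ) < coord B x ∧ coord B x < d.p i + 1 / 4) ∨
      ((d.p (i + 1) : ℝ) - 1 / 4 ≤ coord B x ∧ coord B x < d.p (i + 1))

theorem IsStandard.exists_realizes (hd : d.IsStandard) {B : ℝ} (hB : 0 < B)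
    (h0 : -B ≤ d.p 0) (hk : (d.p d.k : ℝ) ≤ B) : ∃ f P, Realizes B d f P := by
  have hNk : d.N ≤ d.k := by
    have := hd.balanced
    omega
  have hgap : ∀ i, (d.p i : ℝ) + 1 ≤ d.p (i + 1) := fun i => by
    exact_mod_cast hd.strict (Nat.lt_succ_self i)
  have hmono : ∀ {i j}, i ≤ j → (d.p i : ℝ) ≤ d.p j := fun hij =>
    Int.cast_le.2 (hd.strict.monotone hij)
  obtain ⟨F, hF1, hF2, hF3, hF4, hF5⟩ := hd.exists_homeo
  obtain ⟨f, hf⟩ := exists_coord_conj hB F (hF1 _ h0) (hF2 _ hk)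
  have hex : ∀ y, -B ≤ y → y ≤ B → ∃ x, coord B x = y := fun y => exists_coord_eq hB
  choose! P hP using fun (i : ℕ) (hi : i ≤ d.k) =>
    hex (d.p i) (h0.trans (hmono i.zero_le)) ((hmono hi).trans hk)
  choose! s hs using fun (i : ℕ) (hi : i < d.k) =>
    hex (d.p i + 1 / 4) (by linarith [hmono i.zero_le])
      (by linarith [hmono (Nat.succ_le_iff.2 hi), hgap i])
  choose! t ht using fun (i : ℕ) (hi : i < d.k) =>
    hex (d.p (i + 1) - 1 / 4) (by linarith [hmono i.zero_le, hgap i])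
      (by linarith [hmono (Nat.succ_le_iff.2 hi)])
  have hmem : ∀ i < d.k, ∀ x, x ∈ Set.Ioo (P i) (P (i + 1)) ↔
      coord B x ∈ Set.Ioo (d.p i : ℝ) (d.p (i + 1)) := fun i hi x => by
    rw [Set.mem_Ioo, Set.mem_Ioo, ← hP i hi.le, ← hP (i + 1) hi, coord_lt_coord hB,
      coord_lt_coord hB]
  have hrep : IsRep f d.k d.N P := by
    refine IsRep.of_bumps hd.k_pos hNk ?_ ?_ ?_ ?_ ?_
    · intro i hi
      rw [← coord_lt_coord hB, hP i hi.le, hP (i + 1) hi]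
      linarith [hgap i]
    · intro i hi
      refine coord_injective hB ?_
      rw [hf, hP i hi, hF3 i hi]
    · rintro x (hx | hx)
      · refine coord_injective hB ((hf x).trans (hF1 _ ?_))
        rw [← hP 0 (Nat.zero_le _)]
        exact ((coord_lt_coord hB).2 hx).le
      · refine coord_injective hB ((hf x).trans (hF2 _ ?_))
        rw [← hP d.k le_rfl]
        exact ((coord_lt_coord hB).2 hx).le
    · intro i hi x hx
      rw [← coord_lt_coord hB, hf]
      exact (hF4 i hi).1 _ ((hmem i (by omega) x).1 hx)
    · intro i hi hik x hx
      rw [← coord_lt_coord hB, hf]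
      exact (hF5 i hi hik).1 _ ((hmem i hik x).1 hx)
  choose ι hι1 hι2 using fun J : orbitals f => (hrep.orb J.1).1 J.2
  have hmark : ∀ J : orbitals f, s (ι J) ∈ Set.Ioo J.1.1 J.1.2 := fun J => by
    rw [hι2 J]
    refine (hmem _ (hι1 J) _).2 ?_
    rw [hs _ (hι1 J)]
    constructor <;> linarith [hgap (ι J)]
  let m : MarkedFunction := ⟨f, fun J => s (ι J), hmark⟩
  have hright : ∀ J : orbitals f, m.rightStart J = t (ι J) := fun J => by
    refine coord_injective hB ?_
    rw [ht _ (hι1 J)]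
    rcases Nat.lt_or_ge (ι J) d.N with h | h
    · have hJ : J.1 ∈ negOrbitals f := by
        rw [hι2 J]
        exact hrep.neg_mem h
      rw [MarkedFunction.rightStart_of_neg (f := m) hJ]
      change coord B (f.symm (s (ι J))) = _
      refine F.injective ?_
      rw [← hf, OrderIso.apply_symm_apply, hs _ (hι1 J), (hF4 _ h).2]
    · have hJ : J.1 ∈ posOrbitals f := by
        rw [hι2 J]
        exact hrep.pos_mem h (hι1 J)
      rw [MarkedFunction.rightStart_of_pos (f := m) hJ]
      change coord B (f (s (ι J))) = _
      rw [hf, hs _ (hι1 J), (hF5 _ h (hι1 J)).2]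
  refine ⟨m, P, hrep, hP, fun J => ⟨ι J, hι1 J, hι2 J, ?_⟩⟩
  have e1 : J.1.1 = P (ι J) := congrArg Prod.fst (hι2 J)
  have e2 : J.1.2 = P (ι J + 1) := congrArg Prod.snd (hι2 J)
  rintro x (hx | hx)
  · left
    rw [← hs _ (hι1 J), ← hP _ (hι1 J).le, coord_lt_coord hB, coord_lt_coord hB, ← e1]
    exact hx
  · right
    rw [← ht _ (hι1 J), ← hP _ (hι1 J), coord_lt_coord hB, coord_le_coord hB, ← e2]
    have hx' : m.rightStart J ≤ x ∧ x < J.1.2 := hx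
    rwa [hright] at hx'

/-! ### Fastness and levels of realizations -/

section Realizes

variable {B : ℝ} {f g : MarkedFunction} {P Q : ℕ → I}

theorem Realizes.isFast (hd : d.IsStandard) (h : Realizes B d f P) : IsFast {f} := by
  refine ⟨Set.finite_singleton _, ?_, ?_⟩
  · rintro _ rfl
    exact h.rep.finite_orbitals
  · rintro _ rfl _ rfl J K hJK
    obtain ⟨i, hi, hJ, hfJ⟩ := h.feet J
    obtain ⟨j, hj, hK, hfK⟩ := h.feet K
    have hne : i ≠ j := by
      rintro rfl
      exact hJK.elim (fun h => h rfl) fun h => h (hJ.trans hK.symm)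
    rw [Set.disjoint_left]
    intro x hx hx'
    have key : ∀ u v, u < v → (d.p u : ℝ) + 1 ≤ d.p v := fun u v huv => by
      exact_mod_cast hd.strict huv
    have k1 := key i (i + 1) (by omega)
    have k2 := key j (j + 1) (by omega)
    rcases lt_or_gt_of_ne hne with h1 | h1
    · have k3 := key i j h1
      have k4 := key (i + 1) (j + 1) (by omega)
      have k5 : (d.p (i + 1) : ℝ) ≤ d.p j := by exact_mod_cast hd.strict.monotone h1
      rcases hfJ x hx with a | a <;> rcases hfK x hx' with b | b <;> linarith [a.1, a.2, b.1, b.2]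
    · have k3 := key j i h1
      have k4 := key (j + 1) (i + 1) (by omega)
      have k5 : (d.p (j + 1) : ℝ) ≤ d.p i := by exact_mod_cast hd.strict.monotone h1
      rcases hfJ x hx with a | a <;> rcases hfK x hx' with b | b <;> linarith [a.1, a.2, b.1, b.2]

/-- Feet stay within `1 / 4` of a transition point, and distinct integers are at distance at least
`1`. -/
theorem Realizes.disjoint_feet (h : Realizes B d f P) (h' : Realizes B e g Q)
    (hde : ∀ i ≤ d.k, ∀ j ≤ e.k, d.p i ≠ e.p j) (J : orbitals f.fn) (K : orbitals g.fn) :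
    Disjoint (f.feet J) (g.feet K) := by
  obtain ⟨i, hi, -, hfJ⟩ := h.feet J
  obtain ⟨j, hj, -, hfK⟩ := h'.feet K
  rw [Set.disjoint_left]
  intro x hx hx'
  have key : ∀ u ≤ d.k, ∀ v ≤ e.k, (d.p u : ℝ) + 1 ≤ e.p v ∨ (e.p v : ℝ) + 1 ≤ d.p u :=
    fun u hu v hv => by
      rcases lt_or_gt_of_ne (hde u hu v hv) with h | h
      · left
        exact_mod_cast h
      · right
        exact_mod_cast h
  rcases hfJ x hx with a | a <;> rcases hfK x hx' with b | b
  · rcases key i hi.le j hj.le with k | k <;> linarith [a.1, a.2, b.1, b.2]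
  · rcases key i hi.le (j + 1) hj with k | k <;> linarith [a.1, a.2, b.1, b.2]
  · rcases key (i + 1) hi j hj.le with k | k <;> linarith [a.1, a.2, b.1, b.2]
  · rcases key (i + 1) hi (j + 1) hj with k | k <;> linarith [a.1, a.2, b.1, b.2]

theorem Realizes.hasLevel (hB : 0 < B) (hd : d.IsStandard) (he : e.IsStandard)
    (h : Realizes B d f P) (h' : Realizes B e g Q) {t : ℕ} (hl : Level t d e) :
    HasLevel t (f.toExpanding d.k d.N P) (g.toExpanding e.k e.N Q) := by
  have hN := hd.balanced
  have hN' := he.balanced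
  have h1 : ∀ i, coord B ((f.toExpanding d.k d.N P).l i) = d.l i :=
    fun i => h.coord_eq _ (by omega)
  have h2 : ∀ i, coord B ((f.toExpanding d.k d.N P).r i) = d.r i :=
    fun i => h.coord_eq _ (by omega)
  have h3 : ∀ i, coord B ((g.toExpanding e.k e.N Q).l i) = e.l i :=
    fun i => h'.coord_eq _ (by omega)
  have h4 : ∀ i, coord B ((g.toExpanding e.k e.N Q).r i) = e.r i :=
    fun i => h'.coord_eq _ (by omega)
  refine ⟨fun i hi => ?_, fun i hi => ?_, fun i hi => ?_, fun i hi => ?_, fun i hi => ?_,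
    fun i hi => ?_⟩
  · rw [← coord_lt_coord hB, h3, h1]
    exact_mod_cast hl.l_lt i hi
  · rw [← coord_lt_coord hB, h2, h4]
    exact_mod_cast hl.r_lt i hi
  · rw [← coord_lt_coord hB, h1, h3]
    exact_mod_cast hl.l_lt' i hi
  · rw [← coord_lt_coord hB, h4, h2]
    exact_mod_cast hl.r_lt' i hi
  · rw [← coord_le_coord hB, h2, h3]
    exact_mod_cast hl.even i hi
  · rw [← coord_le_coord hB, h4, h1]
    exact_mod_cast hl.odd i hi

end Realizes

end Diagram

/-! ### Signatures of families of diagrams -/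

/-- The signature `a` is that of a family of diagrams without common transition points. -/
def Sig.IsDrawable (a : Sig) : Prop :=
  ∃ d : ℕ → Diagram, (∀ i, (d i).IsStandard) ∧
    (∀ i < a.size, ∀ j < a.size, i ≠ j → ∀ u ≤ (d i).k, ∀ v ≤ (d j).k, (d i).p u ≠ (d j).p v) ∧
    ∀ i j, i < j → j < a.size → Diagram.Level (a.val i j) (d i) (d j)

theorem Diagram.exists_bound {d : ℕ → Diagram} (hd : ∀ i, (d i).IsStandard) (n : ℕ) :
    ∃ B : ℤ, 0 < B ∧ ∀ i < n, ∀ u ≤ (d i).k, -B < (d i).p u ∧ (d i).p u < B := by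
  refine ⟨∑ i ∈ Finset.range n, (|(d i).p 0| + |(d i).p (d i).k|) + 1, ?_, fun i hi u hu => ?_⟩
  · have : 0 ≤ ∑ i ∈ Finset.range n, (|(d i).p 0| + |(d i).p (d i).k|) :=
      Finset.sum_nonneg fun i _ => by positivity
    omega
  · have h1 : |(d i).p 0| + |(d i).p (d i).k| ≤
        ∑ i ∈ Finset.range n, (|(d i).p 0| + |(d i).p (d i).k|) :=
      Finset.single_le_sum (f := fun i => |(d i).p 0| + |(d i).p (d i).k|)
        (fun i _ => by positivity) (Finset.mem_range.2 hi)
    have h2 := (hd i).strict.monotone u.zero_le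
    have h3 := (hd i).strict.monotone hu
    have h4 := neg_abs_le ((d i).p 0)
    have h5 := le_abs_self ((d i).p (d i).k)
    have h6 := abs_nonneg ((d i).p 0)
    have h7 := abs_nonneg ((d i).p (d i).k)
    omega

/-- All diagrams are realized in one coordinate on a large interval `[-b, b]`; the absence of common
transition points gives fastness and turns levels into oscillations. -/
theorem Sig.IsDrawable.exists_hasSignature {a : Sig} (ha : a.IsDrawable) :
    ∃ A : Set MarkedFunction, IsStandardGeneratingSet A ∧ HasSignature A a := by
  obtain ⟨d, hd, hne, hlev⟩ := ha
  obtain ⟨b, hb, hbd⟩ := Diagram.exists_bound hd a.size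
  have hB : (0 : ℝ) < b := by exact_mod_cast hb
  choose e P heP using fun i : Fin a.size => (hd i).exists_realizes hB
    (by exact_mod_cast (hbd i i.2 0 (Nat.zero_le _)).1.le)
    (by exact_mod_cast (hbd i i.2 _ le_rfl).2.le)
  have hlevel : ∀ i j : Fin a.size, i < j → _ := fun i j hij =>
    Diagram.Realizes.hasLevel hB (hd i) (hd j) (heP i) (heP j) (hlev i j hij j.2)
  have hpair : ∀ i j : Fin a.size, i < j → IsStandardPair (e i) (e j) := fun i j hij =>
    (hlevel i j hij).isStandardPair (heP i).rep (heP j).rep (hd i).balanced (hd j).balanced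
      ((heP i).isFast (hd i)) ((heP j).isFast (hd j))
      ((heP i).disjoint_feet (heP j) (hne i i.2 j j.2 (Fin.val_ne_of_ne hij.ne)))
  refine ⟨Set.range e, ⟨Set.finite_range e, ?_, ?_⟩, e, rfl, fun i j hij => ⟨?_, ?_⟩⟩
  · rintro _ ⟨i, rfl⟩
    exact (heP i).rep.isStandardFunction (hd i).balanced
  · rintro _ ⟨i, rfl⟩ _ ⟨j, rfl⟩ h
    rcases lt_trichotomy i j with h1 | rfl | h1
    · exact Or.inl (hpair i j h1)
    · exact absurd rfl h
    · exact Or.inr (hpair j i h1)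
  · have h := (hlevel i j hij).precedes (heP i).rep (heP j).rep
    by_cases h0 : a.val i j = 0
    · exact Or.inl (h.1 h0)
    · exact Or.inr (h.2 h0)
  · refine (hlevel i j hij).osc_eq (heP i).rep (heP j).rep fun u hu v hv huv => ?_
    refine hne i i.2 j j.2 (Fin.val_ne_of_ne hij.ne) u hu v hv ?_
    have h := (heP i).coord_eq u hu
    rw [huv, (heP j).coord_eq v hv] at h
    exact_mod_cast h.symm

/-! ### Reflection with a new orbital, and translation -/

namespace Diagram

variable {d e : Diagram}

theorem IsStandard.l_le_r (hd : d.IsStandard) (i j : ℕ) : d.l i ≤ d.r j :=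
  hd.strict.monotone (by omega)

/-- The reflection of `d` with a new rightmost orbital, which ends at `R`. -/
def extend (d : Diagram) (R : ℤ) : Diagram where
  k := d.k + 1
  N := d.k - d.N
  -- Values beyond the index `d.k + 1` are fillers that keep `p` strictly increasing.
  p i := if i ≤ d.k then -d.p (d.k - i) else R + (i - (d.k + 1) : ℕ)

theorem extend_p_of_le {R : ℤ} {i : ℕ} (h : i ≤ d.k) : (d.extend R).p i = -d.p (d.k - i) :=
  if_pos h

theorem extend_p_last {R : ℤ} : (d.extend R).p (d.k + 1) = R := by
  simp [extend]

theorem IsStandard.extend (hd : d.IsStandard) {R : ℤ} (hR : -d.p 0 < R) :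
    (d.extend R).IsStandard where
  k_pos := Nat.succ_pos _
  balanced := by
    have := hd.balanced
    change d.k + 1 = 2 * (d.k - d.N) ∨ d.k + 1 = 2 * (d.k - d.N) + 1
    omega
  strict := strictMono_nat_of_lt_succ fun i => by
    rcases lt_trichotomy i d.k with h | rfl | h
    · rw [extend_p_of_le h.le, extend_p_of_le h, neg_lt_neg_iff]
      exact hd.strict (by omega)
    · rw [extend_p_of_le le_rfl, extend_p_last, Nat.sub_self]
      exact hR
    · simp only [Diagram.extend, if_neg h.not_ge, if_neg (h.trans i.lt_succ_self).not_ge]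
      omega

theorem IsStandard.extend_l (hd : d.IsStandard) (R : ℤ) (i : ℕ) : (d.extend R).l i = -d.r i := by
  have := hd.balanced
  change (d.extend R).p (min i (d.k - d.N)) = -d.p _
  rw [extend_p_of_le (by omega)]
  congr 2
  omega

theorem IsStandard.extend_r_zero (hd : d.IsStandard) (R : ℤ) : (d.extend R).r 0 = R := by
  have := hd.balanced
  change (d.extend R).p (max (d.k + 1 - 0) (d.k - d.N)) = R
  rw [max_eq_left (by omega)]
  exact extend_p_last

theorem IsStandard.extend_r_succ (hd : d.IsStandard) (R : ℤ) (i : ℕ) :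
    (d.extend R).r (i + 1) = -d.l i := by
  have := hd.balanced
  change (d.extend R).p (max (d.k + 1 - (i + 1)) (d.k - d.N)) = -d.p _
  rw [extend_p_of_le (by omega)]
  congr 2
  omega

/-- Reflection exchanges the left and right points, and the new right end adds one outer layer to
the nesting; this inverts the passage from a pair `(f, g)` to `(g°, f)`, applied to both members. -/
theorem Level.extend {t : ℕ} (h : Level t d e) (hd : d.IsStandard) (he : e.IsStandard)
    (hde : ∀ u ≤ d.k, ∀ v ≤ e.k, d.p u ≠ e.p v) {R S : ℤ} (hRS : R < S) (hR : -e.p 0 < R) :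
    Level (t + 1) (d.extend R) (e.extend S) := by
  have hN := hd.balanced
  have hN' := he.balanced
  -- The nesting goes one stage further than that of `h`, so the weak inequality that ends it must
  -- become strict; here the transition points have to be distinct.
  have hl : ∀ i, 2 * i + 1 ≤ t + 1 → d.r i < e.r i := fun i hi => by
    rcases (show 2 * i + 1 ≤ t ∨ t = 2 * i by omega) with h1 | h1
    · exact h.r_lt i h1
    · exact ((h.even i h1).lt_of_ne (hde _ (by omega) _ (by omega))).trans_le (he.l_le_r i i)
  have hl' : ∀ i, 2 * i + 2 ≤ t + 1 → e.r (i + 1) < d.r i := fun i hi => by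
    rcases (show 2 * i + 2 ≤ t ∨ t = 2 * i + 1 by omega) with h1 | h1
    · exact h.r_lt' i h1
    · exact ((h.odd i h1).lt_of_ne (hde _ (by omega) _ (by omega)).symm).trans_le (hd.l_le_r i i)
  refine ⟨fun i hi => ?_, fun i hi => ?_, fun i hi => ?_, fun i hi => ?_, fun i hi => ?_,
    fun i hi => ?_⟩
  · rw [hd.extend_l, he.extend_l, neg_lt_neg_iff]
    exact hl i hi
  · cases i with
    | zero => rwa [hd.extend_r_zero, he.extend_r_zero]
    | succ i =>
      rw [hd.extend_r_succ, he.extend_r_succ, neg_lt_neg_iff]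
      exact h.l_lt i (by omega)
  · rw [hd.extend_l, he.extend_l, neg_lt_neg_iff]
    exact hl' i hi
  · cases i with
    | zero =>
      rw [hd.extend_r_zero, he.extend_r_succ]
      refine lt_of_le_of_lt ?_ hR
      exact neg_le_neg (he.strict.monotone (Nat.zero_le _))
    | succ i =>
      rw [hd.extend_r_succ, he.extend_r_succ, neg_lt_neg_iff]
      exact h.l_lt' i (by omega)
  · cases i with
    | zero => omega
    | succ i =>
      rw [hd.extend_r_succ, he.extend_l]
      exact neg_le_neg (h.odd i (by omega))
  · rw [he.extend_r_succ, hd.extend_l]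
    exact neg_le_neg (h.even i (by omega))

/-- The translate of a diagram. -/
def translate (d : Diagram) (c : ℤ) : Diagram := ⟨d.k, d.N, fun i => d.p i + c⟩

theorem IsStandard.translate (hd : d.IsStandard) (c : ℤ) : (d.translate c).IsStandard :=
  ⟨hd.k_pos, hd.balanced, fun _ _ h => add_lt_add_left (hd.strict h) c⟩

theorem Level.translate {t : ℕ} (h : Level t d e) (c : ℤ) :
    Level t (d.translate c) (e.translate c) :=
  ⟨fun i hi => add_lt_add_left (h.l_lt i hi) c, fun i hi => add_lt_add_left (h.r_lt i hi) c,
    fun i hi => add_lt_add_left (h.l_lt' i hi) c, fun i hi => add_lt_add_left (h.r_lt' i hi) c,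
    fun i hi => add_le_add_left (h.even i hi) c, fun i hi => add_le_add_left (h.odd i hi) c⟩

/-- A single positive bump. -/
def single : Diagram := ⟨1, 0, fun i => i⟩

theorem isStandard_single : single.IsStandard :=
  ⟨one_pos, Or.inr rfl, Nat.strictMono_cast⟩

theorem level_zero (hd : d.IsStandard) (h : d.p d.k ≤ e.p 0) : Level 0 d e := by
  have := hd.balanced
  refine ⟨fun i hi => by omega, fun i hi => by omega, fun i hi => by omega, fun i hi => by omega,
    fun i hi => ?_, fun i hi => by omega⟩
  obtain rfl : i = 0 := by omega
  change d.p (max (d.k - 0) d.N) ≤ e.p (min 0 e.N)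
  rwa [max_eq_left (by omega), Nat.zero_min]

end Diagram

/-! ### Closure of drawable signatures under the operations of the recursion -/

namespace Sig

theorem isDrawable_zero : zero.IsDrawable :=
  ⟨fun _ => Diagram.single, fun _ => Diagram.isStandard_single, fun _ hi => absurd hi (by simp [zero]),
    fun _ _ _ hj => absurd hj (by simp [zero])⟩

theorem isDrawable_one : one.IsDrawable := by
  refine ⟨fun _ => Diagram.single, fun _ => Diagram.isStandard_single, fun i hi j hj hij => ?_,
    fun i j hij hj => ?_⟩
  · have hi : i < 1 := hi
    have hj : j < 1 := hj
    omega
  · have hj : j < 1 := hj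
    omega

theorem IsDrawable.exp {a : Sig} (ha : a.IsDrawable) : a.exp.IsDrawable := by
  obtain ⟨d, hd, hne, hlev⟩ := ha
  obtain ⟨B, -, hB⟩ := Diagram.exists_bound hd a.size
  -- The new right ends `B + i` exceed all reflected points, which lie between `-B` and `B`, and
  -- increase with `i`, as `Level.extend` requires.
  refine ⟨fun i => if i < a.size then (d i).extend (B + i) else Diagram.single, fun i => ?_,
    fun i hi j hj hij u hu v hv => ?_, fun i j hij hj => ?_⟩
  · dsimp only
    split_ifs with hi
    · refine (hd i).extend ?_
      have := (hB i hi 0 (Nat.zero_le _)).1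
      omega
    · exact Diagram.isStandard_single
  · have hi : i < a.size := hi
    have hj : j < a.size := hj
    dsimp only at hu hv ⊢
    rw [if_pos hi] at hu ⊢
    rw [if_pos hj] at hv ⊢
    have hlt : ∀ i < a.size, ∀ j : ℕ, ∀ u ≤ (d i).k, ((d i).extend (B + i)).p u < B + j :=
      fun i hi j u hu => by
        have := (hB i hi ((d i).k - u) (by omega)).1
        rw [Diagram.extend_p_of_le hu]
        omega
    rcases Nat.le_succ_iff.1 hu with hu | rfl <;> rcases Nat.le_succ_iff.1 hv with hv | rfl
    · rw [Diagram.extend_p_of_le hu, Diagram.extend_p_of_le hv, Ne, neg_inj]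
      exact hne i hi j hj hij _ (by omega) _ (by omega)
    · rw [Diagram.extend_p_last]
      exact (hlt i hi j u hu).ne
    · rw [Diagram.extend_p_last]
      exact (hlt j hj i v hv).ne'
    · rw [Diagram.extend_p_last, Diagram.extend_p_last]
      omega
  · have hj : j < a.size := hj
    dsimp only [Sig.exp]
    rw [if_pos (hij.trans hj), if_pos hj]
    refine (hlev i j hij hj).extend (hd i) (hd j)
      (hne i (hij.trans hj) j hj hij.ne) (by omega) ?_
    have := (hB j hj 0 (Nat.zero_le _)).1
    omega

theorem IsDrawable.add {a b : Sig} (ha : a.IsDrawable) (hb : b.IsDrawable) :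
    (a.add b).IsDrawable := by
  obtain ⟨d, hd, hne, hlev⟩ := ha
  obtain ⟨e, he, hne', hlev'⟩ := hb
  obtain ⟨B, -, hB⟩ := Diagram.exists_bound hd a.size
  obtain ⟨C, -, hC⟩ := Diagram.exists_bound he b.size
  have hsep : ∀ i < a.size, ∀ j < b.size, ∀ u ≤ (d i).k, ∀ v ≤ (e j).k,
      (d i).p u < ((e j).translate (B + C)).p v := fun i hi j hj u hu v hv => by
    have h1 := (hB i hi u hu).2
    have h2 := (hC j hj v hv).1
    change _ < (e j).p v + (B + C)
    omega
  -- Translation by `B + C` moves the second family to the right of the first, so mixed pairs have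
  -- level `0`.
  refine ⟨fun i => if i < a.size then d i else (e (i - a.size)).translate (B + C), fun i => ?_,
    fun i hi j hj hij u hu v hv => ?_, fun i j hij hj => ?_⟩
  · dsimp only
    split_ifs
    · exact hd i
    · exact (he _).translate _
  · have hi : i < a.size + b.size := hi
    have hj : j < a.size + b.size := hj
    dsimp only at hu hv ⊢
    split_ifs at hu hv ⊢ with h1 h2 h2
    · exact hne i h1 j h2 hij u hu v hv
    · exact (hsep i h1 _ (by omega) u hu v hv).ne
    · exact (hsep j h2 _ (by omega) v hv u hu).ne'
    · exact fun h => hne' _ (by omega) _ (by omega) (by omega) u hu v hv (add_right_cancel h)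
  · have hj : j < a.size + b.size := hj
    dsimp only [Sig.add]
    rcases Nat.lt_or_ge j a.size with h1 | h1
    · rw [if_pos ⟨by omega, h1⟩, if_pos (by omega), if_pos h1]
      exact hlev i j hij h1
    · rw [if_neg (by omega), if_neg (c := j < a.size) (by omega)]
      rcases Nat.lt_or_ge i a.size with h2 | h2
      · rw [if_neg (by omega), if_pos h2]
        exact Diagram.level_zero (hd i) (hsep i h2 _ (by omega) _ le_rfl 0 (Nat.zero_le _)).le
      · rw [if_pos ⟨h2, h1⟩, if_neg (by omega)]
        exact (hlev' _ _ (by omega) (by omega)).translate _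

end Sig

theorem isDrawable_reducedSignature (ξ : Ordinal.{0}) : (reducedSignature ξ).IsDrawable := by
  induction ξ using WellFoundedLT.induction with
  | ind ξ ih =>
    rw [reducedSignature]
    split_ifs with h0 h1
    · exact Sig.isDrawable_zero
    · exact (ih _ h1).exp.add (ih _ (Ordinal.sub_omega0_opow_log_lt h0))
    · exact Sig.isDrawable_one.add (ih _ (Ordinal.sub_omega0_opow_log_lt h0))

open Ordinal in
theorem mainTheorem8 :
    (∀ ξ : Ordinal.{0}, ξ < ε₀ →
      (∃ A : Set MarkedFunction,
        IsStandardGeneratingSet A ∧ HasSignature A (reducedSignature ξ)) ∧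
      ∀ A : Set MarkedFunction,
        IsStandardGeneratingSet A → HasSignature A (reducedSignature ξ) →
        IsElementaryAmenable (generatedGroup A) ∧
          ¬ ∃ φ : thompsonF →* generatedGroup A, Function.Injective φ) ∧
    (∀ A : Set MarkedFunction, IsStandardGeneratingSet A →
      IsElementaryAmenable (generatedGroup A)) := by
  have hEA : ∀ A : Set MarkedFunction, IsStandardGeneratingSet A →
      IsElementaryAmenable (generatedGroup A) := fun _ hA => hA.isElementaryAmenable
  refine ⟨fun ξ _ => ⟨(isDrawable_reducedSignature ξ).exists_hasSignature,
    fun A hA _ => ⟨hEA A hA, ?_⟩⟩, hEA⟩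
  rintro ⟨φ, hφ⟩
  exact not_isElementaryAmenable_thompsonF (.subgroup _ _ φ hφ (hEA A hA))
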